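/- **Setting.** Let $G$ be a simple undirected $d$-regular graph ($d\ge 1$) on $n$ vertices with random walk matrix $W=\frac1d A$, and let $\lambda(G)=\max\{\|Wx\|_2/\|x\|_2 : 0\ne x\in\mathbb R^n,\ x\perp\mathbf 1\}$. Let $X=(X_0,X_1,\dots)$ be the simple random walk on $G$ started at $X_0=$ vertex $1$. For distributions $p,q$ on a discrete set, $\|p-q\|_1=\sum_a|p(a)-q(a)|$. **Algorithms.** An algorithm is a program for a word RAM with unit-cost instructions and without coins ("deterministic"). It accesses the graph only through the unit-cost probes rand_vertex (a uniformly random vertex) and rand_neighbor$(v)$ (a uniformly random neighbour of $v$), whose answers are its only randomness. It is told $n$, $B$, $\lceil 1/\varepsilon\rceil$ and $\lceil 1/(1-\lambda)\rceil$, and it answers queries $t\in\mathbb N$, one after the other, by vertices. Between queries it keeps only a persistent memory (its internal state), which is blank at the start. The working memory is discarded after each query. It is a *local access algorithm with parameters $(\varepsilon,B)$ for $G$* if, for every sequence of $r\le B$ queries with bounded query times, fixed in advance or chosen depending on the previous answers, the joint law of the queries and answers is within $\ell_1$ distance $\varepsilon$ of the law obtained when every query $t$ is answered by $X_t$. It is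 *robust* if this remains true when each query may depend on all previous answers and internal states, in the following sense. There is a (randomized) rule, not depending on how the queries are chosen, which produces a new internal state from the path of $X$, the old internal state and the queried time, such that for every such choice of $r\le B$ queries with bounded query times the joint law of all queries, answers and internal states is within $\ell_1$ distance $\varepsilon$ of the law obtained when $X$ is drawn in advance, every query $t$ is answered by $X_t$, and the internal states are produced by the rule. **Theorem.** There are a single program and a constant $C>0$ such that for all $n$, all $d\ge1$, all $0\le\lambda<1$, $0<\varepsilon<2$, $B\in\mathbb N$, and every $d$-regular graph $G$ on $n$ vertices with $\lambda(G)\le\lambda$, the program is a robust local access algorithm with parameters $(\varepsilon,B)$ for $G$. Moreover, in every run of at most $B$ queries chosen in any (adaptive) way, when a query for time $t$ is answered and $\hat t$ is the largest time queried so far (including $t$): * the time (number of instructions and probes) and the working space (number of memory words accessed) are each at most $$C\cdot\sqrt n\cdot\log(n(t+1))\cdot\frac1{1-\lambda}\cdot\log^2\!\Big(\frac{nB}{\varepsilon}\Big);$$ * the persistent memory grows by at most $$C\cdot\log(n(\hat t+1))\cdot\frac1{1-\lambda}\cdot\log\Big(\frac{nB}{\varepsilon}\Big)$$ bits, where a nonzero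 memory cell is charged the lengths of its address and of its content; * all words used have at most $C\big(\log(n(t+1))+\log(nB/\varepsilon)+\log\frac1{1-\lambda}\big)$ bits. -/

import Mathlib

noncomputable section

namespace WalkAccess

/-! ### Random walks on a regular graph with vertex set `Fin n`; vertex `0` is the start vertex -/

section Walk

variable {n : ℕ} (G : SimpleGraph (Fin n)) [DecidableRel G.Adj]

/-- The random walk matrix of a `d`-regular graph. -/
def walkMatrix (d : ℕ) : Matrix (Fin n) (Fin n) ℝ :=
  (d : ℝ)⁻¹ • G.adjMatrix ℝ

/-- `λ(G)`: the maximum of `‖W x‖₂ / ‖x‖₂` over the nonzero vectors `x` orthogonal to the all-ones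
vector (the quotients are bounded, and the supremum is attained by compactness). -/
def spectralExpansion (d : ℕ) : ℝ :=
  sSup {q : ℝ | ∃ x : EuclideanSpace ℝ (Fin n), x ≠ 0 ∧ ∑ i, x i = 0 ∧
    q = ‖Matrix.toEuclideanLin (walkMatrix G d) x‖ / ‖x‖}

/-- One step of the random walk: a uniformly random neighbour (an isolated vertex, which cannot
occur when `1 ≤ d`, would stay where it is). -/
def neighborDist (v : Fin n) : PMF (Fin n) :=
  if h : (G.neighborFinset v).Nonempty then PMF.uniformOfFinset (G.neighborFinset v) h
  else PMF.pure v

/-- The random walk of length `len` from vertex `0`, as the law of a function whose values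
at the times `0, …, len` are the positions of the walk; the values at later times are fixed to `0`
and are never used. -/
def walkDist [NeZero n] : ℕ → PMF (ℕ → Fin n)
  | 0 => PMF.pure fun _ => 0
  | len + 1 => (walkDist len).bind fun X =>
      (neighborDist G (X len)).map fun v => Function.update X (len + 1) v

end Walk

/-- The `ℓ₁` distance of two (discrete) distributions. -/
def l1Dist {α : Type*} (p q : PMF α) : ENNReal :=
  ∑' a, ENNReal.ofReal |(p a).toReal - (q a).toReal|

/-! ### The machine model

A word RAM without coins: its only source of randomness are the probes to the graph. Programs
are structured (every loop has its number of iterations fixed on entry), so every run halts. -/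

/-- Arithmetic instructions on words. `log` is the position of the most significant bit of the
first argument; `sub` is truncated at `0`. -/
inductive ArithOp
  | add | sub | mul | div | mod | log

def ArithOp.eval : ArithOp → ℕ → ℕ → ℕ
  | add, a, b => a + b
  | sub, a, b => a - b
  | mul, a, b => a * b
  | div, a, b => a / b
  | mod, a, b => a % b
  | log, a, _ => Nat.log 2 a

/-- Programs. The natural numbers `x y z a` are names of registers, `c` is a literal. -/
inductive Cmd
  /-- `x := c` -/
  | const (x c : ℕ)
  /-- `x := y o z` -/
  | arith (o : ArithOp) (x y z : ℕ)
  /-- `x := work[a]` -/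
  | readWork (x a : ℕ)
  /-- `work[a] := x` -/
  | writeWork (a x : ℕ)
  /-- `x := store[a]` -/
  | readStore (x a : ℕ)
  /-- `store[a] := x` -/
  | writeStore (a x : ℕ)
  /-- probe: `x :=` a uniformly random vertex -/
  | randVertex (x : ℕ)
  /-- probe: `x :=` a uniformly random neighbour of the vertex `y` -/
  | randNeighbor (x y : ℕ)
  /-- `p; q` -/
  | seq (p q : Cmd)
  /-- `if x < y then p else q` -/
  | ifLt (x y : ℕ) (p q : Cmd)
  /-- execute `p` as many times as register `x` says on entry -/
  | loop (x : ℕ) (p : Cmd)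

/-- Contents of the persistent memory: sparse, and `0` in all but finitely many cells. -/
abbrev Store := ℕ →₀ ℕ

/-- Configuration of the machine while it answers one query, with its meters. -/
structure Config where
  /-- registers -/
  reg : ℕ → ℕ
  /-- working memory, discarded after the query -/
  work : ℕ → ℕ
  /-- persistent memory, kept between queries -/
  store : Store
  /-- number of instructions executed so far -/
  time : ℕ
  /-- the cells of the working memory that have been accessed -/
  touched : Finset ℕ
  /-- the largest word that has occurred -/
  peak : ℕ

namespace Config

/-- Charge one unit of time. -/
def tick (m : Config) : Config := { m with time := m.time + 1 }

/-- Assign a register, in one unit of time. -/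
def setReg (m : Config) (x v : ℕ) : Config :=
  { m with reg := Function.update m.reg x v, time := m.time + 1, peak := max m.peak v }

/-- Record an access to a cell of the working memory. -/
def touch (m : Config) (a : ℕ) : Config := { m with touched := insert a m.touched }

def setWork (m : Config) (a v : ℕ) : Config :=
  { m with work := Function.update m.work a v, time := m.time + 1,
           touched := insert a m.touched }

def setStore (m : Config) (a v : ℕ) : Config :=
  { m with store := m.store.update a v, time := m.time + 1 }

end Config

/-- Execute a random step `k` times. -/
def iterate (step : Config → PMF Config) : ℕ → Config → PMF Config
  | 0, m => PMF.pure m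
  | k + 1, m => (step m).bind (iterate step k)

section Run

variable {n : ℕ} [NeZero n] (G : SimpleGraph (Fin n)) [DecidableRel G.Adj]

/-- Answer to the probe `rand_vertex`. -/
def vertexProbe (n : ℕ) [NeZero n] : PMF ℕ :=
  (PMF.uniformOfFintype (Fin n)).map fun v => (v : ℕ)

/-- Answer to the probe `rand_neighbor`; a word that is not a vertex is answered by `0`. -/
def neighborProbe (v : ℕ) : PMF ℕ :=
  if h : v < n then (neighborDist G ⟨v, h⟩).map fun w => (w : ℕ) else PMF.pure 0

/-- The law of the configuration in which a program halts. Every instruction, every probe, every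
test and every pass through a loop costs one unit of time. -/
def run : Cmd → Config → PMF Config
  | .const x c, m => PMF.pure (m.setReg x c)
  | .arith o x y z, m => PMF.pure (m.setReg x (o.eval (m.reg y) (m.reg z)))
  | .readWork x a, m => PMF.pure ((m.touch (m.reg a)).setReg x (m.work (m.reg a)))
  | .writeWork a x, m => PMF.pure (m.setWork (m.reg a) (m.reg x))
  | .readStore x a, m => PMF.pure (m.setReg x (m.store (m.reg a)))
  | .writeStore a x, m => PMF.pure (m.setStore (m.reg a) (m.reg x))
  | .randVertex x, m => (vertexProbe n).map fun v => m.setReg x v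
  | .randNeighbor x y, m => (neighborProbe G (m.reg y)).map fun v => m.setReg x v
  | .seq p q, m => (run p m).bind (run q)
  | .ifLt x y p q, m => if m.reg x < m.reg y then run p m.tick else run q m.tick
  | .loop x p, m => iterate (fun m' => run p m'.tick) (m.reg x) m.tick

end Run

/-! ### Answering queries -/

/-- What an algorithm is told besides the query: the number `n` of vertices, the bound `B` on the
number of queries, and the reals `1 / ε` and `1 / (1 - lam)`, rounded up. -/
structure Params where
  n : ℕ
  B : ℕ
  invEps : ℕ
  invGap : ℕ

def params (n B : ℕ) (ε lam : ℝ) : Params :=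
  ⟨n, B, ⌈1 / ε⌉₊, ⌈1 / (1 - lam)⌉₊⟩

/-- The configuration in which the query for time `t` starts, with persistent memory `σ`: register
`0` holds `t`, registers `1` to `4` hold the parameters, the rest is blank. -/
def startConfig (π : Params) (t : ℕ) (σ : Store) : Config where
  reg := fun x => if x = 0 then t else if x = 1 then π.n else if x = 2 then π.B
    else if x = 3 then π.invEps else if x = 4 then π.invGap else 0
  work := fun _ => 0
  store := σ
  time := 0
  touched := ∅
  peak := max t (max π.n (max π.B (max π.invEps π.invGap)))

/-- Number of bits that the persistent memory occupies: every nonzero cell is charged the length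
of its address and the length of its content. -/
def storeBits (σ : Store) : ℕ :=
  σ.sum fun a v => Nat.size a + Nat.size v

/-- One round of the interaction: the queried time, the answer, and the internal state of the
algorithm after the answer. -/
structure Round where
  time : ℕ
  answer : ℕ
  state : Store

/-- The internal state after a history (most recent round first); initially it is blank. -/
def currentState : List Round → Store
  | [] => 0
  | ρ :: _ => ρ.state

/-- The part of a history that consists of queries and answers. -/
def visible (h : List Round) : List (ℕ × ℕ) :=
  h.map fun ρ => (ρ.time, ρ.answer)

/-- The largest time queried in a history (`0` for the empty one). -/
def maxTime : List Round → ℕ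
  | [] => 0
  | ρ :: h => max ρ.time (maxTime h)

section Interaction

variable {n : ℕ} [NeZero n] (G : SimpleGraph (Fin n)) [DecidableRel G.Adj]

/-- The final configuration of the query for time `t`, asked after the history `h`. The answer is
read off register `0`. -/
def query (P : Cmd) (π : Params) (h : List Round) (t : ℕ) : PMF Config :=
  run G P (startConfig π t (currentState h))

/-- The law of the history of the first `r` rounds, when the next query is chosen by `f` as a
function of the whole history, including all internal states. -/
def interaction (P : Cmd) (π : Params) (f : List Round → ℕ) : ℕ → PMF (List Round)
  | 0 => PMF.pure []
  | r + 1 => (interaction P π f r).bind fun h =>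
      (query G P π h (f h)).map fun m => ⟨f h, m.reg 0, m.store⟩ :: h

/-- Queries and answers of the first `r` rounds when the answers are the positions of `X` and the
next query is chosen by `g` from the previous queries and answers. -/
def readOff (g : List (ℕ × ℕ) → ℕ) (X : ℕ → Fin n) : ℕ → List (ℕ × ℕ)
  | 0 => []
  | r + 1 => (g (readOff g X r), (X (g (readOff g X r)) : ℕ)) :: readOff g X r

/-- The history of the first `r` rounds when the answers are the positions of `X`; the new internal
state is generated by `I` from `X`, the old state and the queried time. -/
def idealInteraction (I : (ℕ → Fin n) → Store → ℕ → PMF Store) (f : List Round → ℕ)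
    (X : ℕ → Fin n) : ℕ → PMF (List Round)
  | 0 => PMF.pure []
  | r + 1 => (idealInteraction I f X r).bind fun h =>
      (I X (currentState h) (f h)).map fun σ => ⟨f h, (X (f h) : ℕ), σ⟩ :: h

/-- `P` is a local access algorithm: for any sequence of at most `B` queries, fixed in advance
(`g` depends on the length of its argument only) or chosen depending on the previous answers, the
law of the answers is `ε`-close in `ℓ₁` to that of the positions of a random walk at the queried
times. `len` is any bound on the queried times. -/
def IsLocalAccess (P : Cmd) (π : Params) (B : ℕ) (ε : ℝ) : Prop :=
  ∀ (len : ℕ) (g : List (ℕ × ℕ) → ℕ), (∀ h, g h ≤ len) → ∀ r ≤ B,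
    l1Dist ((interaction G P π (fun h => g (visible h)) r).map visible)
      ((walkDist G len).map fun X => readOff g X r) ≤ ENNReal.ofReal ε

/-- `P` is robust: it stays correct if the queries also depend on its internal states. As the
queries then carry information on the states, the whole history, states included, is
compared with an ideal one: a random walk is drawn in advance, independently of the queries, all
answers are its positions, and the states are generated from the walk by a mechanism `I`
that does not depend on the choice of the queries. -/
def IsRobust (P : Cmd) (π : Params) (B : ℕ) (ε : ℝ) : Prop :=
  ∃ I : (ℕ → Fin n) → Store → ℕ → PMF Store,
    ∀ (len : ℕ) (f : List Round → ℕ), (∀ h, f h ≤ len) → ∀ r ≤ B,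
      l1Dist (interaction G P π f r)
        ((walkDist G len).bind fun X => idealInteraction I f X r) ≤ ENNReal.ofReal ε

end Interaction

end WalkAccess

end

/-! The persistent memory holds a partial record of one trajectory: cell `i` contains `v + 1` if the
walk is known to be at `v` at time `i`, and `0` if its position is unknown. A query for an
unrecorded time `t` extends the record around `t` by a sample that approximates the conditional law
of the walk given the record. By the Markov property only the nearest recorded time on either side
matters, and by mixing (`mixes_of_expansion`) even that one is irrelevant, up to a factor close to
one, at distance `h` or more, where `h` is of order `log (n B / ε) / (1 - λ)`. With `L = 2 h` there
are three kinds of extension: a uniform vertex if no recorded time is closer than `L`; a walk to `t`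
from the only near recorded time, run backwards if that time lies to the right (the walk matrix is
symmetric); a bridge between two prescribed end points if both sides are near.

Bridges are found by a birthday argument. The record never has a gap shorter than `L`
(`GapFree.extend`), so each half of a gap has length at least `h`, and the end point of a walk over
one half is nearly uniform. Among about `√n log (n B / ε)` walks from either end two meet with high
probability, and every given pair of half paths that meet is returned with nearly the conditional
probability it should have (`collisionLaw_lower`).

All errors are one-sided multiplicative factors. `matchProb` is the probability that the random walk
agrees with a record; a query turns the record `σ` into `τ` with probability at least `c` times the
ratio of the values of `matchProb` at `τ` and `σ` (`extensionLaw_lower`). These ratios telescope, so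
every history has at least `c ^ r` times its ideal probability (`mul_ideal_le_interaction`). The
bound is pointwise and thus indifferent to how queries are chosen, even from the states, because the
ideal states are a function of the walk and the queries (`fill`). It yields an `ℓ₁` distance of at
most `2 (1 - c ^ r)` (`l1Dist_le_of_mul_le`), and the constants give `c = 1 - 1 / (2 Λ)` with `Λ = n
B ⌈1 / ε⌉` (`accuracy_of_bounds`).

The program is tied to these sampling laws by `Sim`, a coupling phrased through expectations. It
transfers lower bounds on probabilities to the program and also shows that every possible run
satisfies the invariants from which the resource bounds follow. -/

noncomputable section

namespace WalkAccess

open scoped ENNReal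

/-! ### Mixing of the random walk from the spectral bound -/

section Chain

variable {n : ℕ} (G : SimpleGraph (Fin n)) [DecidableRel G.Adj] {d : ℕ}

lemma walkMatrix_apply (i j : Fin n) :
    walkMatrix G d i j = if G.Adj i j then (d : ℝ)⁻¹ else 0 := by
  simp [walkMatrix, SimpleGraph.adjMatrix_apply]

lemma walkMatrix_transpose : (walkMatrix G d).transpose = walkMatrix G d := by
  simp [walkMatrix]

lemma walkMatrix_nonneg (i j : Fin n) : 0 ≤ walkMatrix G d i j := by
  rw [walkMatrix_apply]; split_ifs <;> positivity

lemma walkMatrix_pow_nonneg (k : ℕ) (i j : Fin n) : 0 ≤ (walkMatrix G d ^ k) i j := by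
  induction k generalizing i j with
  | zero => rw [pow_zero, Matrix.one_apply]; split_ifs <;> simp
  | succ k ih =>
    rw [pow_succ, Matrix.mul_apply]
    exact Finset.sum_nonneg fun z _ => mul_nonneg (ih _ _) (walkMatrix_nonneg G _ _)

lemma walkMatrix_pow_comm (k : ℕ) (i j : Fin n) :
    (walkMatrix G d ^ k) i j = (walkMatrix G d ^ k) j i := by
  conv_lhs => rw [← walkMatrix_transpose G, ← Matrix.transpose_pow, Matrix.transpose_apply]

variable (hd : 1 ≤ d) (hG : G.IsRegularOfDegree d)
include hd hG

lemma walkMatrix_row_sum (i : Fin n) : ∑ j, walkMatrix G d i j = 1 := by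
  have h : ((G.neighborFinset i).card : ℝ) = d := by
    rw [SimpleGraph.card_neighborFinset_eq_degree, hG i]
  have hd' : (d : ℝ) ≠ 0 := by positivity
  simp only [walkMatrix_apply]
  rw [← Finset.sum_filter, Finset.sum_const, nsmul_eq_mul, ← SimpleGraph.neighborFinset_eq_filter, h]
  field_simp

lemma walkMatrix_pow_row_sum (k : ℕ) (i : Fin n) : ∑ j, (walkMatrix G d ^ k) i j = 1 := by
  induction k generalizing i with
  | zero => simp [Matrix.one_apply]
  | succ k ih =>
    simp only [pow_succ', Matrix.mul_apply]
    rw [Finset.sum_comm]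
    simp only [← Finset.mul_sum, ih, mul_one]
    exact walkMatrix_row_sum G hd hG i

lemma neighborDist_apply (u v : Fin n) :
    neighborDist G u v = ENNReal.ofReal (walkMatrix G d u v) := by
  have hc : (G.neighborFinset u).card = d := by
    rw [SimpleGraph.card_neighborFinset_eq_degree, hG u]
  have hne : (G.neighborFinset u).Nonempty := Finset.card_pos.1 (by omega)
  rw [neighborDist, dif_pos hne, PMF.uniformOfFinset_apply, walkMatrix_apply, hc]
  simp only [SimpleGraph.mem_neighborFinset]
  split_ifs
  · rw [ENNReal.ofReal_inv_of_pos (by positivity), ENNReal.ofReal_natCast]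
  · simp

omit hd hG in
-- A bound on the quotients is needed because the supremum of an unbounded set of reals is `0` by
-- default; `spectralExpansion` would then control nothing.
lemma norm_walkMatrix_le (x : EuclideanSpace ℝ (Fin n)) :
    ‖Matrix.toEuclideanLin (walkMatrix G d) x‖
      ≤ ‖(Matrix.toEuclideanLin (walkMatrix G d)).toContinuousLinearMap‖ * ‖x‖ :=
  (Matrix.toEuclideanLin (walkMatrix G d)).toContinuousLinearMap.le_opNorm x

omit hd hG in
lemma norm_walkMatrix_le_of_sum_eq_zero {lam : ℝ} (hlam : spectralExpansion G d ≤ lam)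
    (x : EuclideanSpace ℝ (Fin n)) (hx : ∑ i, x i = 0) :
    ‖Matrix.toEuclideanLin (walkMatrix G d) x‖ ≤ lam * ‖x‖ := by
  by_cases h0 : x = 0
  · simp [h0]
  have hpos : 0 < ‖x‖ := norm_pos_iff.2 h0
  rw [← div_le_iff₀ hpos]
  refine le_trans ?_ hlam
  refine le_csSup ⟨‖(Matrix.toEuclideanLin (walkMatrix G d)).toContinuousLinearMap‖, ?_⟩
    (Set.mem_ofPred_eq ▸ ⟨x, h0, hx, rfl⟩)
  rintro q ⟨y, hy, -, rfl⟩
  rw [div_le_iff₀ (norm_pos_iff.2 hy)]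
  exact norm_walkMatrix_le G y

lemma sum_walkMatrix_mulVec (x : Fin n → ℝ) :
    ∑ i, (walkMatrix G d).mulVec x i = ∑ i, x i := by
  simp only [Matrix.mulVec, dotProduct]
  rw [Finset.sum_comm]
  refine Finset.sum_congr rfl fun j _ => ?_
  rw [← Finset.sum_mul]
  have : ∀ i, walkMatrix G d i j = walkMatrix G d j i := fun i => by
    simpa using walkMatrix_pow_comm G (d := d) 1 i j
  simp only [this, walkMatrix_row_sum G hd hG, one_mul]

/-- The columns of the walk matrix also sum to one, so a vector orthogonal to the constants stays so
and the one-step contraction can be iterated. -/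
lemma norm_walkMatrix_pow_le {lam : ℝ} (h0 : 0 ≤ lam) (hlam : spectralExpansion G d ≤ lam)
    (k : ℕ) (x : EuclideanSpace ℝ (Fin n)) (hx : ∑ i, x i = 0) :
    ‖Matrix.toEuclideanLin (walkMatrix G d ^ k) x‖ ≤ lam ^ k * ‖x‖ := by
  induction k generalizing x with
  | zero => simp [Matrix.toLpLin_one]
  | succ k ih =>
    have hy : ∑ i, (Matrix.toEuclideanLin (walkMatrix G d) x) i = 0 := by
      have := sum_walkMatrix_mulVec G hd hG x.ofLp
      simpa [Matrix.toLpLin_apply, hx] using this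
    have e : Matrix.toEuclideanLin (walkMatrix G d ^ (k + 1)) x
        = Matrix.toEuclideanLin (walkMatrix G d ^ k)
          (Matrix.toEuclideanLin (walkMatrix G d) x) := by
      simp [Matrix.toLpLin_apply, pow_succ]
    rw [e]
    refine (ih _ hy).trans ?_
    rw [pow_succ, mul_assoc]
    exact mul_le_mul_of_nonneg_left
      (norm_walkMatrix_le_of_sum_eq_zero G hlam x hx) (by positivity)

/-- Entries of powers of the random walk matrix are close to uniform. -/
lemma abs_walkMatrix_pow_sub_le [NeZero n] {lam : ℝ} (h0 : 0 ≤ lam)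
    (hlam : spectralExpansion G d ≤ lam) (k : ℕ) (u v : Fin n) :
    |(walkMatrix G d ^ k) u v - 1 / n| ≤ lam ^ k := by
  have hn : (n : ℝ) ≠ 0 := by exact_mod_cast NeZero.ne n
  have hn1 : (1 : ℝ) ≤ n := by exact_mod_cast NeZero.one_le
  -- The centred indicator of `v` is orthogonal to the constants and has norm at most one; the
  -- `u`-coordinate of its image is the difference to be bounded.
  set x : EuclideanSpace ℝ (Fin n) :=
    WithLp.toLp 2 (fun i => (if i = v then (1 : ℝ) else 0) - 1 / n) with hx
  have hsum : ∑ i, x i = 0 := by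
    simp [hx, Finset.sum_sub_distrib]
  have hnorm : ‖x‖ ≤ 1 := by
    rw [EuclideanSpace.norm_eq, Real.sqrt_le_one]
    have : ∀ i, ‖x i‖ ^ 2 = (if i = v then (1 : ℝ) - 2 / n else 0) + (1 / n) ^ 2 := by
      intro i
      simp only [hx, Real.norm_eq_abs, sq_abs]
      split_ifs <;> ring
    simp only [this, Finset.sum_add_distrib, Finset.sum_ite_eq', Finset.mem_univ, if_true,
      Finset.sum_const, Finset.card_univ, Fintype.card_fin, nsmul_eq_mul]
    have : (n : ℝ) * (1 / n) ^ 2 = 1 / n := by field_simp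
    rw [this]
    have : (2 : ℝ) / n = 1 / n + 1 / n := by ring
    have : (0 : ℝ) ≤ 1 / n := by positivity
    linarith
  have hcoord : (Matrix.toEuclideanLin (walkMatrix G d ^ k) x) u
      = (walkMatrix G d ^ k) u v - 1 / n := by
    simp only [hx, Matrix.toLpLin_apply, Matrix.mulVec, dotProduct, mul_sub, mul_ite, mul_one,
      mul_zero, Finset.sum_sub_distrib, Finset.sum_ite_eq', Finset.mem_univ, if_true,
      ← Finset.sum_mul, walkMatrix_pow_row_sum G hd hG, one_mul]
  rw [← hcoord, ← Real.norm_eq_abs]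
  calc _ ≤ ‖Matrix.toEuclideanLin (walkMatrix G d ^ k) x‖ := PiLp.norm_apply_le _ _
    _ ≤ lam ^ k * ‖x‖ := norm_walkMatrix_pow_le G hd hG h0 hlam k x hsum
    _ ≤ lam ^ k := mul_le_of_le_one_right (by positivity) hnorm

/-- A regular expander has at least three vertices. -/
lemma three_le_card [NeZero n] {lam : ℝ} (h1 : lam < 1)
    (hlam : spectralExpansion G d ≤ lam) : 3 ≤ n := by
  by_contra! hlt
  have hdeg : ∀ v, d < n := fun v => by
    have := G.degree_lt_card_verts v
    rwa [hG v, Fintype.card_fin] at this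
  have := hdeg 0
  obtain rfl : n = 2 := by omega
  have hr0 := walkMatrix_row_sum G hd hG 0
  have hr1 := walkMatrix_row_sum G hd hG 1
  have hdiag : ∀ i, walkMatrix G d i i = 0 := fun i => by simp [walkMatrix_apply]
  simp only [Fin.sum_univ_two, hdiag, zero_add, add_zero] at hr0 hr1
  -- On a single edge `(1, -1)` has eigenvalue `-1`, which contradicts `lam < 1`.
  have h := norm_walkMatrix_le_of_sum_eq_zero G hlam (WithLp.toLp 2 ![1, -1]) (by simp)
  have e : Matrix.toEuclideanLin (walkMatrix G d) (WithLp.toLp 2 ![1, -1])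
      = -(WithLp.toLp 2 ![1, -1]) := by
    ext i
    fin_cases i <;> simp [Matrix.toLpLin_apply, hdiag, hr0, hr1]
  rw [e, norm_neg] at h
  have hpos : 0 < ‖(WithLp.toLp 2 ![1, -1] : EuclideanSpace ℝ (Fin 2))‖ := by
    rw [norm_pos_iff]
    intro hh
    have := congrArg (fun x : EuclideanSpace ℝ (Fin 2) => x 0) hh
    simp at this
  nlinarith

end Chain

/-! ### Expectations under discrete distributions -/

/-- Expectation of a nonnegative function under a discrete distribution. -/
def expect {α : Type*} (p : PMF α) (f : α → ℝ≥0∞) : ℝ≥0∞ := ∑' a, p a * f a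

section Expect

variable {α β : Type*}

@[simp] lemma expect_pure (a : α) (f : α → ℝ≥0∞) : expect (PMF.pure a) f = f a := by
  classical
  rw [expect, tsum_eq_single a]
  · simp
  · intro b hb
    simp [hb]

lemma expect_bind (p : PMF α) (k : α → PMF β) (f : β → ℝ≥0∞) :
    expect (p.bind k) f = expect p fun a => expect (k a) f := by
  simp only [expect, PMF.bind_apply, ← ENNReal.tsum_mul_right, ← ENNReal.tsum_mul_left]
  rw [ENNReal.tsum_comm]
  simp only [mul_assoc]

lemma expect_map (p : PMF α) (g : α → β) (f : β → ℝ≥0∞) :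
    expect (p.map g) f = expect p fun a => f (g a) := by
  simp [PMF.map, expect_bind]

lemma expect_mono_support {p : PMF α} {f g : α → ℝ≥0∞} (h : ∀ a ∈ p.support, f a ≤ g a) :
    expect p f ≤ expect p g := by
  refine ENNReal.tsum_le_tsum fun a => ?_
  by_cases ha : a ∈ p.support
  · exact mul_le_mul_right (h a ha) _
  · rw [PMF.mem_support_iff, not_not] at ha
    simp [ha]

lemma expect_mono {p : PMF α} {f g : α → ℝ≥0∞} (h : ∀ a, f a ≤ g a) :
    expect p f ≤ expect p g :=
  expect_mono_support fun a _ => h a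

@[simp] lemma expect_const (p : PMF α) (c : ℝ≥0∞) : expect p (fun _ => c) = c := by
  rw [expect, ENNReal.tsum_mul_right, PMF.tsum_coe, one_mul]

lemma expect_add (p : PMF α) (f g : α → ℝ≥0∞) :
    expect p (fun a => f a + g a) = expect p f + expect p g := by
  simp only [expect, mul_add, ENNReal.tsum_add]

lemma expect_mul_left (p : PMF α) (c : ℝ≥0∞) (f : α → ℝ≥0∞) :
    expect p (fun a => c * f a) = c * expect p f := by
  simp only [expect, ← ENNReal.tsum_mul_left]
  exact tsum_congr fun a => by ring

lemma expect_mul_right (p : PMF α) (c : ℝ≥0∞) (f : α → ℝ≥0∞) :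
    expect p (fun a => f a * c) = expect p f * c := by
  simp only [expect, ← ENNReal.tsum_mul_right, mul_assoc]

lemma expect_finset_sum {ι : Type*} (s : Finset ι) (p : PMF α) (f : ι → α → ℝ≥0∞) :
    expect p (fun a => ∑ i ∈ s, f i a) = ∑ i ∈ s, expect p (f i) := by
  classical
  induction s using Finset.induction_on with
  | empty => simp
  | insert i s hi ih => simp only [Finset.sum_insert hi, expect_add, ih]

open Classical in
lemma expect_eq_apply (p : PMF α) (a : α) :
    expect p (fun b => if b = a then 1 else 0) = p a := by
  rw [expect, tsum_eq_single a]
  · simp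
  · intro b hb
    simp [hb]

lemma mul_le_expect (p : PMF α) (a : α) (f : α → ℝ≥0∞) : p a * f a ≤ expect p f :=
  ENNReal.le_tsum (f := fun a => p a * f a) a

lemma expect_fintype [Fintype α] (p : PMF α) (f : α → ℝ≥0∞) :
    expect p f = ∑ a, p a * f a := tsum_fintype _

/-- If `f ≤ 1` has expectation one, a point of positive mass where `f` vanishes is impossible:
adding the indicator of that point would keep the function below one and push its expectation above
one. -/
lemma forall_support_of_le_expect {p : PMF α} {S : α → Prop} {f : α → ℝ≥0∞}
    (hf : ∀ a, f a ≤ 1) (hS : ∀ a, ¬ S a → f a = 0) (h : 1 ≤ expect p f) :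
    ∀ a ∈ p.support, S a := by
  intro a ha
  by_contra hna
  rw [PMF.mem_support_iff] at ha
  have h1 : expect p f + p a ≤ 1 := by
    classical
    calc expect p f + p a = expect p f + expect p (fun b => if b = a then 1 else 0) := by
          rw [expect_eq_apply]
      _ = expect p (fun b => f b + if b = a then 1 else 0) := (expect_add _ _ _).symm
      _ ≤ expect p (fun _ => 1) := expect_mono fun b => by
          split_ifs with hb
          · rw [hb, hS a hna, zero_add]
          · simpa using hf b
      _ = 1 := expect_const _ _
  have h2 : (1 : ℝ≥0∞) + p a ≤ 1 := (add_le_add_left h _).trans h1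
  have : (1 : ℝ≥0∞) + p a ≤ 1 + 0 := by simpa using h2
  exact ha (le_antisymm ((ENNReal.add_le_add_iff_left ENNReal.one_ne_top).1 this) bot_le)

end Expect

/-! ### The law of the walk as a product of transition probabilities -/

section Walks

variable {n : ℕ} [NeZero n] (G : SimpleGraph (Fin n)) [DecidableRel G.Adj] (d : ℕ)

/-- The product of the transition probabilities of `X` over the times `i, …, i + k`. -/
def pathWeight (X : ℕ → Fin n) (i k : ℕ) : ℝ :=
  ∏ j ∈ Finset.range k, walkMatrix G d (X (i + j)) (X (i + j + 1))

omit [NeZero n] in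
lemma pathWeight_nonneg (X : ℕ → Fin n) (i k : ℕ) : 0 ≤ pathWeight G d X i k :=
  Finset.prod_nonneg fun _ _ => walkMatrix_nonneg G _ _

/-- The random walk of length `k` from `u`; the values at later times are `0`. -/
def walkFrom (u : Fin n) : ℕ → PMF (ℕ → Fin n)
  | 0 => PMF.pure fun i => if i = 0 then u else 0
  | k + 1 => (walkFrom u k).bind fun X =>
      (neighborDist G (X k)).map fun v => Function.update X (k + 1) v

lemma walkDist_eq_walkFrom (k : ℕ) : walkDist G k = walkFrom G 0 k := by
  induction k with
  | zero => simp [walkDist, walkFrom]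
  | succ k ih => simp [walkDist, walkFrom, ih]

variable {d} (hd : 1 ≤ d) (hG : G.IsRegularOfDegree d)
include hd hG

open Classical in
lemma walkFrom_apply (u : Fin n) (k : ℕ) (X : ℕ → Fin n) :
    walkFrom G u k X
      = if X 0 = u ∧ ∀ i, k < i → X i = 0 then ENNReal.ofReal (pathWeight G d X 0 k) else 0 := by
  induction k generalizing X with
  | zero =>
    simp only [walkFrom, PMF.pure_apply, pathWeight, Finset.range_zero, Finset.prod_empty,
      ENNReal.ofReal_one]
    refine if_congr ?_ rfl rfl
    constructor
    · rintro rfl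
      exact ⟨rfl, fun i hi => if_neg hi.ne'⟩
    · rintro ⟨h0, h⟩
      funext i
      by_cases hi : i = 0
      · simp [hi, h0]
      · simp [hi, h i (Nat.pos_of_ne_zero hi)]
  | succ k ih =>
    -- Positions after the end of a walk are pinned to `0`, so `Y` is the only walk of length `k`
    -- that can be prolonged to `X`.
    set Y := Function.update X (k + 1) 0 with hY
    rw [walkFrom, PMF.bind_apply, tsum_eq_single Y]
    · have hmap : ((neighborDist G (Y k)).map fun v => Function.update Y (k + 1) v) X
          = ENNReal.ofReal (walkMatrix G d (X k) (X (k + 1))) := by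
        rw [PMF.map_apply, tsum_eq_single (X (k + 1)), if_pos, neighborDist_apply G hd hG]
        · simp [hY]
        · simp [hY]
        · intro v hv
          rw [if_neg]
          intro h
          apply hv
          rw [h]
          simp
      have hw : pathWeight G d Y 0 k = pathWeight G d X 0 k := by
        refine Finset.prod_congr rfl fun j hj => ?_
        rw [Finset.mem_range] at hj
        simp [hY, Function.update_of_ne (show j ≠ k + 1 by omega),
          Function.update_of_ne (show j + 1 ≠ k + 1 by omega)]
      rw [hmap, ih, hw]
      have hcond : (Y 0 = u ∧ ∀ i, k < i → Y i = 0) ↔ (X 0 = u ∧ ∀ i, k + 1 < i → X i = 0) := by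
        rw [hY, Function.update_of_ne (by omega)]
        refine and_congr Iff.rfl ⟨fun h i hi => ?_, fun h i hi => ?_⟩
        · have := h i (by omega)
          rwa [Function.update_of_ne (by omega)] at this
        · by_cases hik : i = k + 1
          · simp [hik]
          · rw [Function.update_of_ne hik]
            exact h i (by omega)
      rw [if_congr hcond rfl rfl, ite_mul, zero_mul]
      refine if_congr Iff.rfl ?_ rfl
      rw [← ENNReal.ofReal_mul (pathWeight_nonneg _ _ _ _ _)]
      simp only [pathWeight, Finset.prod_range_succ, zero_add]
    · intro Z hZ
      by_contra hne
      obtain ⟨h1, h2⟩ := mul_ne_zero_iff.1 hne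
      rw [ih] at h1
      have hc : Z 0 = u ∧ ∀ i, k < i → Z i = 0 := by
        by_contra hc
        exact h1 (if_neg hc)
      have : X ∈ ((neighborDist G (Z k)).map fun v => Function.update Z (k + 1) v).support :=
        (PMF.mem_support_iff _ _).2 h2
      rw [PMF.mem_support_map_iff] at this
      obtain ⟨v, -, rfl⟩ := this
      apply hZ
      rw [hY, Function.update_idem, eq_comm, Function.update_eq_self_iff]
      exact (hc.2 (k + 1) (by omega)).symm

lemma expect_walkFrom_end (u : Fin n) (k : ℕ) (f : Fin n → ℝ≥0∞) :
    expect (walkFrom G u k) (fun X => f (X k))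
      = ∑ v, ENNReal.ofReal ((walkMatrix G d ^ k) u v) * f v := by
  induction k generalizing f with
  | zero =>
    have h : ∀ x, ENNReal.ofReal (if u = x then 1 else 0) * f x = if u = x then f x else 0 := by
      intro x
      split_ifs <;> simp
    simp [walkFrom, Matrix.one_apply, h]
  | succ k ih =>
    simp only [walkFrom, expect_bind, expect_map, Function.update_self]
    simp only [expect_fintype, neighborDist_apply G hd hG]
    rw [ih (fun z => ∑ v, ENNReal.ofReal (walkMatrix G d z v) * f v)]
    simp only [Finset.mul_sum]
    rw [Finset.sum_comm]
    refine Finset.sum_congr rfl fun v _ => ?_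
    rw [pow_succ, Matrix.mul_apply, ENNReal.ofReal_sum_of_nonneg, Finset.sum_mul]
    · refine Finset.sum_congr rfl fun z _ => ?_
      rw [ENNReal.ofReal_mul (walkMatrix_pow_nonneg G _ _ _), mul_assoc]
    · exact fun z _ => mul_nonneg (walkMatrix_pow_nonneg G _ _ _) (walkMatrix_nonneg G _ _)

lemma map_walkFrom_end (u v : Fin n) (k : ℕ) :
    (walkFrom G u k).map (fun X => X k) v = ENNReal.ofReal ((walkMatrix G d ^ k) u v) := by
  classical
  rw [← expect_eq_apply, expect_map]
  refine Eq.trans ?_ ((expect_walkFrom_end G hd hG u k (fun b => if b = v then 1 else 0)).trans ?_)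
  · congr!
  · simp

end Walks

/-! ### Images of uniformly random functions -/

section Occupancy

variable {ι : Type*} [Fintype ι] [DecidableEq ι]

/-- The sum of `Ψ (image f)` over all functions `f` from a set with `K` elements to `ι`. -/
def imageSum : ℕ → (Finset ι → ℝ≥0∞) → ℝ≥0∞
  | 0, Ψ => Ψ ∅
  | K + 1, Ψ => ∑ e, imageSum K fun D => Ψ (insert e D)

lemma imageSum_mono {K : ℕ} {Φ Ψ : Finset ι → ℝ≥0∞} (h : ∀ D, Φ D ≤ Ψ D) :
    imageSum K Φ ≤ imageSum K Ψ := by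
  induction K generalizing Φ Ψ with
  | zero => exact h _
  | succ K ih => exact Finset.sum_le_sum fun e _ => ih fun D => h _

lemma imageSum_const (K : ℕ) (c : ℝ≥0∞) :
    imageSum K (fun _ : Finset ι => c) = (Fintype.card ι : ℝ≥0∞) ^ K * c := by
  induction K with
  | zero => simp [imageSum]
  | succ K ih =>
    simp only [imageSum, ih, Finset.sum_const, Finset.card_univ, nsmul_eq_mul]
    ring

lemma imageSum_add (K : ℕ) (Φ Ψ : Finset ι → ℝ≥0∞) :
    imageSum K (fun D => Φ D + Ψ D) = imageSum K Φ + imageSum K Ψ := by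
  induction K generalizing Φ Ψ with
  | zero => rfl
  | succ K ih =>
    simp only [imageSum, ih, Finset.sum_add_distrib]

lemma imageSum_sum {κ : Type*} (s : Finset κ) (K : ℕ) (Φ : κ → Finset ι → ℝ≥0∞) :
    imageSum K (fun D => ∑ i ∈ s, Φ i D) = ∑ i ∈ s, imageSum K (Φ i) := by
  classical
  induction s using Finset.induction_on with
  | empty => simpa using imageSum_const K (0 : ℝ≥0∞)
  | insert i s hi ih => simp only [Finset.sum_insert hi, imageSum_add, ih]

lemma imageSum_mul_left (K : ℕ) (c : ℝ≥0∞) (Ψ : Finset ι → ℝ≥0∞) :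
    imageSum K (fun D => c * Ψ D) = c * imageSum K Ψ := by
  induction K generalizing Ψ with
  | zero => rfl
  | succ K ih => simp only [imageSum, ih, Finset.mul_sum]

/-- Composition with a permutation is a bijection on the set of functions. This symmetry is what
makes the collision vertex uniform. -/
lemma imageSum_map (π : Equiv.Perm ι) (K : ℕ) (Ψ : Finset ι → ℝ≥0∞) :
    imageSum K (fun D => Ψ (D.map π.toEmbedding)) = imageSum K Ψ := by
  induction K generalizing Ψ with
  | zero => simp [imageSum]
  | succ K ih =>
    simp only [imageSum, Finset.map_insert]
    rw [← Equiv.sum_comp π fun e => imageSum K fun D => Ψ (insert e D)]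
    refine Finset.sum_congr rfl fun e _ => ?_
    exact ih fun D => Ψ (insert (π e) D)

lemma imageSum_subset (K : ℕ) (S : Finset ι) :
    imageSum K (fun D => if D ⊆ S then (1 : ℝ≥0∞) else 0) = (S.card : ℝ≥0∞) ^ K := by
  induction K with
  | zero => simp [imageSum]
  | succ K ih =>
    simp only [imageSum, Finset.insert_subset_iff]
    have h : ∀ e, imageSum K (fun D => if e ∈ S ∧ D ⊆ S then (1 : ℝ≥0∞) else 0)
        = if e ∈ S then (S.card : ℝ≥0∞) ^ K else 0 := by
      intro e
      by_cases he : e ∈ S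
      · simp [he, ih]
      · simpa [he] using imageSum_const K (0 : ℝ≥0∞)
    simp only [h, ← Finset.sum_filter]
    simp [pow_succ, mul_comm]

/-- Union bound: a small image lies in a set of exactly `s` elements, and `s ^ K` functions map into
a given such set. -/
lemma imageSum_card_lt_le {s : ℕ} (hs : s ≤ Fintype.card ι) (K : ℕ) :
    imageSum K (fun D : Finset ι => if D.card < s then (1 : ℝ≥0∞) else 0)
      ≤ ((Fintype.card ι).choose s : ℝ≥0∞) * (s : ℝ≥0∞) ^ K := by
  calc imageSum K (fun D : Finset ι => if D.card < s then (1 : ℝ≥0∞) else 0)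
      ≤ imageSum K (fun D => ∑ S ∈ Finset.powersetCard s (Finset.univ : Finset ι),
          if D ⊆ S then (1 : ℝ≥0∞) else 0) := by
        refine imageSum_mono fun D => ?_
        split_ifs with hD
        · obtain ⟨S, hDS, -, hS⟩ :=
            Finset.exists_subsuperset_card_eq (Finset.subset_univ D) hD.le (by simpa using hs)
          calc (1 : ℝ≥0∞) = if D ⊆ S then (1 : ℝ≥0∞) else 0 := (if_pos hDS).symm
            _ ≤ _ := Finset.single_le_sum (f := fun S => if D ⊆ S then (1 : ℝ≥0∞) else 0)
                (fun _ _ => zero_le) (Finset.mem_powersetCard.2 ⟨Finset.subset_univ _, hS⟩)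
        · exact zero_le
    _ = _ := by
        rw [imageSum_sum]
        simp only [imageSum_subset]
        rw [Finset.sum_congr rfl (g := fun _ => (s : ℝ≥0∞) ^ K)
          (fun S hS => by rw [(Finset.mem_powersetCard.1 hS).2])]
        simp

/-- By symmetry, an element of a large random image is uniformly distributed. -/
lemma card_mul_imageSum_mem {s : ℕ} (hs : 1 ≤ s) (K : ℕ) (w : ι) :
    (Fintype.card ι : ℝ≥0∞) * imageSum K (fun D : Finset ι => if w ∈ D then
        (if s ≤ D.card then (D.card : ℝ≥0∞)⁻¹ else 0) else 0)
      = imageSum K (fun D : Finset ι => if s ≤ D.card then (1 : ℝ≥0∞) else 0) := by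
  have hsym : ∀ v, imageSum K (fun D : Finset ι => if v ∈ D then
        (if s ≤ D.card then (D.card : ℝ≥0∞)⁻¹ else 0) else 0)
      = imageSum K (fun D : Finset ι => if w ∈ D then
        (if s ≤ D.card then (D.card : ℝ≥0∞)⁻¹ else 0) else 0) := by
    intro v
    rw [← imageSum_map (Equiv.swap v w)]
    congr 1
    funext D
    refine if_congr ?_ (by simp) rfl
    rw [Finset.mem_map_equiv]
    simp
  calc _ = ∑ v : ι, imageSum K (fun D : Finset ι => if v ∈ D then
        (if s ≤ D.card then (D.card : ℝ≥0∞)⁻¹ else 0) else 0) := by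
        simp only [hsym, Finset.sum_const, Finset.card_univ, nsmul_eq_mul]
    _ = _ := by
        rw [← imageSum_sum]
        congr 1
        funext D
        rw [← Finset.sum_filter]
        simp only [Finset.filter_mem_eq_inter, Finset.univ_inter, Finset.sum_const, nsmul_eq_mul]
        split_ifs with h
        · exact ENNReal.mul_inv_cancel (by simp only [ne_eq, Nat.cast_eq_zero]; omega) (by simp)
        · simp

end Occupancy

/-! ### Collisions of two families of samples -/

section Collision

variable {ι β γ : Type*} [Fintype ι] [DecidableEq ι] (p : PMF β) (e : β → ι) (q : PMF γ)
  (e' : γ → ι)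

/-- A table that holds, for every value of `e`, the last of `K` samples from `p` with this value. -/
def tableLaw : ℕ → PMF (ι → Option β)
  | 0 => PMF.pure fun _ => none
  | K + 1 => (tableLaw K).bind fun T => p.map fun b => Function.update T (e b) (some b)

/-- The first of `K` samples from `q` whose value of `e'` is in the table. -/
def hitLaw (T : ι → Option β) : ℕ → PMF (Option γ)
  | 0 => PMF.pure none
  | K + 1 => (hitLaw T K).bind fun o => match o with
    | some c => PMF.pure (some c)
    | none => q.map fun c => if (T (e' c)).isSome then some c else none

/-- Samples from `p` and `q`, at most `K` of each kind, with a collision. -/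
def collisionLaw (K : ℕ) : PMF (Option (β × γ)) :=
  (tableLaw p e K).bind fun T => (hitLaw q e' T K).map fun o =>
    o.bind fun c => (T (e' c)).map fun b => (b, c)

/-- The domain of a table. -/
def tableDom (T : ι → Option β) : Finset ι := Finset.univ.filter fun w => (T w).isSome

omit [DecidableEq ι] in
lemma mem_tableDom {T : ι → Option β} {w : ι} : w ∈ tableDom T ↔ (T w).isSome := by
  simp [tableDom]

lemma tableDom_update (T : ι → Option β) (w : ι) (b : β) :
    tableDom (Function.update T w (some b)) = insert w (tableDom T) := by
  ext v
  by_cases h : v = w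
  · subst h; simp [mem_tableDom]
  · simp [mem_tableDom, h]

omit [DecidableEq ι] in
lemma expect_comp_eq_sum (f : ι → ℝ≥0∞) :
    expect p (fun b => f (e b)) = ∑ w, p.map e w * f w := by
  rw [← expect_map, expect_fintype]

variable {p e q e'} {lo hi : ℝ≥0∞}

/-- Every sequence of `K` values of `e` has probability at least `lo ^ K`, so the samples dominate
the sum over all functions up to this factor. -/
lemma imageSum_le_expect_tableDom (hlo : ∀ w, lo ≤ p.map e w) (K : ℕ) (Φ : Finset ι → ℝ≥0∞) :
    lo ^ K * imageSum K Φ ≤ expect (tableLaw p e K) fun T => Φ (tableDom T) := by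
  induction K generalizing Φ with
  | zero =>
    have : tableDom (fun _ : ι => (none : Option β)) = ∅ := by
      ext; simp [mem_tableDom]
    simp [imageSum, tableLaw, this]
  | succ K ih =>
    simp only [tableLaw, expect_bind, expect_map, tableDom_update]
    calc lo ^ (K + 1) * imageSum (K + 1) Φ
        = ∑ w, lo * (lo ^ K * imageSum K fun D => Φ (insert w D)) := by
          simp only [imageSum, Finset.mul_sum]
          exact Finset.sum_congr rfl fun w _ => by ring
      _ ≤ ∑ w, p.map e w * expect (tableLaw p e K) fun T => Φ (insert w (tableDom T)) :=
          Finset.sum_le_sum fun w _ => mul_le_mul' (hlo w) (ih _)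
      _ = _ := by
          have h : ∀ T : ι → Option β, expect p (fun b => Φ (insert (e b) (tableDom T)))
              = ∑ w, p.map e w * Φ (insert w (tableDom T)) := fun T =>
            expect_comp_eq_sum p e fun w => Φ (insert w (tableDom T))
          simp only [h, expect_finset_sum, expect_mul_left]

open Classical in
-- Given the values of `e`, the entry at `e b` is a sample conditioned on having this value; it
-- equals `b` with probability `p b / p.map e (e b)` whatever the domain of the table is. The
-- division is cleared to avoid zero denominators. The induction looks at the last sample: if it has
-- the value `e b` it must be `b` itself, otherwise the entry must already be `b`.
lemma imageSum_le_expect_table (hlo : ∀ w, lo ≤ p.map e w) (b : β) (K : ℕ)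
    (Φ : Finset ι → ℝ≥0∞) :
    p b * (lo ^ K * imageSum K fun D => if e b ∈ D then Φ D else 0)
      ≤ p.map e (e b) * expect (tableLaw p e K)
          fun T => if T (e b) = some b then Φ (tableDom T) else 0 := by
  induction K generalizing Φ with
  | zero => simp [imageSum]
  | succ K ih =>
    set w := e b with hw
    have hstep : ∀ T : ι → Option β,
        p b * Φ (insert w (tableDom T)) + ∑ v ∈ Finset.univ.erase w, p.map e v *
          (if T w = some b then Φ (insert v (tableDom T)) else 0)
        ≤ expect p fun b' => if Function.update T (e b') (some b') w = some b then
          Φ (insert (e b') (tableDom T)) else 0 := by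
      intro T
      have h1 : ∑ v ∈ Finset.univ.erase w, p.map e v *
          (if T w = some b then Φ (insert v (tableDom T)) else 0)
          = expect p fun b' => if e b' = w then 0 else
            (if T w = some b then Φ (insert (e b') (tableDom T)) else 0) := by
        rw [expect_comp_eq_sum p e fun v => if v = w then 0 else
            (if T w = some b then Φ (insert v (tableDom T)) else 0),
          ← Finset.add_sum_erase _ _ (Finset.mem_univ w)]
        simp only [if_true, mul_zero, zero_add]
        refine Finset.sum_congr rfl fun v hv => ?_
        rw [if_neg (Finset.ne_of_mem_erase hv)]
      have h2 : p b * Φ (insert w (tableDom T))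
          = expect p fun b' => (if b' = b then 1 else 0) * Φ (insert w (tableDom T)) := by
        rw [expect_mul_right, expect_eq_apply]
      rw [h1, h2, ← expect_add]
      refine expect_mono fun b' => ?_
      by_cases hb : e b' = w
      · rw [if_pos hb, add_zero, hb, Function.update_self]
        simp only [Option.some.injEq]
        split_ifs <;> simp
      · have hne : b' ≠ b := fun h => hb (by rw [h])
        rw [if_neg hb, if_neg hne, zero_mul, zero_add, Function.update_of_ne (Ne.symm hb)]
    simp only [tableLaw, expect_bind, expect_map, tableDom_update]
    refine le_trans ?_ (mul_le_mul_right (expect_mono hstep) _)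
    rw [expect_add, expect_mul_left, expect_finset_sum]
    simp only [expect_mul_left]
    rw [mul_add, Finset.mul_sum]
    have hS : imageSum (K + 1) (fun D => if w ∈ D then Φ D else 0)
        = imageSum K (fun D => Φ (insert w D)) + ∑ v ∈ Finset.univ.erase w,
          imageSum K fun D => if w ∈ D then Φ (insert v D) else 0 := by
      rw [imageSum, ← Finset.add_sum_erase _ _ (Finset.mem_univ w)]
      congr 1
      · simp
      · refine Finset.sum_congr rfl fun v hv => ?_
        have : w ≠ v := (Finset.ne_of_mem_erase hv).symm
        simp [this]
    rw [hS, mul_add, mul_add, Finset.mul_sum, Finset.mul_sum]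
    refine add_le_add ?_ (Finset.sum_le_sum fun v _ => ?_)
    · calc p b * (lo ^ (K + 1) * imageSum K fun D => Φ (insert w D))
          = lo * (p b * (lo ^ K * imageSum K fun D => Φ (insert w D))) := by ring
        _ ≤ _ := mul_le_mul' (hlo w)
            (mul_le_mul_right (imageSum_le_expect_tableDom hlo K fun D => Φ (insert w D)) _)
    · calc p b * (lo ^ (K + 1) * imageSum K fun D => if w ∈ D then Φ (insert v D) else 0)
          = lo * (p b * (lo ^ K * imageSum K fun D => if w ∈ D then Φ (insert v D) else 0)) := by
            ring
        _ ≤ p.map e v * _ := mul_le_mul' (hlo v) (ih fun D => Φ (insert v D))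
        _ = _ := by ring

variable (q e') in
/-- The probability that a sample misses a set. -/
def missProb (D : Finset ι) : ℝ≥0∞ := expect q fun c => if e' c ∈ D then 0 else 1

omit [Fintype ι] in
lemma missProb_add (D : Finset ι) :
    missProb q e' D + expect q (fun c => if e' c ∈ D then 1 else 0) = 1 := by
  rw [missProb, ← expect_add]
  refine Eq.trans ?_ (expect_const q 1)
  congr 1
  funext c
  split_ifs <;> simp

lemma hitLaw_none (T : ι → Option β) (K : ℕ) :
    hitLaw q e' T K none = missProb q e' (tableDom T) ^ K := by
  classical
  induction K with
  | zero => simp [hitLaw]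
  | succ K ih =>
    rw [← expect_eq_apply, hitLaw, expect_bind, pow_succ, ← ih, ← expect_eq_apply,
      ← expect_mul_right]
    congr 1
    funext o
    cases o with
    | some c => simp
    | none =>
      simp only [expect_map, missProb, if_true, one_mul, mem_tableDom]
      congr 1
      funext c
      split_ifs <;> simp_all

/-- The first hit comes after some number `k < K` of misses, which gives a geometric sum. -/
lemma hitLaw_some (T : ι → Option β) {c : γ} (hc : (T (e' c)).isSome) (K : ℕ) :
    hitLaw q e' T K (some c)
      = q c * ∑ k ∈ Finset.range K, missProb q e' (tableDom T) ^ k := by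
  classical
  induction K with
  | zero => simp [hitLaw]
  | succ K ih =>
    rw [Finset.sum_range_succ, mul_add, ← ih, ← hitLaw_none, ← expect_eq_apply, hitLaw,
      expect_bind, ← expect_eq_apply, mul_comm (q c), ← expect_eq_apply _ none,
      ← expect_mul_right, ← expect_add]
    congr 1
    funext o
    cases o with
    | some c' => simp
    | none =>
      simp only [expect_map, reduceCtorEq, if_false, if_true, zero_add, one_mul]
      rw [← expect_eq_apply]
      congr 1
      funext c'
      by_cases h : c' = c
      · subst h; simp [hc]
      · rw [if_neg h, if_neg]
        split_ifs <;> simp [h]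

omit [Fintype ι] in
-- Either all `K` attempts miss or there is a first hit: the geometric series in a form free of
-- subtraction and division.
lemma missProb_pow_add (D : Finset ι) (K : ℕ) :
    missProb q e' D ^ K + expect q (fun c => if e' c ∈ D then 1 else 0)
      * ∑ k ∈ Finset.range K, missProb q e' D ^ k = 1 := by
  induction K with
  | zero => simp
  | succ K ih =>
    rw [Finset.sum_range_succ, mul_add, pow_succ]
    calc _ = missProb q e' D ^ K * (missProb q e' D
            + expect q (fun c => if e' c ∈ D then 1 else 0))
            + expect q (fun c => if e' c ∈ D then 1 else 0)
            * ∑ k ∈ Finset.range K, missProb q e' D ^ k := by ring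
      _ = 1 := by rw [missProb_add, mul_one, ih]

lemma expect_mem_eq_sum (D : Finset ι) :
    expect q (fun c => if e' c ∈ D then 1 else 0) = ∑ w ∈ D, q.map e' w := by
  rw [expect_comp_eq_sum q e' fun w => if w ∈ D then 1 else 0]
  simp

/-- If the values of the samples are nearly uniform, then every colliding pair is found with nearly
the probability it has given that there is a collision. -/
lemma collisionLaw_lower (hlo : ∀ w, lo ≤ p.map e w)
    (hhi : ∀ w, p.map e w ≤ hi) (hlo' : ∀ w, lo ≤ q.map e' w) (hhi' : ∀ w, q.map e' w ≤ hi)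
    {s K : ℕ} (hs : 1 ≤ s) (hsn : s ≤ Fintype.card ι)
    {e1 e2 : ℝ≥0∞} (he1 : (1 - lo * s) ^ K ≤ e1)
    (he2 : ((Fintype.card ι).choose s : ℝ≥0∞) * (s : ℝ≥0∞) ^ K
      ≤ e2 * (Fintype.card ι : ℝ≥0∞) ^ K)
    {b : β} {c : γ} (hbc : e b = e' c) :
    p b * q c * (1 - e1) * (1 - e2) * (lo * Fintype.card ι) ^ K
      ≤ hi ^ 2 * Fintype.card ι * collisionLaw p e q e' K (some (b, c)) := by
  classical
  set N : ℝ≥0∞ := (Fintype.card ι : ℝ≥0∞) with hN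
  have hNt : N ≠ ⊤ := by simp [hN]
  set w := e b with hw
  -- For a table with domain `D`, a sample with value in `D` is returned with `φ D` times its
  -- weight. The function `g` is the part of `φ` that counts, namely `1 / |D|` for large domains.
  set φ : Finset ι → ℝ≥0∞ := fun D => ∑ k ∈ Finset.range K, missProb q e' D ^ k with hφ
  set g : Finset ι → ℝ≥0∞ := fun D => if s ≤ D.card then (D.card : ℝ≥0∞)⁻¹ else 0 with hg
  -- the output probability
  have hout : q c * expect (tableLaw p e K)
      (fun T => if T w = some b then φ (tableDom T) else 0)
      ≤ collisionLaw p e q e' K (some (b, c)) := by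
    rw [← expect_eq_apply (collisionLaw p e q e' K), collisionLaw, expect_bind, ← expect_mul_left]
    refine expect_mono fun T => ?_
    rw [expect_map]
    split_ifs with hT
    · rw [← hitLaw_some T (c := c) (by rw [← hbc, hT]; rfl)]
      refine le_trans ?_ (mul_le_expect _ (some c) _)
      rw [if_pos, mul_one]
      simp [← hbc, hT]
    · simp
  -- the number of values in the table
  have hgφ : ∀ D, (1 - e1) * g D ≤ hi * φ D := by
    intro D
    by_cases hD : s ≤ D.card
    swap
    · simp [hg, hD]
    have hc0 : (D.card : ℝ≥0∞) ≠ 0 := by simp only [ne_eq, Nat.cast_eq_zero]; omega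
    have h1 := missProb_pow_add (q := q) (e' := e') D K
    have hq1 : expect q (fun c => if e' c ∈ D then 1 else 0) ≤ D.card * hi := by
      rw [expect_mem_eq_sum, ← nsmul_eq_mul]
      exact Finset.sum_le_card_nsmul _ _ _ fun w _ => hhi' w
    have hq2 : lo * s ≤ expect q (fun c => if e' c ∈ D then 1 else 0) := by
      rw [expect_mem_eq_sum, mul_comm]
      calc (s : ℝ≥0∞) * lo ≤ D.card * lo := mul_le_mul_left (by exact_mod_cast hD) _
        _ = D.card • lo := (nsmul_eq_mul _ _).symm
        _ ≤ _ := Finset.card_nsmul_le_sum _ _ _ fun w _ => hlo' w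
    have hm : missProb q e' D ^ K ≤ e1 := by
      refine le_trans (pow_le_pow_left₀ zero_le ?_ K) he1
      have h2 := missProb_add (q := q) (e' := e') D
      have hne : expect q (fun c => if e' c ∈ D then 1 else 0) ≠ ⊤ := by
        intro h
        rw [h] at h2
        simp at h2
      rw [ENNReal.eq_sub_of_add_eq hne h2]
      exact tsub_le_tsub_left hq2 _
    have h3 : 1 - e1 ≤ D.card * hi * φ D := by
      refine tsub_le_iff_left.2 ?_
      rw [← h1]
      exact add_le_add hm (mul_le_mul_left hq1 _)
    calc (1 - e1) * g D ≤ D.card * hi * φ D * (D.card : ℝ≥0∞)⁻¹ := by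
          simp only [hg, if_pos hD]
          exact mul_le_mul_left h3 _
      _ = hi * φ D * (D.card * (D.card : ℝ≥0∞)⁻¹) := by ring
      _ = hi * φ D := by rw [ENNReal.mul_inv_cancel hc0 (by simp), mul_one]
  have hlarge : (1 - e2) * N ^ K ≤ imageSum K
      (fun D : Finset ι => if s ≤ D.card then (1 : ℝ≥0∞) else 0) := by
    have h1 : N ^ K = imageSum K (fun D : Finset ι => if s ≤ D.card then (1 : ℝ≥0∞) else 0)
        + imageSum K (fun D : Finset ι => if D.card < s then (1 : ℝ≥0∞) else 0) := by
      rw [← imageSum_add]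
      have := imageSum_const (ι := ι) K 1
      rw [mul_one] at this
      rw [hN, ← this]
      congr 1
      funext D
      by_cases hD : s ≤ D.card
      · simp [hD, not_lt.2 hD]
      · simp [hD, not_le.1 hD]
    rw [ENNReal.sub_mul (fun _ _ => ENNReal.pow_ne_top hNt), one_mul, tsub_le_iff_right]
    nth_rewrite 1 [h1]
    exact add_le_add_right ((imageSum_card_lt_le hsn K).trans he2) _
  -- As `g` depends only on the size of `D`, the symmetry lemma evaluates the sum over all images
  -- containing `w`, independently of `w`.
  have hsum : (1 - e1) * ((1 - e2) * N ^ K)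
      ≤ hi * N * imageSum K (fun D => if w ∈ D then φ D else 0) := by
    calc (1 - e1) * ((1 - e2) * N ^ K)
        ≤ (1 - e1) * (N * imageSum K (fun D => if w ∈ D then g D else 0)) := by
          rw [card_mul_imageSum_mem hs K w]
          exact mul_le_mul_right hlarge _
      _ = N * imageSum K (fun D => (1 - e1) * (if w ∈ D then g D else 0)) := by
          rw [imageSum_mul_left]; ring
      _ ≤ N * imageSum K (fun D => hi * (if w ∈ D then φ D else 0)) := by
          refine mul_le_mul_right (imageSum_mono fun D => ?_) _
          split_ifs
          · exact hgφ D
          · simp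
      _ = _ := by rw [imageSum_mul_left]; ring
  -- One factor `hi` comes from the hit probability, the other from the probability of the value `w`
  -- in the table.
  calc p b * q c * (1 - e1) * (1 - e2) * (lo * N) ^ K
      = p b * q c * lo ^ K * ((1 - e1) * ((1 - e2) * N ^ K)) := by rw [mul_pow]; ring
    _ ≤ p b * q c * lo ^ K * (hi * N * imageSum K (fun D => if w ∈ D then φ D else 0)) :=
        mul_le_mul_right hsum _
    _ = hi * N * q c * (p b * (lo ^ K * imageSum K (fun D => if w ∈ D then φ D else 0))) := by
        ring
    _ ≤ hi * N * q c * (p.map e w * expect (tableLaw p e K)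
          fun T => if T w = some b then φ (tableDom T) else 0) :=
        mul_le_mul_right (imageSum_le_expect_table hlo b K φ) _
    _ ≤ hi * N * q c * (hi * expect (tableLaw p e K)
          fun T => if T w = some b then φ (tableDom T) else 0) :=
        mul_le_mul_right (mul_le_mul_left (hhi w) _) _
    _ = hi ^ 2 * N * (q c * expect (tableLaw p e K)
          fun T => if T w = some b then φ (tableDom T) else 0) := by ring
    _ ≤ _ := mul_le_mul_right hout _

end Collision

/-! ### The probability that the walk agrees with a partial record -/

section Matching

variable {n : ℕ} (G : SimpleGraph (Fin n)) [DecidableRel G.Adj] (d : ℕ)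

/-- A partial record of a walk (`0` stands for an unknown position, `v + 1` for the vertex `v`)
allows the vertex `y` at time `i`. -/
def Allows (σ : ℕ → ℕ) (i : ℕ) (y : Fin n) : Prop := σ i = 0 ∨ σ i = y + 1

instance (σ : ℕ → ℕ) (i : ℕ) (y : Fin n) : Decidable (Allows σ i y) :=
  inferInstanceAs (Decidable (_ ∨ _))

lemma allows_of_zero {σ : ℕ → ℕ} {i : ℕ} {y : Fin n} (h : σ i = 0) : Allows σ i y := Or.inl h

lemma allows_of_eq {σ : ℕ → ℕ} {i : ℕ} {y : Fin n} (h : σ i = y + 1) : Allows σ i y := Or.inr h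

lemma allows_congr {σ τ : ℕ → ℕ} {i : ℕ} (h : σ i = τ i) (y : Fin n) :
    Allows σ i y ↔ Allows τ i y := by
  rw [Allows, Allows, h]

/-- The probability that a random walk which is at `y` at time `i` agrees with the record `σ`
at the times `i, …, i + k`. -/
def matchProb (σ : ℕ → ℕ) : ℕ → ℕ → Fin n → ℝ
  | 0, i, y => if Allows σ i y then 1 else 0
  | k + 1, i, y =>
    (if Allows σ i y then 1 else 0) * ∑ z, walkMatrix G d y z * matchProb σ k (i + 1) z

lemma matchProb_nonneg (σ : ℕ → ℕ) (k i : ℕ) (y : Fin n) : 0 ≤ matchProb G d σ k i y := by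
  induction k generalizing i y with
  | zero => rw [matchProb]; split_ifs <;> simp
  | succ k ih =>
    rw [matchProb]
    refine mul_nonneg (by split_ifs <;> simp) (Finset.sum_nonneg fun z _ => ?_)
    exact mul_nonneg (walkMatrix_nonneg G _ _) (ih _ _)

lemma matchProb_of_not_allows {σ : ℕ → ℕ} {i : ℕ} {y : Fin n} (h : ¬ Allows σ i y) (k : ℕ) :
    matchProb G d σ k i y = 0 := by
  cases k <;> simp [matchProb, h]

lemma matchProb_succ_of_allows {σ : ℕ → ℕ} {i : ℕ} {y : Fin n} (h : Allows σ i y) (k : ℕ) :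
    matchProb G d σ (k + 1) i y = ∑ z, walkMatrix G d y z * matchProb G d σ k (i + 1) z := by
  simp [matchProb, h]

lemma matchProb_congr {σ τ : ℕ → ℕ} {k i : ℕ} (h : ∀ j, i ≤ j → j ≤ i + k → σ j = τ j)
    (y : Fin n) : matchProb G d σ k i y = matchProb G d τ k i y := by
  induction k generalizing i y with
  | zero => simp only [matchProb, allows_congr (h i le_rfl le_rfl)]
  | succ k ih =>
    simp only [matchProb, allows_congr (h i le_rfl (by omega))]
    congr 1
    refine Finset.sum_congr rfl fun z _ => ?_
    rw [ih fun j h1 h2 => h j (by omega) (by omega)]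

/-- Unrecorded intermediate times impose no condition, so the sums over them make up a matrix power
(Chapman–Kolmogorov). -/
lemma matchProb_skip {σ : ℕ → ℕ} {m k i : ℕ} (hm : 1 ≤ m)
    (h : ∀ j, i < j → j < i + m → σ j = 0) (y : Fin n) :
    matchProb G d σ (m + k) i y = (if Allows σ i y then 1 else 0)
      * ∑ z, (walkMatrix G d ^ m) y z * matchProb G d σ k (i + m) z := by
  induction m, hm using Nat.le_induction generalizing i y with
  | base => rw [add_comm, matchProb, pow_one]
  | succ m hm ih =>
    rw [show m + 1 + k = (m + k) + 1 by ring, matchProb]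
    congr 1
    rw [pow_succ']
    simp only [Matrix.mul_apply, Finset.sum_mul]
    rw [Finset.sum_comm]
    refine Finset.sum_congr rfl fun z _ => ?_
    rw [ih (fun j h1 h2 => h j (by omega) (by omega)),
      if_pos (allows_of_zero (h (i + 1) (by omega) (by omega))),
      one_mul, Finset.mul_sum]
    refine Finset.sum_congr rfl fun x _ => ?_
    rw [mul_assoc, show i + 1 + m = i + (m + 1) by ring]

/-- Along a recorded stretch each sum over the next vertex has a single nonzero term. -/
lemma matchProb_path {σ : ℕ → ℕ} {X : ℕ → Fin n} {m k i : ℕ}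
    (h : ∀ j, i ≤ j → j ≤ i + m → σ j = X j + 1) :
    matchProb G d σ (m + k) i (X i)
      = pathWeight G d X i m * matchProb G d σ k (i + m) (X (i + m)) := by
  induction m generalizing k with
  | zero => simp [pathWeight]
  | succ m ih =>
    rw [show m + 1 + k = m + (k + 1) by ring, ih fun j h1 h2 => h j h1 (by omega)]
    rw [matchProb_succ_of_allows G d (allows_of_eq (h _ (by omega) (by omega))),
      Finset.sum_eq_single (X (i + m + 1))]
    · simp only [pathWeight, Finset.prod_range_succ, add_assoc, mul_assoc]
    · intro z _ hz
      rw [matchProb_of_not_allows G d, mul_zero]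
      rintro (h0 | h0)
      · rw [h _ (by omega) (by omega)] at h0
        omega
      · rw [h _ (by omega) (by omega)] at h0
        exact hz (Fin.ext (by omega))
    · simp

variable {G d}

/-- Records that agree before a window undergo the same positive averaging there, so an inequality
at the left end of the window propagates to earlier times. This makes the comparison of two records
local. -/
lemma matchProb_mono_prefix {σ τ : ℕ → ℕ} {a b : ℝ} {k m i : ℕ}
    (h : ∀ j, i ≤ j → j < i + m → τ j = σ j)
    (hab : ∀ y, a * matchProb G d τ k (i + m) y ≤ b * matchProb G d σ k (i + m) y) (y : Fin n) :
    a * matchProb G d τ (m + k) i y ≤ b * matchProb G d σ (m + k) i y := by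
  induction m generalizing i y with
  | zero => simpa using hab y
  | succ m ih =>
    rw [show m + 1 + k = (m + k) + 1 by ring]
    simp only [matchProb, allows_congr (h i le_rfl (by omega))]
    rw [mul_left_comm, mul_left_comm b]
    refine mul_le_mul_of_nonneg_left ?_ (by split_ifs <;> simp)
    rw [Finset.mul_sum, Finset.mul_sum]
    refine Finset.sum_le_sum fun z _ => ?_
    rw [mul_left_comm, mul_left_comm b]
    refine mul_le_mul_of_nonneg_left ?_ (walkMatrix_nonneg G _ _)
    refine ih (fun j h1 h2 => h j (by omega) (by omega)) ?_ z
    rwa [show i + 1 + m = i + (m + 1) by ring]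

section Window

variable {δ c : ℝ} {h : ℕ}

/-- All powers of the random walk matrix from the `h`-th on are uniform up to a factor `1 ± δ`. -/
def Mixes (G : SimpleGraph (Fin n)) [DecidableRel G.Adj] (d : ℕ) (δ : ℝ) (h : ℕ) : Prop :=
  ∀ m, h ≤ m → ∀ u v, (1 - δ) / n ≤ (walkMatrix G d ^ m) u v ∧
    (walkMatrix G d ^ m) u v ≤ (1 + δ) / n

lemma Mixes.le_sum (hmix : Mixes G d δ h) {m : ℕ} (hm : h ≤ m) (y : Fin n) {A : Fin n → ℝ}
    (hA : ∀ z, 0 ≤ A z) :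
    (1 - δ) / n * ∑ z, A z ≤ ∑ z, (walkMatrix G d ^ m) y z * A z := by
  rw [Finset.mul_sum]
  exact Finset.sum_le_sum fun z _ => mul_le_mul_of_nonneg_right (hmix m hm y z).1 (hA z)

lemma Mixes.sum_le (hmix : Mixes G d δ h) {m : ℕ} (hm : h ≤ m) (y : Fin n) {A : Fin n → ℝ}
    (hA : ∀ z, 0 ≤ A z) :
    ∑ z, (walkMatrix G d ^ m) y z * A z ≤ (1 + δ) / n * ∑ z, A z := by
  rw [Finset.mul_sum]
  exact Finset.sum_le_sum fun z _ => mul_le_mul_of_nonneg_right (hmix m hm y z).2 (hA z)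

/-- A record `σ` without entries between the times `t - dl` and `t + dr`, and an extension `τ`
of it by positions between these times. -/
structure Extends (σ τ : ℕ → ℕ) (t dl dr : ℕ) : Prop where
  one_le_dl : 1 ≤ dl
  dl_le : dl ≤ t
  one_le_dr : 1 ≤ dr
  free : ∀ j, t - dl < j → j < t + dr → σ j = 0
  left : ∀ j, j ≤ t - dl → τ j = σ j
  right : ∀ j, t + dr ≤ j → τ j = σ j

variable {σ τ : ℕ → ℕ} {X : ℕ → Fin n} {t dl dr k : ℕ}

lemma Extends.matchProb_eq (H : Extends σ τ t dl dr) (y : Fin n) :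
    matchProb G d σ (dl + dr + k) (t - dl) y = (if Allows σ (t - dl) y then 1 else 0)
      * ∑ z, (walkMatrix G d ^ (dl + dr)) y z * matchProb G d σ k (t + dr) z := by
  have h1 := H.one_le_dl
  have h2 := H.dl_le
  rw [matchProb_skip G d (by omega)
    (fun j h1 h2 => H.free j h1 (by omega)), show t - dl + (dl + dr) = t + dr by omega]

lemma Extends.matchProb_right (H : Extends σ τ t dl dr) (y : Fin n) :
    matchProb G d τ k (t + dr) y = matchProb G d σ k (t + dr) y :=
  matchProb_congr G d (fun j h1 _ => H.right j h1) y

lemma matchProb_of_ne {i : ℕ} {x y : Fin n} (hx : σ i = x + 1) (hy : y ≠ x) :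
    matchProb G d σ k i y = 0 := by
  refine matchProb_of_not_allows G d ?_ k
  rintro (h0 | h0)
  · omega
  · exact hy (Fin.ext (by omega))

/-- With both ends recorded, the conditional probability of the path between them is its weight
divided by the entry of the matrix power; everything to the right of the window cancels. -/
lemma Extends.matchProb_le_bridge (H : Extends σ τ t dl dr)
    (hτ : ∀ j, t - dl ≤ j → j ≤ t + dr → τ j = X j + 1) {P : ℝ}
    (hP : c * pathWeight G d X (t - dl) (dl + dr)
      ≤ P * (walkMatrix G d ^ (dl + dr)) (X (t - dl)) (X (t + dr))) (y : Fin n) :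
    c * matchProb G d τ (dl + dr + k) (t - dl) y
      ≤ P * matchProb G d σ (dl + dr + k) (t - dl) y := by
  have h2 := H.dl_le
  have hl := hτ (t - dl) le_rfl (by omega)
  have hr := hτ (t + dr) (by omega) le_rfl
  rw [H.right _ le_rfl] at hr
  by_cases hy : y = X (t - dl)
  · subst hy
    rw [matchProb_path G d (fun j h1 h2 => hτ j h1 (by omega)), H.matchProb_eq,
      if_pos (allows_of_eq (by rw [← H.left _ le_rfl, hl])), one_mul,
      show t - dl + (dl + dr) = t + dr by omega, H.matchProb_right,
      Finset.sum_eq_single (X (t + dr)), ← mul_assoc, ← mul_assoc]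
    · exact mul_le_mul_of_nonneg_right hP (matchProb_nonneg G d _ _ _ _)
    · intro z _ hz
      rw [matchProb_of_ne hr hz, mul_zero]
    · simp
  · rw [matchProb_of_ne hl hy, matchProb_of_ne (by rw [← H.left _ le_rfl, hl]) hy]
    simp

/-- To the right of `t` both records have a free stretch of length at least `h`, after which the
position is nearly uniform. The right part of the record thus contributes the same up to the factor
`(1 + δ) / (1 - δ)`. -/
lemma Extends.matchProb_le_left (H : Extends σ τ t dl dr) (hmix : Mixes G d δ h) (hh : h ≤ dr)
    (hτ : ∀ j, t - dl ≤ j → j ≤ t → τ j = X j + 1) (hτ' : ∀ j, t < j → j < t + dr → τ j = 0)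
    (h0 : 0 ≤ c) (hc : c * (1 + δ) ≤ 1 - δ) (y : Fin n) :
    c * matchProb G d τ (dl + dr + k) (t - dl) y
      ≤ pathWeight G d X (t - dl) dl * matchProb G d σ (dl + dr + k) (t - dl) y := by
  have h2 := H.dl_le
  have hl := hτ (t - dl) le_rfl (by omega)
  have hA : ∀ z, 0 ≤ matchProb G d σ k (t + dr) z := matchProb_nonneg G d _ _ _
  by_cases hy : y = X (t - dl)
  · subst hy
    rw [H.matchProb_eq, if_pos (allows_of_eq (by rw [← H.left _ le_rfl, hl])), one_mul, add_assoc dl,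
      matchProb_path G d (fun j h1 h2 => hτ j h1 (by omega)),
      show t - dl + dl = t by omega, matchProb_skip G d H.one_le_dr (fun j h1 h2 => hτ' j h1 h2),
      if_pos (allows_of_eq (hτ t (by omega) le_rfl)), one_mul, mul_left_comm]
    refine mul_le_mul_of_nonneg_left ?_ (pathWeight_nonneg G d _ _ _)
    simp only [H.matchProb_right]
    refine le_trans (mul_le_mul_of_nonneg_left (hmix.sum_le hh _ hA) h0)
      (le_trans ?_ (hmix.le_sum (by omega) _ hA))
    rw [← mul_assoc]
    refine mul_le_mul_of_nonneg_right ?_ (Finset.sum_nonneg fun z _ => hA z)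
    rw [← mul_div_assoc]
    gcongr
  · rw [matchProb_of_ne hl hy, matchProb_of_ne (by rw [← H.left _ le_rfl, hl]) hy]
    simp

lemma Extends.matchProb_eq_mid (H : Extends σ τ t dl dr) (hτ : τ t = X t + 1)
    (hτ' : ∀ j, t - dl < j → j < t → τ j = 0) (y : Fin n) :
    matchProb G d τ (dl + dr + k) (t - dl) y = (if Allows σ (t - dl) y then 1 else 0)
      * ((walkMatrix G d ^ dl) y (X t) * matchProb G d τ (dr + k) t (X t)) := by
  have h2 := H.dl_le
  rw [add_assoc, matchProb_skip G d H.one_le_dl (fun j h1 h2 => hτ' j h1 (by omega)),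
    show t - dl + dl = t by omega, Finset.sum_eq_single (X t)]
  · simp only [allows_congr (H.left _ le_rfl)]
  · intro z _ hz
    rw [matchProb_of_ne hτ hz, mul_zero]
  · simp

/-- The probabilities of getting from the left end to `X t` and to `X (t + dr)` are both close to `1
/ n`, because each of these stretches has length at least `h`; all other factors agree. -/
lemma Extends.matchProb_le_right (H : Extends σ τ t dl dr) (hmix : Mixes G d δ h) (hh : h ≤ dl)
    (hτ : ∀ j, t ≤ j → j ≤ t + dr → τ j = X j + 1) (hτ' : ∀ j, t - dl < j → j < t → τ j = 0)
    (h0 : 0 ≤ c) (hc : c * (1 + δ) ≤ 1 - δ) (y : Fin n) :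
    c * matchProb G d τ (dl + dr + k) (t - dl) y
      ≤ pathWeight G d X t dr * matchProb G d σ (dl + dr + k) (t - dl) y := by
  have hr := hτ (t + dr) (by omega) le_rfl
  rw [H.right _ le_rfl] at hr
  rw [H.matchProb_eq_mid (hτ t le_rfl (by omega)) hτ', H.matchProb_eq, mul_left_comm,
    mul_left_comm (pathWeight G d X t dr)]
  refine mul_le_mul_of_nonneg_left ?_ (by split_ifs <;> simp)
  rw [matchProb_path G d (fun j h1 h2 => hτ j h1 (by omega)), H.matchProb_right,
    Finset.sum_eq_single (X (t + dr))]
  · have hA := matchProb_nonneg G d σ k (t + dr) (X (t + dr))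
    have hw := pathWeight_nonneg G d X t dr
    have h3 : c * (walkMatrix G d ^ dl) y (X t)
        ≤ (walkMatrix G d ^ (dl + dr)) y (X (t + dr)) := by
      refine le_trans (mul_le_mul_of_nonneg_left (hmix _ hh _ _).2 h0)
        (le_trans ?_ (hmix _ (by omega) _ _).1)
      rw [← mul_div_assoc]
      gcongr
    calc _ = c * (walkMatrix G d ^ dl) y (X t)
          * (pathWeight G d X t dr * matchProb G d σ k (t + dr) (X (t + dr))) := by ring
      _ ≤ (walkMatrix G d ^ (dl + dr)) y (X (t + dr))
          * (pathWeight G d X t dr * matchProb G d σ k (t + dr) (X (t + dr))) :=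
          mul_le_mul_of_nonneg_right h3 (mul_nonneg hw hA)
      _ = _ := by ring
  · intro z _ hz
    rw [matchProb_of_ne hr hz, mul_zero]
  · simp

/-- A single new position splits one free stretch into two. Two upper bounds `(1 + δ) / n` stand
against one lower bound `(1 - δ) / n`, which leaves the uniform weight `1 / n`. -/
lemma Extends.matchProb_le_none (H : Extends σ τ t dl dr) (hmix : Mixes G d δ h) (hh : h ≤ dl)
    (hh' : h ≤ dr) (hτ : τ t = X t + 1) (hτ' : ∀ j, t - dl < j → j < t + dr → j ≠ t → τ j = 0)
    (hδ : 0 ≤ 1 + δ) (h0 : 0 ≤ c) (hc : c * (1 + δ) ^ 2 ≤ 1 - δ) (y : Fin n) :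
    c * matchProb G d τ (dl + dr + k) (t - dl) y
      ≤ 1 / n * matchProb G d σ (dl + dr + k) (t - dl) y := by
  have h2 := H.dl_le
  have h3 := H.one_le_dl
  have hA : ∀ z, 0 ≤ matchProb G d σ k (t + dr) z := matchProb_nonneg G d _ _ _
  rw [H.matchProb_eq_mid hτ (fun j h1 h2 => hτ' j h1 (by omega) (by omega)), H.matchProb_eq,
    mul_left_comm, mul_left_comm (1 / (n : ℝ))]
  refine mul_le_mul_of_nonneg_left ?_ (by split_ifs <;> simp)
  rw [matchProb_skip G d H.one_le_dr (fun j h1 h2 => hτ' j (by omega) h2 (by omega)),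
    if_pos (allows_of_eq hτ), one_mul]
  simp only [H.matchProb_right]
  set S := ∑ z, matchProb G d σ k (t + dr) z with hS
  have hS0 : 0 ≤ S := Finset.sum_nonneg fun z _ => hA z
  calc c * ((walkMatrix G d ^ dl) y (X t)
        * ∑ z, (walkMatrix G d ^ dr) (X t) z * matchProb G d σ k (t + dr) z)
      ≤ c * ((1 + δ) / n * ((1 + δ) / n * S)) :=
        mul_le_mul_of_nonneg_left (mul_le_mul (hmix _ hh _ _).2 (hmix.sum_le hh' _ hA)
          (Finset.sum_nonneg fun z _ => mul_nonneg (walkMatrix_pow_nonneg G _ _ _) (hA z))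
          (by positivity)) h0
    _ = (c * (1 + δ) ^ 2) * (1 / n * (S / n)) := by ring
    _ ≤ (1 - δ) * (1 / n * (S / n)) := mul_le_mul_of_nonneg_right hc (by positivity)
    _ = 1 / n * ((1 - δ) / n * S) := by ring
    _ ≤ _ := mul_le_mul_of_nonneg_left (hmix.le_sum (by omega) _ hA) (by positivity)

end Window

end Matching

/-! ### Matching probabilities as probabilities of events of the walk -/

section MatchWalk

variable {n : ℕ} [NeZero n] (G : SimpleGraph (Fin n)) [DecidableRel G.Adj] {d : ℕ}
  (hd : 1 ≤ d) (hG : G.IsRegularOfDegree d)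
include hd hG

omit [NeZero n] in
lemma matchProb_of_free {σ : ℕ → ℕ} {k i : ℕ} (h : ∀ j, i < j → j ≤ i + k → σ j = 0)
    (y : Fin n) : matchProb G d σ k i y = if Allows σ i y then 1 else 0 := by
  cases k with
  | zero => rw [matchProb]
  | succ k =>
    have := matchProb_skip G d (σ := σ) (k := 0) (i := i) (m := k + 1) (by omega)
      (fun j h1 h2 => h j h1 (by omega)) y
    rw [add_zero] at this
    rw [this]
    simp only [matchProb, Allows, h (i + (k + 1)) (by omega) le_rfl, true_or, if_true, mul_one,
      walkMatrix_pow_row_sum G hd hG]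

omit [NeZero n] in
-- Times after the last recorded one impose no condition and rows sum to one, so the horizon can be
-- moved freely beyond it.
lemma matchProb_extend {σ : ℕ → ℕ} {k i : ℕ} (h : ∀ j, i + k < j → σ j = 0) (m : ℕ)
    (y : Fin n) : matchProb G d σ (k + m) i y = matchProb G d σ k i y := by
  induction k generalizing i y with
  | zero =>
    rw [zero_add, matchProb_of_free G hd hG (fun j h1 _ => h j (by omega)), matchProb]
  | succ k ih =>
    rw [show k + 1 + m = (k + m) + 1 by ring]
    simp only [matchProb]
    congr 1
    refine Finset.sum_congr rfl fun z _ => ?_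
    rw [ih fun j hj => h j (by omega)]

open Classical in
-- The conditions before time `k` are tested on the sampled path, the later ones are still inside
-- `matchProb`; the induction moves the boundary by one.
lemma expect_walkFrom_match_aux (σ : ℕ → ℕ) (u : Fin n) (k m : ℕ) :
    expect (walkFrom G u k) (fun X => (if ∀ i < k, Allows σ i (X i) then 1 else 0)
      * ENNReal.ofReal (matchProb G d σ m k (X k))) = ENNReal.ofReal (matchProb G d σ (k + m) 0 u) := by
  induction k generalizing m with
  | zero => simp [walkFrom]
  | succ k ih =>
    rw [show k + 1 + m = k + (m + 1) by ring, ← ih, walkFrom, expect_bind]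
    congr 1
    funext X
    rw [expect_map, expect_fintype]
    have hX : ∀ v, (∀ i < k + 1, Allows σ i (Function.update X (k + 1) v i))
        ↔ (∀ i < k, Allows σ i (X i)) ∧ Allows σ k (X k) := by
      intro v
      have : ∀ i < k + 1, Function.update X (k + 1) v i = X i := fun i hi =>
        Function.update_of_ne (by omega) _ _
      constructor
      · exact fun h => ⟨fun i hi => by simpa [this i (by omega)] using h i (by omega),
          by simpa [this k (by omega)] using h k (by omega)⟩
      · rintro ⟨h1, h2⟩ i hi
        rw [this i hi]
        rcases Nat.lt_succ_iff_lt_or_eq.1 hi with h | rfl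
        · exact h1 i h
        · exact h2
    simp only [hX, Function.update_self, neighborDist_apply G hd hG]
    by_cases h1 : ∀ i < k, Allows σ i (X i)
    · by_cases h2 : Allows σ k (X k)
      · rw [matchProb_succ_of_allows G d h2, ENNReal.ofReal_sum_of_nonneg
          fun z _ => mul_nonneg (walkMatrix_nonneg G _ _) (matchProb_nonneg G d _ _ _ _)]
        simp [h2, ENNReal.ofReal_mul (walkMatrix_nonneg G _ _)]
      · simp [h2, matchProb_of_not_allows G d h2]
    · simp [h1]

open Classical in
/-- `matchProb` is the probability that the random walk agrees with a record. -/
lemma expect_walkFrom_match (σ : ℕ → ℕ) (u : Fin n) (k : ℕ) :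
    expect (walkFrom G u k) (fun X => if ∀ i ≤ k, Allows σ i (X i) then 1 else 0)
      = ENNReal.ofReal (matchProb G d σ k 0 u) := by
  rw [← add_zero k, ← expect_walkFrom_match_aux G hd hG σ u k 0]
  congr 1
  funext X
  have : (∀ i ≤ k, Allows σ i (X i)) ↔ (∀ i < k, Allows σ i (X i)) ∧ Allows σ k (X k) :=
    ⟨fun h => ⟨fun i hi => h i hi.le, h k le_rfl⟩, fun h i hi => by
      rcases hi.lt_or_eq with h' | rfl
      · exact h.1 i h'
      · exact h.2⟩
  rw [add_zero, matchProb, if_congr this rfl rfl]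
  by_cases h1 : ∀ i < k, Allows σ i (X i)
  · by_cases h2 : Allows σ k (X k)
    · simp [h2]
    · simp [h2]
  · simp [h1]

end MatchWalk

/-! ### Couplings and invariants for random programs -/

section Relational

variable {α β γ α' β' : Type*}

/-- All outcomes satisfy `R`. -/
def Ensures (p : PMF α) (R : α → Prop) : Prop := ∀ a ∈ p.support, R a

lemma ensures_pure {a : α} {R : α → Prop} (h : R a) : Ensures (PMF.pure a) R := by
  intro b hb
  rw [PMF.support_pure, Set.mem_singleton_iff] at hb
  exact hb ▸ h

lemma Ensures.bind {p : PMF α} {k : α → PMF β} {R : α → Prop} {S : β → Prop}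
    (h : Ensures p R) (hk : ∀ a, R a → Ensures (k a) S) : Ensures (p.bind k) S := by
  intro b hb
  rw [PMF.mem_support_bind_iff] at hb
  obtain ⟨a, ha, hb⟩ := hb
  exact hk a (h a ha) b hb

lemma ensures_map {p : PMF α} {f : α → β} {S : β → Prop} (h : ∀ a, S (f a)) :
    Ensures (p.map f) S := by
  intro b hb
  rw [PMF.mem_support_map_iff] at hb
  obtain ⟨a, -, rfl⟩ := hb
  exact h a

/-- There is a coupling of `p` and `q` under which `R` holds; stated in terms of expectations. -/
def Sim (p : PMF α) (q : PMF β) (R : α → β → Prop) : Prop :=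
  ∀ (f : α → ℝ≥0∞) (g : β → ℝ≥0∞), (∀ a b, R a b → g b ≤ f a) → expect q g ≤ expect p f

lemma Sim.pure {a : α} {b : β} {R : α → β → Prop} (h : R a b) :
    Sim (PMF.pure a) (PMF.pure b) R := by
  intro f g hfg
  simpa using hfg a b h

lemma Sim.bind {p : PMF α} {q : PMF β} {R : α → β → Prop} {k : α → PMF α'} {l : β → PMF β'}
    {S : α' → β' → Prop} (h : Sim p q R) (hk : ∀ a b, R a b → Sim (k a) (l b) S) :
    Sim (p.bind k) (q.bind l) S := by
  intro f g hfg
  rw [expect_bind, expect_bind]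
  exact h _ _ fun a b hab => hk a b hab f g hfg

lemma Sim.of_ensures_bind {p : PMF α} {R : α → Prop} {k : α → PMF α'} {q : PMF β}
    {S : α' → β → Prop} (h : Ensures p R) (hk : ∀ a, R a → Sim (k a) q S) :
    Sim (p.bind k) q S := by
  intro f g hfg
  rw [expect_bind, ← expect_const p (expect q g)]
  exact expect_mono_support fun a ha => hk a (h a ha) f g hfg

lemma Sim.bind_ensures {p : PMF α} {q : PMF β} {R : α → β → Prop} {k : α → PMF α'}
    {S : α' → β → Prop} (h : Sim p q R) (hk : ∀ a b, R a b → Ensures (k a) fun a' => S a' b) :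
    Sim (p.bind k) q S := by
  have : Sim (p.bind k) (q.bind PMF.pure) S := h.bind fun a b hab f g hfg => by
    rw [expect_pure, ← expect_const (k a) (g b)]
    exact expect_mono_support fun a' ha' => hfg a' b (hk a b hab a' ha')
  rwa [PMF.bind_pure] at this

lemma Sim.mono {p : PMF α} {q : PMF β} {R S : α → β → Prop} (h : Sim p q R)
    (hRS : ∀ a b, R a b → S a b) : Sim p q S :=
  fun f g hfg => h f g fun a b hab => hfg a b (hRS a b hab)

lemma Sim.map_right {p : PMF α} {q : PMF β} {S : α → β' → Prop} (φ : β → β')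
    (h : Sim p q fun a b => S a (φ b)) : Sim p (q.map φ) S := by
  intro f g hfg
  rw [expect_map]
  exact h f _ fun a b hab => hfg a _ hab

/-- Testing the coupling with `g = 1` and the indicator of having a partner shows that no outcome
lacks one. This turns a simulation into a statement about every possible run. -/
lemma Sim.ensures {p : PMF α} {q : PMF β} {R : α → β → Prop} (h : Sim p q R) :
    Ensures p fun a => ∃ b, R a b := by
  classical
  refine forall_support_of_le_expect (f := fun a => if ∃ b, R a b then 1 else 0) ?_ ?_ ?_
  · intro a
    split_ifs <;> simp
  · intro a ha
    exact if_neg ha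
  · refine (expect_const q 1).ge.trans (h _ _ fun a b hab => ?_)
    rw [if_pos ⟨b, hab⟩]

/-- All outcomes coupled with `b` are sent to `c`, so `c` receives at least the mass of `b`.
Accuracy uses the simulation only through such lower bounds. -/
lemma Sim.apply_le_map {p : PMF α} {q : PMF β} {R : α → β → Prop} (h : Sim p q R) {φ : α → γ}
    {b : β} {c : γ} (hφ : ∀ a, R a b → φ a = c) : q b ≤ p.map φ c := by
  classical
  rw [← expect_eq_apply q b, ← expect_eq_apply _ c, expect_map]
  refine h _ _ fun a b' hab => ?_
  split_ifs with h1 h2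
  · exact le_rfl
  · exact absurd (hφ a (h1 ▸ hab)) h2
  · exact zero_le
  · exact le_rfl

/-- Loops unfold at their first pass, whereas the sampling laws and the invariants grow at the last
one. -/
lemma iterate_succ_eq_bind (step : Config → PMF Config) (k : ℕ) (m : Config) :
    iterate step (k + 1) m = (iterate step k m).bind step := by
  induction k generalizing m with
  | zero => simp [iterate]
  | succ k ih =>
    rw [iterate, iterate, PMF.bind_bind]
    exact congrArg _ (funext fun a => ih a)

lemma Sim.iterate {step : Config → PMF Config} {k : ℕ} {m : Config} {q : ℕ → PMF β}
    {s : ℕ → β → PMF β} (hq : ∀ i, q (i + 1) = (q i).bind (s i))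
    {R : ℕ → Config → β → Prop} (h0 : Sim (PMF.pure m) (q 0) (R 0))
    (hs : ∀ i < k, ∀ m b, R i m b → Sim (step m) (s i b) (R (i + 1))) :
    Sim (WalkAccess.iterate step k m) (q k) (R k) := by
  induction k with
  | zero => exact h0
  | succ k ih =>
    rw [iterate_succ_eq_bind, hq]
    exact (ih fun i hi => hs i (by omega)).bind (hs k (by omega))

lemma Ensures.iterate {step : Config → PMF Config} {k : ℕ} {m : Config} {R : ℕ → Config → Prop}
    (h0 : R 0 m) (hs : ∀ i < k, ∀ m, R i m → Ensures (step m) (R (i + 1))) :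
    Ensures (WalkAccess.iterate step k m) (R k) := by
  induction k with
  | zero => exact ensures_pure h0
  | succ k ih =>
    rw [iterate_succ_eq_bind]
    exact (ih fun i hi => hs i (by omega)).bind (hs k (by omega))

end Relational

/-! ### Machine configurations and the cost of memory accesses -/

section ConfigFields

variable (m : Config) (x v a : ℕ)

@[simp] lemma Config.tick_reg : m.tick.reg = m.reg := rfl
@[simp] lemma Config.tick_work : m.tick.work = m.work := rfl
@[simp] lemma Config.tick_store : m.tick.store = m.store := rfl
@[simp] lemma Config.tick_time : m.tick.time = m.time + 1 := rfl
@[simp] lemma Config.tick_peak : m.tick.peak = m.peak := rfl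
@[simp] lemma Config.tick_touched : m.tick.touched = m.touched := rfl
@[simp] lemma Config.setReg_reg : (m.setReg x v).reg = Function.update m.reg x v := rfl
@[simp] lemma Config.setReg_work : (m.setReg x v).work = m.work := rfl
@[simp] lemma Config.setReg_store : (m.setReg x v).store = m.store := rfl
@[simp] lemma Config.setReg_time : (m.setReg x v).time = m.time + 1 := rfl
@[simp] lemma Config.setReg_peak : (m.setReg x v).peak = max m.peak v := rfl
@[simp] lemma Config.setReg_touched : (m.setReg x v).touched = m.touched := rfl
@[simp] lemma Config.touch_reg : (m.touch a).reg = m.reg := rfl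
@[simp] lemma Config.touch_work : (m.touch a).work = m.work := rfl
@[simp] lemma Config.touch_store : (m.touch a).store = m.store := rfl
@[simp] lemma Config.touch_time : (m.touch a).time = m.time := rfl
@[simp] lemma Config.touch_peak : (m.touch a).peak = m.peak := rfl
@[simp] lemma Config.touch_touched : (m.touch a).touched = insert a m.touched := rfl
@[simp] lemma Config.setWork_reg : (m.setWork a v).reg = m.reg := rfl
@[simp] lemma Config.setWork_work : (m.setWork a v).work = Function.update m.work a v := rfl
@[simp] lemma Config.setWork_store : (m.setWork a v).store = m.store := rfl
@[simp] lemma Config.setWork_time : (m.setWork a v).time = m.time + 1 := rfl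
@[simp] lemma Config.setWork_peak : (m.setWork a v).peak = m.peak := rfl
@[simp] lemma Config.setWork_touched : (m.setWork a v).touched = insert a m.touched := rfl
@[simp] lemma Config.setStore_reg : (m.setStore a v).reg = m.reg := rfl
@[simp] lemma Config.setStore_work : (m.setStore a v).work = m.work := rfl
@[simp] lemma Config.setStore_store : (m.setStore a v).store = m.store.update a v := rfl
@[simp] lemma Config.setStore_time : (m.setStore a v).time = m.time + 1 := rfl
@[simp] lemma Config.setStore_peak : (m.setStore a v).peak = m.peak := rfl
@[simp] lemma Config.setStore_touched : (m.setStore a v).touched = m.touched := rfl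

end ConfigFields

section Touched

variable {n : ℕ} [NeZero n] (G : SimpleGraph (Fin n)) [DecidableRel G.Adj]

/-- Every access to the working memory takes time. -/
lemma ensures_touched (P : Cmd) (m : Config) : Ensures (run G P m) fun m' =>
    m'.touched.card + m.time ≤ m.touched.card + m'.time := by
  have hins : ∀ (s : Finset ℕ) (a : ℕ), (insert a s).card ≤ s.card + 1 := fun s a =>
    Finset.card_insert_le a s
  induction P generalizing m with
  | const x c => exact ensures_pure (by simp)
  | arith o x y z => exact ensures_pure (by simp)
  | readWork x a =>
    refine ensures_pure ?_
    have := hins m.touched (m.reg a)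
    simp; omega
  | writeWork a x =>
    refine ensures_pure ?_
    have := hins m.touched (m.reg a)
    simp; omega
  | readStore x a => exact ensures_pure (by simp)
  | writeStore a x => exact ensures_pure (by simp)
  | randVertex x => exact ensures_map fun v => by simp
  | randNeighbor x y => exact ensures_map fun v => by simp
  | seq p q hp hq =>
    exact (hp m).bind fun m' h' m'' h'' => by
      have := hq m' m'' h''
      omega
  | ifLt x y p q hp hq =>
    rw [run]
    split_ifs
    · intro m' h'
      have := hp _ m' h'
      simp at this; omega
    · intro m' h'
      have := hq _ m' h'
      simp at this; omega
  | loop x p hp =>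
    refine Ensures.iterate (R := fun _ m' =>
      m'.touched.card + m.time ≤ m.touched.card + m'.time) (by simp) ?_
    intro i _ m₁ h₁ m₂ h₂
    have := hp _ m₂ h₂
    simp at this; omega

end Touched

section

variable (a b : ℕ)

lemma ArithOp.eval_add : ArithOp.add.eval a b = a + b := rfl
lemma ArithOp.eval_sub : ArithOp.sub.eval a b = a - b := rfl
lemma ArithOp.eval_mul : ArithOp.mul.eval a b = a * b := rfl
lemma ArithOp.eval_div : ArithOp.div.eval a b = a / b := rfl
lemma ArithOp.eval_log : ArithOp.log.eval a b = Nat.log 2 a := rfl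

end

lemma Sim.of_bind_map {α β γ : Type*} {p : PMF γ} {k : γ → PMF α} {f : γ → β} {R : α → β → Prop}
    (h : ∀ c, Sim (k c) (PMF.pure (f c)) R) : Sim (p.bind k) (p.map f) R := by
  rw [← PMF.bind_pure_comp]
  refine Sim.bind (R := Eq) (fun f g hfg => expect_mono fun c => hfg c c rfl) ?_
  rintro c _ rfl
  exact h c

/-! ### Walks written to the persistent memory -/

/-- One step of a walk from the vertex in register `14`, recorded in the persistent memory. -/
def walkStep (o : ArithOp) : Cmd :=
  .seq (.randNeighbor 14 14) (.seq (.arith o 15 15 5) (.seq (.arith .add 16 14 5)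
    (.writeStore 15 16)))

/-- A walk of as many steps as register `x` says from the recorded vertex to whose time
register `15` points. The recorded times increase or decrease according to `o`. -/
def walkStore (o : ArithOp) (x : ℕ) : Cmd :=
  .seq (.readStore 14 15) (.seq (.arith .sub 14 14 5) (.loop x (walkStep o)))

section

variable {n : ℕ} (G : SimpleGraph (Fin n)) [DecidableRel G.Adj]

lemma neighborProbe_coe (v : Fin n) :
    neighborProbe G v = (neighborDist G v).bind fun w => PMF.pure (w : ℕ) := by
  rw [neighborProbe, dif_pos v.2]
  exact PMF.map_id _

lemma vertexProbe_eq [NeZero n] :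
    vertexProbe n = (PMF.uniformOfFintype (Fin n)).bind fun w => PMF.pure (w : ℕ) :=
  PMF.map_id _

lemma run_seq_randNeighbor [NeZero n] {x y : ℕ} {q : Cmd} {m : Config} {v : Fin n}
    (hv : m.reg y = v) :
    run G (.seq (.randNeighbor x y) q) m
      = (neighborDist G v).bind fun w => run G q (m.setReg x w) := by
  rw [run, run, hv, neighborProbe_coe, PMF.bind_map, PMF.bind_bind]
  simp only [PMF.pure_bind, Function.comp_apply]

lemma run_seq_randVertex [NeZero n] {x : ℕ} {q : Cmd} {m : Config} :
    run G (.seq (.randVertex x) q) m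
      = (PMF.uniformOfFintype (Fin n)).bind fun w => run G q (m.setReg x w) := by
  rw [run, run, vertexProbe_eq, PMF.bind_map, PMF.bind_bind]
  simp only [PMF.pure_bind, Function.comp_apply]

/-- The state of `walkStore` after `j` steps along `X`, when it is started in `m₀` with the
addresses `ad`. -/
structure WalkInv (m₀ : Config) (u : Fin n) (ad : ℕ → ℕ) (M : ℕ) (j : ℕ) (m : Config)
    (X : ℕ → Fin n) : Prop where
  start : X 0 = u
  reg : ∀ y, y ≠ 14 → y ≠ 15 → y ≠ 16 → m.reg y = m₀.reg y
  reg14 : m.reg 14 = X j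
  reg15 : m.reg 15 = ad j
  work : m.work = m₀.work
  storeIn : ∀ i, 1 ≤ i → i ≤ j → m.store (ad i) = X i + 1
  storeOut : ∀ c, (∀ i, 1 ≤ i → i ≤ j → c ≠ ad i) → m.store c = m₀.store c
  time : m.time ≤ m₀.time + 3 + 5 * j
  peak : m.peak ≤ M

/-- The address sequence `ad` is abstract so that one proof covers walks forwards and backwards in
time. Injectivity keeps later writes from destroying earlier ones. -/
lemma sim_walkStore [NeZero n] {o : ArithOp} {x k M : ℕ} {m₀ : Config} {u : Fin n} {ad : ℕ → ℕ}
    (hx : x ≠ 14) (hk : m₀.reg x = k) (h5 : m₀.reg 5 = 1)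
    (h15 : m₀.reg 15 = ad 0) (hu : m₀.store (ad 0) - 1 = u) (had : ∀ j, o.eval (ad j) 1 = ad (j + 1))
    (hinj : ∀ i j, i < j → j ≤ k → ad i ≠ ad j) (hM : ∀ j ≤ k, ad j ≤ M) (hn : n + 1 ≤ M)
    (hM0 : m₀.peak ≤ M) :
    Sim (run G (walkStore o x) m₀) (walkFrom G u k) (WalkInv m₀ u ad M k) := by
  have hadM := hM 0 (by omega)
  simp only [walkStore, run, PMF.pure_bind, ArithOp.eval_sub]
  set m₁ := (m₀.setReg 14 (m₀.store (m₀.reg 15))).setReg 14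
    (((m₀.setReg 14 (m₀.store (m₀.reg 15)))).reg 14
      - (m₀.setReg 14 (m₀.store (m₀.reg 15))).reg 5) with hm₁
  have hk' : m₁.reg x = k := by simp [hm₁, hx, hk]
  rw [hk']
  refine Sim.iterate (s := fun i X => (neighborDist G (X i)).map fun v =>
    Function.update X (i + 1) v) (fun i => rfl) (Sim.pure ?_) ?_
  · have hu' : m₀.store (m₀.reg 15) - m₀.reg 5 = u := by rw [h15, h5, hu]
    refine ⟨by simp, ?_, ?_, ?_, ?_, ?_, ?_, ?_, ?_⟩
    · intro y h1 h2 h3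
      simp [hm₁, h1]
    · simp [hm₁, hu']
    · simp [hm₁, h15]
    · simp [hm₁]
    · intro i h1 h2
      omega
    · intro c _
      simp [hm₁]
    · simp [hm₁]
    · have : m₀.store (m₀.reg 15) ≤ M := by rw [h15]; have := u.2; omega
      have := u.2
      simp [hm₁, hu', hM0]
      omega
  · intro i hi m X hX
    have e5 : m.reg 5 = 1 := by rw [hX.reg 5 (by omega) (by omega) (by omega), h5]
    rw [walkStep, run_seq_randNeighbor G (v := X i) (by simp [hX.reg14])]
    refine Sim.of_bind_map fun v => ?_
    simp only [run, PMF.pure_bind, ArithOp.eval_add]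
    refine Sim.pure ?_
    have hv := v.2
    refine ⟨by simp [hX.start], ?_, ?_, ?_, ?_, ?_, ?_, ?_, ?_⟩
    · intro y h1 h2 h3
      simp [h1, h2, h3, hX.reg y h1 h2 h3]
    · simp
    · simp [hX.reg15, e5, had]
    · simp [hX.work]
    · intro a h1 h2
      rcases h2.lt_or_eq with h | rfl
      · have hne : ad a ≠ ad (i + 1) := hinj _ _ h (by omega)
        simp [hX.reg15, e5, had, Finsupp.update_apply, hne, hX.storeIn a h1 (by omega),
          Function.update_of_ne h.ne]
      · simp [hX.reg15, e5, had]
    · intro c hc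
      have hne : c ≠ ad (i + 1) := hc _ (by omega) le_rfl
      simp [hX.reg15, e5, had, Finsupp.update_apply, hne,
        hX.storeOut c fun a h1 h2 => hc a h1 (by omega)]
    · have := hX.time
      simp
      omega
    · have := hX.peak
      have := hM (i + 1) (by omega)
      simp [hX.reg15, e5, had]
      omega

end

/-! ### The table of walks in the working memory -/

/-- One step of a walk from the vertex in register `14`, recorded in the working memory. -/
def recordStep : Cmd :=
  .seq (.randNeighbor 14 14) (.seq (.writeWork 22 14) (.arith .add 22 22 5))

/-- A walk from the vertex in register `23`, recorded in the working memory; the cell of its last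
vertex gets a pointer to the end of the record. -/
def recordWalk : Cmd :=
  .seq (.arith .add 14 23 9) (.seq (.loop 18 recordStep) (.writeWork 14 22))

section

variable {n : ℕ} (G : SimpleGraph (Fin n)) [DecidableRel G.Adj]

/-- The state of `recordWalk` after `j` steps along `X`. -/
structure RecordInv (m₀ : Config) (u : Fin n) (p M : ℕ) (j : ℕ) (m : Config)
    (X : ℕ → Fin n) : Prop where
  reg : ∀ y, y ≠ 14 → y ≠ 22 → m.reg y = m₀.reg y
  reg14 : m.reg 14 = X j
  reg22 : m.reg 22 = p + j
  workIn : ∀ i < j, m.work (p + i) = X (i + 1)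
  workOut : ∀ c, c < p ∨ p + j ≤ c → m.work c = m₀.work c
  store : m.store = m₀.store
  time : m.time ≤ m₀.time + 1 + 4 * j
  peak : m.peak ≤ M

lemma sim_recordLoop [NeZero n] {k p M : ℕ} {m₀ : Config} {u : Fin n}
    (hk : m₀.reg 18 = k) (h5 : m₀.reg 5 = 1) (h14 : m₀.reg 14 = u) (h22 : m₀.reg 22 = p)
    (hn : n ≤ M) (hp : p + k ≤ M) (hM0 : m₀.peak ≤ M) :
    Sim (run G (.loop 18 recordStep) m₀) (walkFrom G u k) (RecordInv m₀ u p M k) := by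
  rw [run, hk]
  refine Sim.iterate (s := fun i X => (neighborDist G (X i)).map fun v =>
    Function.update X (i + 1) v) (fun i => rfl) (Sim.pure ?_) ?_
  · exact ⟨fun _ _ _ => rfl, by simp [h14], by simp [h22], fun i hi => by omega, fun _ _ => rfl,
      rfl, by simp, hM0⟩
  · intro i hi m X hX
    have e5 : m.reg 5 = 1 := by rw [hX.reg 5 (by omega) (by omega), h5]
    rw [recordStep, run_seq_randNeighbor G (v := X i) (by simp [hX.reg14])]
    refine Sim.of_bind_map fun v => ?_
    simp only [run, PMF.pure_bind, ArithOp.eval_add]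
    refine Sim.pure ?_
    have hv := v.2
    refine ⟨?_, by simp, ?_, ?_, ?_, by simp [hX.store], ?_, ?_⟩
    · intro y h1 h2
      simp [h1, h2, hX.reg y h1 h2]
    · simp [hX.reg22, e5, add_assoc]
    · intro a ha
      rcases Nat.lt_succ_iff_lt_or_eq.1 ha with h | rfl
      · have h1 : p + a ≠ p + i := by omega
        have h2 : a + 1 ≠ i + 1 := by omega
        simp [hX.reg22, h.ne, hX.workIn a h]
      · simp [hX.reg22]
    · intro c hc
      have hne : c ≠ p + i := by omega
      simp [hX.reg22, hne, hX.workOut c (by omega)]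
    · have := hX.time
      simp
      omega
    · have := hX.peak
      simp [hX.reg22, e5]
      omega

/-- The state of the machine after `i` recorded walks of length `l`, which make up the
table `T`. -/
structure TableInv (m₀ : Config) (l M : ℕ) (i : ℕ) (m : Config)
    (T : Fin n → Option (ℕ → Fin n)) : Prop where
  reg : ∀ y, y ≠ 14 → y ≠ 22 → m.reg y = m₀.reg y
  reg22 : m.reg 22 = n + i * l
  store : m.store = m₀.store
  none : ∀ w, T w = none → m.work w = 0
  some : ∀ w α, T w = some α → α l = w ∧ n + l ≤ m.work w ∧ m.work w ≤ n + i * l ∧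
    ∀ j < l, m.work (m.work w - l + j) = α (j + 1)
  time : m.time ≤ m₀.time + 1 + i * (4 * l + 4)
  peak : m.peak ≤ M

/-- The cells below `n` are the table, indexed by end vertices, and the paths are stored one after
the other from cell `n` on. A later walk with the same end replaces the pointer but no path, which
is why the table keeps the last sample with a given end. -/
lemma sim_recordWalks [NeZero n] {l K M : ℕ} {m₀ : Config} {u : Fin n}
    (h5 : m₀.reg 5 = 1) (h8 : m₀.reg 8 = K) (h9 : m₀.reg 9 = 0) (h18 : m₀.reg 18 = l)
    (h22 : m₀.reg 22 = n) (h23 : m₀.reg 23 = u) (hw : m₀.work = fun _ => 0)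
    (hM : n + K * l ≤ M) (hM0 : m₀.peak ≤ M) :
    Sim (run G (.loop 8 recordWalk) m₀) (tableLaw (walkFrom G u l) (fun X => X l) K)
      (TableInv m₀ l M K) := by
  rw [run, h8]
  refine Sim.iterate (s := fun i (T : Fin n → Option (ℕ → Fin n)) => (walkFrom G u l).map fun b =>
    Function.update T (b l) (some b)) (fun i => rfl) (Sim.pure ?_) ?_
  · exact ⟨fun _ _ _ => rfl, by simp [h22], rfl, by simp [hw], by simp, by simp, hM0⟩
  · intro i hi m T hT
    have e5 : m.reg 5 = 1 := by rw [hT.reg 5 (by omega) (by omega), h5]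
    have e9 : m.reg 9 = 0 := by rw [hT.reg 9 (by omega) (by omega), h9]
    have e18 : m.reg 18 = l := by rw [hT.reg 18 (by omega) (by omega), h18]
    have e23 : m.reg 23 = u := by rw [hT.reg 23 (by omega) (by omega), h23]
    have hil : (i + 1) * l ≤ K * l := Nat.mul_le_mul_right _ hi
    have hil' : (i + 1) * l = i * l + l := by ring
    have hit : (i + 1) * (4 * l + 4) = i * (4 * l + 4) + (4 * l + 4) := by ring
    have hu := u.2
    have hTp := hT.peak
    have hTt := hT.time
    rw [recordWalk, run, run, PMF.pure_bind, run, ArithOp.eval_add]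
    set m₁ := m.tick.setReg 14 (m.tick.reg 23 + m.tick.reg 9) with hm₁
    have hs := sim_recordLoop G (m₀ := m₁) (u := u) (k := l) (p := n + i * l) (M := M)
      (by simp [hm₁, e18]) (by simp [hm₁, e5]) (by simp [hm₁, e23, e9])
      (by simp [hm₁, hT.reg22]) (by omega) (by omega) (by simp [hm₁, e23, e9]; omega)
    refine Sim.map_right _ (hs.bind_ensures fun m' X hX => ensures_pure ?_)
    have hXl := (X l).2
    have hptr : m'.reg 22 = n + (i + 1) * l := by rw [hX.reg22]; omega
    refine ⟨?_, by simp [hptr], by simp [hX.store, hm₁, hT.store], ?_, ?_, ?_, by simp [hX.peak]⟩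
    · intro y h1 h2
      simp [hX.reg y h1 h2, hm₁, h1, hT.reg y h1 h2]
    · intro w hwT
      by_cases hwl : w = X l
      · simp [hwl] at hwT
      · rw [Function.update_of_ne hwl] at hwT
        have hne : (w : ℕ) ≠ X l := fun h => hwl (Fin.ext h)
        have hww := w.2
        simp [hX.reg14, hne, hX.workOut w (by omega), hm₁, hT.none w hwT]
    · intro w α hwT
      by_cases hwl : w = X l
      · subst hwl
        rw [Function.update_self, Option.some.injEq] at hwT
        subst hwT
        refine ⟨rfl, by simp [hX.reg14, hptr]; omega, by simp [hX.reg14, hptr], ?_⟩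
        intro j hj
        -- The pointer is to the cell after the record, so the record starts `l` cells before it,
        -- and it lies above the table.
        have h1 : n + (i + 1) * l - l + j = (n + i * l) + j := by omega
        have h2 : n + i * l + j ≠ X l := by omega
        simp only [Config.setWork_work, hX.reg14, Function.update_self, hptr, h1,
          Function.update_of_ne h2]
        exact hX.workIn j hj
      · rw [Function.update_of_ne hwl] at hwT
        obtain ⟨h1, h2, h3, h4⟩ := hT.some w α hwT
        have hne : (w : ℕ) ≠ X l := fun h => hwl (Fin.ext h)
        have hww := w.2
        have e : (m'.setWork (m'.reg 14) (m'.reg 22)).work w = m.work w := by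
          simp [hX.reg14, hne, hX.workOut w (by omega), hm₁]
        rw [e]
        refine ⟨h1, h2, by omega, ?_⟩
        intro j hj
        have h5 : m.work w - l + j ≠ X l := by omega
        rw [← h4 j hj]
        simp only [Config.setWork_work, hX.reg14, Function.update_of_ne h5]
        rw [hX.workOut _ (by omega)]
        simp [hm₁]
    · have := hX.time
      simp [hm₁] at this
      simp
      omega

end

/-! ### Bridging a gap by a collision of walks -/

/-- A walk backwards in time from the vertex recorded at the time in register `21`, unless
register `24` is positive. Register `24` receives the table entry of the last vertex. -/
def hitWalk : Cmd :=
  .ifLt 24 5 (.seq (.arith .add 15 21 9) (.seq (walkStore .sub 19) (.readWork 24 14)))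
    (.const 16 0)

/-- Copy one vertex of a recorded walk to the persistent memory. -/
def copyStep : Cmd :=
  .seq (.arith .sub 24 24 5) (.seq (.readWork 16 24) (.seq (.arith .add 16 16 5)
    (.seq (.writeStore 15 16) (.arith .sub 15 15 5))))

/-- Copy the recorded walk to whose end register `24` points to the persistent memory. -/
def copyPath : Cmd :=
  .ifLt 9 24 (.seq (.arith .add 15 20 18) (.loop 18 copyStep)) (.const 16 0)

/-- Fill the gap of length `dl + dr` between two recorded positions, where `dl` and `dr` are in
registers `11` and `13`. -/
def bridge : Cmd :=
  .seq (.arith .add 17 11 13) (.seq (.const 12 2) (.seq (.arith .div 18 17 12)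
  (.seq (.arith .sub 19 17 18) (.seq (.arith .sub 20 0 11) (.seq (.arith .add 21 0 13)
  (.seq (.arith .add 22 1 9) (.seq (.readStore 23 20) (.seq (.arith .sub 23 23 5)
  (.seq (.loop 8 recordWalk) (.seq (.const 24 0) (.seq (.loop 8 hitWalk) copyPath)))))))))))

section

variable {n : ℕ} (G : SimpleGraph (Fin n)) [DecidableRel G.Adj]

/-- The state of the machine after `i` walks of length `l` backwards from time `b`. -/
structure HitInv (m₀ : Config) (b l M : ℕ) (T : Fin n → Option (ℕ → Fin n)) (i : ℕ) (m : Config)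
    (o : Option (ℕ → Fin n)) : Prop where
  reg : ∀ y, y ≠ 14 → y ≠ 15 → y ≠ 16 → y ≠ 24 → m.reg y = m₀.reg y
  work : m.work = m₀.work
  storeOut : ∀ c, b ≤ c ∨ c < b - l → m.store c = m₀.store c
  bound : ∀ c, m.store c ≤ n
  none : o = none → m.reg 24 = 0
  some : ∀ β, o = some β → (T (β l)).isSome ∧ m.reg 24 = m₀.work (β l) ∧
    ∀ j, 1 ≤ j → j ≤ l → m.store (b - j) = β j + 1
  time : m.time ≤ m₀.time + 1 + i * (5 * l + 8)
  peak : m.peak ≤ M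

/-- Each attempt rewrites the same `l` cells to the left of `b`, so it erases the failed attempts
before it. Register `24` doubles as the success flag: an empty table cell is `0` and a pointer is
positive, so after a hit the remaining passes do nothing. -/
lemma sim_hitWalks [NeZero n] {b l K M : ℕ} {m₀ : Config} {v : Fin n}
    {T : Fin n → Option (ℕ → Fin n)}
    (h5 : m₀.reg 5 = 1) (h8 : m₀.reg 8 = K) (h9 : m₀.reg 9 = 0) (h19 : m₀.reg 19 = l)
    (h21 : m₀.reg 21 = b) (h24 : m₀.reg 24 = 0) (hb : m₀.store b - 1 = v) (hlb : l ≤ b)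
    (hbound : ∀ c, m₀.store c ≤ n) (hnone : ∀ w, T w = none → m₀.work w = 0)
    (hsome : ∀ w, (T w).isSome → 1 ≤ m₀.work w ∧ m₀.work w ≤ M)
    (hbM : b ≤ M) (hn : n + 1 ≤ M) (hM0 : m₀.peak ≤ M) :
    Sim (run G (.loop 8 hitWalk) m₀) (hitLaw (walkFrom G v l) (fun X => X l) T K)
      (HitInv m₀ b l M T K) := by
  rw [run, h8]
  refine Sim.iterate (s := fun i o => match o with
    | some c => PMF.pure (some c)
    | none => (walkFrom G v l).map fun c => if (T (c l)).isSome then some c else none)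
    (fun i => by rw [hitLaw]; exact congrArg _ (funext fun o => by cases o <;> rfl))
    (Sim.pure ?_) ?_
  · exact ⟨fun _ _ _ _ _ => rfl, rfl, fun _ _ => rfl, hbound, fun _ => h24, by simp, by simp, hM0⟩
  · intro i hi m o ho
    have e5 : m.reg 5 = 1 := by rw [ho.reg 5 (by omega) (by omega) (by omega) (by omega), h5]
    have hit : (i + 1) * (5 * l + 8) = i * (5 * l + 8) + (5 * l + 8) := by ring
    have hot := ho.time
    have hop := ho.peak
    rw [hitWalk, run]
    cases o with
    | some β =>
      obtain ⟨h1, h2, h3⟩ := ho.some β rfl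
      have h4 := (hsome _ h1).1
      rw [if_neg (by simp [e5, h2]; omega), run]
      refine Sim.pure ⟨?_, by simp [ho.work], ?_, by simp [ho.bound], by simp, ?_, ?_,
        by simp [hop]⟩
      · intro y y1 y2 y3 y4
        simp [y3, ho.reg y y1 y2 y3 y4]
      · intro c hc
        simp [ho.storeOut c hc]
      · intro β' hβ'
        obtain rfl : β = β' := by simpa using hβ'
        exact ⟨h1, by simp [h2], by simpa using h3⟩
      · simp
        omega
    | none =>
      have h24' := ho.none rfl
      have e9 : m.reg 9 = 0 := by rw [ho.reg 9 (by omega) (by omega) (by omega) (by omega), h9]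
      have e19 : m.reg 19 = l := by
        rw [ho.reg 19 (by omega) (by omega) (by omega) (by omega), h19]
      have e21 : m.reg 21 = b := by
        rw [ho.reg 21 (by omega) (by omega) (by omega) (by omega), h21]
      rw [if_pos (by simp [e5, h24']), run, run, PMF.pure_bind, run, ArithOp.eval_add]
      set m₁ := m.tick.tick.setReg 15 (m.tick.tick.reg 21 + m.tick.tick.reg 9) with hm₁
      have hs := sim_walkStore G (o := .sub) (x := 19) (k := l) (M := M) (m₀ := m₁) (u := v)
        (ad := fun j => b - j) (by omega) (by simp [hm₁, e19]) (by simp [hm₁, e5])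
        (by simp [hm₁, e21, e9])
        (by simp [hm₁, ho.storeOut b (Or.inl le_rfl), hb])
        (fun j => by simp [ArithOp.eval_sub, Nat.sub_sub]) (fun i j h1 h2 => by omega)
        (fun j _ => by omega) hn (by simp [hm₁, e21, e9]; omega)
      refine Sim.map_right _ (hs.bind_ensures fun m' X hX => ?_)
      rw [run]
      refine ensures_pure ?_
      have ework : m'.work = m₀.work := by rw [hX.work]; simp [hm₁, ho.work]
      have hXtime := hX.time
      have hXpeak := hX.peak
      have hst : ∀ c, (b ≤ c ∨ c < b - l) → m'.store c = m.store c := fun c hc => by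
        rw [hX.storeOut c fun i h1 h2 => by omega]
        simp [hm₁]
      have hpos : ∀ c, ¬ (b ≤ c ∨ c < b - l) → m'.store c = X (b - c) + 1 := fun c hc => by
        have := hX.storeIn (b - c) (by omega) (by omega)
        rwa [show b - (b - c) = c by omega] at this
      refine ⟨?_, by simp [ework], ?_, ?_, ?_, ?_, ?_, ?_⟩
      · intro y y1 y2 y3 y4
        simp [y4, hX.reg y y1 y2 y3, hm₁, y2, ho.reg y y1 y2 y3 y4]
      · intro c hc
        simp [hst c hc, ho.storeOut c hc]
      · intro c
        by_cases hc : b ≤ c ∨ c < b - l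
        · simp [hst c hc, ho.bound c]
        · simp [hpos c hc]
      · intro hn
        have : T (X l) = none := by
          by_contra hc
          rw [if_pos (Option.isSome_iff_ne_none.2 hc)] at hn
          simp at hn
        simp [hX.reg14, ework, hnone _ this]
      · intro β hβ
        by_cases hc : (T (X l)).isSome
        · rw [if_pos hc, Option.some.injEq] at hβ
          subst hβ
          refine ⟨hc, by simp [hX.reg14, ework], ?_⟩
          simpa using hX.storeIn
        · rw [if_neg hc] at hβ
          simp at hβ
      · simp [hm₁] at hXtime
        simp
        omega
      · have : m₀.work (X l) ≤ M := by
          by_cases hc : (T (X l)).isSome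
          · exact (hsome _ hc).2
          · rw [hnone _ (by simpa using hc)]
            omega
        simp [hX.reg14, ework, hXpeak, this]

/-- The state of `copyPath` after `j` of `l` vertices have been copied. -/
structure CopyInv (m₀ : Config) (a l p M : ℕ) (α : ℕ → Fin n) (j : ℕ) (m : Config) : Prop where
  reg : ∀ y, y ≠ 15 → y ≠ 16 → y ≠ 24 → m.reg y = m₀.reg y
  reg24 : m.reg 24 = p - j
  reg15 : m.reg 15 = a + l - j
  work : m.work = m₀.work
  storeIn : ∀ i, a + l - j < i → i ≤ a + l → m.store i = α (i - a) + 1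
  storeOut : ∀ i, ¬ (a + l - j < i ∧ i ≤ a + l) → m.store i = m₀.store i
  time : m.time ≤ m₀.time + 3 + 6 * j
  peak : m.peak ≤ M

lemma ensures_copyPath [NeZero n] {a l p M : ℕ} {m₀ : Config} {α : ℕ → Fin n}
    (h5 : m₀.reg 5 = 1) (h9 : m₀.reg 9 = 0) (h18 : m₀.reg 18 = l) (h20 : m₀.reg 20 = a)
    (h24 : m₀.reg 24 = p) (hp : 0 < p) (hlp : l ≤ p) (hpM : p ≤ M)
    (hα : ∀ j < l, m₀.work (p - l + j) = α (j + 1)) (hal : a + l ≤ M) (hn : n + 1 ≤ M)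
    (hM0 : m₀.peak ≤ M) :
    Ensures (run G copyPath m₀) (CopyInv m₀ a l p M α l) := by
  rw [copyPath, run, if_pos (by rw [h9, h24]; exact hp), run, run, PMF.pure_bind, run,
    ArithOp.eval_add]
  have e18 : (m₀.tick.setReg 15 (m₀.tick.reg 20 + m₀.tick.reg 18)).reg 18 = l := by simp [h18]
  rw [e18]
  refine Ensures.iterate ?_ ?_
  · refine ⟨?_, by simp [h24], by simp [h20, h18], by simp, fun i _ _ => by omega, by simp,
      by simp, by simp [h20, h18]; omega⟩
    intro y y1 y2 y3
    simp [y1]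
  · intro j hj m hm
    have e5 : m.reg 5 = 1 := by rw [hm.reg 5 (by omega) (by omega) (by omega), h5]
    have hw : m.work (p - j - 1) = α (l - j) := by
      have := hα (l - j - 1) (by omega)
      rw [hm.work, ← show l - j - 1 + 1 = l - j by omega, ← this]
      congr 1
      omega
    have hαn := (α (l - j)).2
    have hmt := hm.time
    have hmp := hm.peak
    simp only [copyStep, run, PMF.pure_bind, ArithOp.eval_add, ArithOp.eval_sub]
    refine ensures_pure ⟨?_, ?_, ?_, by simp [hm.work], ?_, ?_, ?_, ?_⟩
    · intro y y1 y2 y3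
      simp [y1, y2, y3, hm.reg y y1 y2 y3]
    · simp [hm.reg24, e5]
      omega
    · simp [hm.reg15, e5]
      omega
    · intro i h1 h2
      by_cases hi : i = a + l - j
      · subst hi
        rw [show a + l - j - a = l - j by omega]
        simp [hm.reg15, hm.reg24, e5, hw]
      · simp [hm.reg15, Finsupp.update_apply, hi, hm.storeIn i (by omega) h2]
    · intro i hi
      have hi' : i ≠ a + l - j := by omega
      simp [hm.reg15, Finsupp.update_apply, hi', hm.storeOut i (by omega)]
    · simp
      omega
    · simp [hm.reg15, hm.reg24, e5, hw]
      omega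

end

/-! ### Extending the record around the queried time -/

/-- Extend the record around the queried time: `dl` and `dr` (in registers `11` and `13`) are the
distances to the nearest recorded times, and a distance of at least `L` (in register `7`) means
that there is none nearby. -/
def extendRecord : Cmd :=
  .ifLt 11 7
    (.ifLt 13 7
      (.ifLt 9 11 bridge (.const 16 0))
      (.seq (.arith .sub 15 0 11) (walkStore .add 11)))
    (.ifLt 13 7
      (.seq (.arith .add 15 0 13) (walkStore .sub 13))
      (.seq (.randVertex 14) (.seq (.arith .add 14 14 5) (.writeStore 0 14))))

/-- The times at which `extendRecord` adds a position to the record. -/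
def NewTime (L t dl dr c : ℕ) : Prop :=
  (if dl < L then t - dl < c else t ≤ c) ∧ (if dr < L then c < t + dr else c ≤ t)

instance (L t dl dr c : ℕ) : Decidable (NewTime L t dl dr c) :=
  inferInstanceAs (Decidable (_ ∧ _))

/-- A walk from time `a` for `l` steps, and then a reversed walk from time `b`. -/
def glue {n : ℕ} (a l b : ℕ) (αβ : (ℕ → Fin n) × (ℕ → Fin n)) (c : ℕ) : Fin n :=
  if c ≤ a + l then αβ.1 (c - a) else αβ.2 (b - c)

/-- The vertex that is recorded by the word `v + 1`. -/
def vertexOf (n : ℕ) [NeZero n] (w : ℕ) : Fin n := Fin.ofNat n (w - 1)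

lemma coe_vertexOf {n : ℕ} [NeZero n] {w : ℕ} (hw : w ≤ n) : (vertexOf n w : ℕ) = w - 1 := by
  have := NeZero.pos n
  rw [vertexOf, Fin.val_ofNat, Nat.mod_eq_of_lt (by omega)]

section

variable {n : ℕ} [NeZero n] (G : SimpleGraph (Fin n)) [DecidableRel G.Adj]

/-- The law of the positions that `extendRecord` adds to the record `σ`. -/
def extensionLaw (σ : ℕ → ℕ) (t L K dl dr : ℕ) : PMF (Option (ℕ → Fin n)) :=
  if dl < L then
    if dr < L then
      if 0 < dl then
        (collisionLaw
          (walkFrom G (vertexOf n (σ (t - dl))) ((dl + dr) / 2)) (fun X => X ((dl + dr) / 2))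
          (walkFrom G (vertexOf n (σ (t + dr))) (dl + dr - (dl + dr) / 2))
          (fun X => X (dl + dr - (dl + dr) / 2)) K).map
        (Option.map (glue (t - dl) ((dl + dr) / 2) (t + dr)))
      else PMF.pure (some fun _ => 0)
    else (walkFrom G (vertexOf n (σ (t - dl))) dl).map fun X => some fun c => X (c - (t - dl))
  else
    if dr < L then
      (walkFrom G (vertexOf n (σ (t + dr))) dr).map fun X => some fun c => X (t + dr - c)
    else (PMF.uniformOfFintype (Fin n)).map fun v => some fun _ => v

/-- The state of the machine before `extendRecord`. -/
structure Ready (σ : ℕ → ℕ) (t L K dl dr Θ M : ℕ) (m : Config) : Prop where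
  reg0 : m.reg 0 = t
  reg1 : m.reg 1 = n
  reg5 : m.reg 5 = 1
  reg7 : m.reg 7 = L
  reg8 : m.reg 8 = K
  reg9 : m.reg 9 = 0
  reg11 : m.reg 11 = dl
  reg13 : m.reg 13 = dr
  store : ∀ c, m.store c = σ c
  work : m.work = fun _ => 0
  time : m.time ≤ Θ
  peak : m.peak ≤ M

/-- The state of the machine after `extendRecord`, if the positions `o` have been added. -/
structure Extended (n : ℕ) (σ : ℕ → ℕ) (t : ℕ) (new : ℕ → Prop) (Θ M : ℕ) (m : Config)
    (o : Option (ℕ → Fin n)) : Prop where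
  reg0 : m.reg 0 = t
  reg5 : m.reg 5 = 1
  bound : ∀ c, m.store c ≤ n
  storeOut : ∀ c, ¬ new c → m.store c = σ c
  storeIn : ∀ x, o = some x → ∀ c, new c → m.store c = x c + 1
  time : m.time ≤ Θ
  peak : m.peak ≤ M

set_option maxHeartbeats 1000000 in
-- The two half walks end at the common time `t - dl + l`. The backward one is already in place;
-- copying the forward one up to this time rewrites the meeting vertex by itself.
lemma sim_bridge {σ : ℕ → ℕ} {t L K dl dr Θ M : ℕ} {m₀ : Config}
    (h : Ready (n := n) σ t L K dl dr Θ M m₀) (hdl : 0 < dl) (hdr : 0 < dr) (hdlt : dl ≤ t)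
    (hdlL : dl < L) (hdrL : dr < L) (hσ : ∀ c, σ c ≤ n) (htM : t + 2 * L ≤ M)
    (hn : n + 1 ≤ M) (hKM : n + K * L ≤ M) :
    Sim (run G bridge m₀) (collisionLaw
        (walkFrom G (vertexOf n (σ (t - dl))) ((dl + dr) / 2)) (fun X => X ((dl + dr) / 2))
        (walkFrom G (vertexOf n (σ (t + dr))) (dl + dr - (dl + dr) / 2))
        (fun X => X (dl + dr - (dl + dr) / 2)) K)
      fun m o => Extended n σ t (fun c => t - dl < c ∧ c < t + dr)
        (Θ + (K * (9 * L + 12) + 6 * L + 20)) M m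
        (o.map (glue (t - dl) ((dl + dr) / 2) (t + dr))) := by
  set l := (dl + dr) / 2 with hl
  set l' := dl + dr - l with hl'
  have hlL : l ≤ L := by omega
  have hlL' : l' ≤ L := by omega
  have hKl : K * l ≤ K * L := Nat.mul_le_mul_left _ hlL
  set u := vertexOf n (σ (t - dl)) with hu
  set v := vertexOf n (σ (t + dr)) with hv
  have hu' : σ (t - dl) - 1 = u := (coe_vertexOf (hσ _)).symm
  have hv' : σ (t + dr) - 1 = v := (coe_vertexOf (hσ _)).symm
  have hσu := hσ (t - dl)
  have hulM := u.2
  simp only [bridge]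
  rw [run, run, PMF.pure_bind, run, run, PMF.pure_bind, run, run, PMF.pure_bind, run, run,
    PMF.pure_bind, run, run, PMF.pure_bind, run, run, PMF.pure_bind, run, run, PMF.pure_bind,
    run, run, PMF.pure_bind, run, run, PMF.pure_bind, run]
  simp only [ArithOp.eval_add, ArithOp.eval_sub, ArithOp.eval_div]
  generalize hm₁ : Config.setReg _ 23 (_ - _) = m₁
  have r0 : m₁.reg 0 = t := by simp [← hm₁, h.reg0]
  have r5 : m₁.reg 5 = 1 := by simp [← hm₁, h.reg5]
  have r8 : m₁.reg 8 = K := by simp [← hm₁, h.reg8]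
  have r9 : m₁.reg 9 = 0 := by simp [← hm₁, h.reg9]
  have r18 : m₁.reg 18 = l := by simp [← hm₁, h.reg11, h.reg13, hl]
  have r19 : m₁.reg 19 = l' := by simp [← hm₁, h.reg11, h.reg13, hl, hl']
  have r20 : m₁.reg 20 = t - dl := by simp [← hm₁, h.reg0, h.reg11]
  have r21 : m₁.reg 21 = t + dr := by simp [← hm₁, h.reg0, h.reg13]
  have r22 : m₁.reg 22 = n := by simp [← hm₁, h.reg1, h.reg9]
  have r23 : m₁.reg 23 = u := by simp [← hm₁, h.reg0, h.reg11, h.reg5, h.store, hu']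
  have e1 : m₁.work = fun _ => 0 := by simp [← hm₁, h.work]
  have e2 : ∀ c, m₁.store c = σ c := by simp [← hm₁, h.store]
  have e3 : m₁.time ≤ Θ + 9 := by
    have := h.time
    simp [← hm₁]
    omega
  have e4 : m₁.peak ≤ M := by
    have := h.peak
    simp [← hm₁, h.reg0, h.reg1, h.reg5, h.reg9, h.reg11, h.reg13, h.store, hu']
    omega
  clear hm₁
  refine (sim_recordWalks G r5 r8 r9 r18 r22 r23 e1 (M := M) (by omega) e4).bind ?_
  intro m₂ T hT
  have htT := hT.time
  have hpT := hT.peak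
  rw [run, run, PMF.pure_bind, run]
  refine Sim.map_right _ ?_
  have s2 : ∀ c, (m₂.setReg 24 0).store c = σ c := by simp [hT.store, e2]
  refine (sim_hitWalks G (m₀ := m₂.setReg 24 0) (b := t + dr) (l := l') (v := v) (T := T)
    (M := M) (K := K) ?_ ?_ ?_ ?_ ?_ (by simp) (by simp [hT.store, e2, hv']) (by omega)
    (by simp [hT.store, e2, hσ]) (by simpa using hT.none) ?_ (by omega) hn
    (by simp [hpT])).bind_ensures ?_
  · simp [hT.reg 5, r5]
  · simp [hT.reg 8, r8]
  · simp [hT.reg 9, r9]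
  · simp [hT.reg 19, r19]
  · simp [hT.reg 21, r21]
  · intro w hw
    obtain ⟨α, hα⟩ := Option.isSome_iff_exists.1 hw
    obtain ⟨-, h2, h3, -⟩ := hT.some w α hα
    have := NeZero.pos n
    simp
    omega
  intro m₃ o ho
  have hto := ho.time
  simp only [Config.setReg_time] at hto
  have hpo := ho.peak
  have q0 : m₃.reg 0 = t := by
    rw [ho.reg 0 (by omega) (by omega) (by omega) (by omega)]
    simp [hT.reg 0, r0]
  have q5 : m₃.reg 5 = 1 := by
    rw [ho.reg 5 (by omega) (by omega) (by omega) (by omega)]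
    simp [hT.reg 5, r5]
  have q9 : m₃.reg 9 = 0 := by
    rw [ho.reg 9 (by omega) (by omega) (by omega) (by omega)]
    simp [hT.reg 9, r9]
  have q18 : m₃.reg 18 = l := by
    rw [ho.reg 18 (by omega) (by omega) (by omega) (by omega)]
    simp [hT.reg 18, r18]
  have q20 : m₃.reg 20 = t - dl := by
    rw [ho.reg 20 (by omega) (by omega) (by omega) (by omega)]
    simp [hT.reg 20, r20]
  have hK1 : K * (4 * l + 4) ≤ K * (4 * L + 4) := Nat.mul_le_mul_left _ (by omega)
  have hK2 : K * (5 * l' + 8) ≤ K * (5 * L + 8) := Nat.mul_le_mul_left _ (by omega)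
  have hK3 : K * (9 * L + 12) = K * (4 * L + 4) + K * (5 * L + 8) := by ring
  cases o with
  | none =>
    -- Without a collision the last failed walk stays in the gap. Nothing is claimed about its
    -- positions, only that the stored words do not exceed `n`, so that later queries remain well
    -- behaved.
    have q24 := ho.none rfl
    rw [copyPath, run, if_neg (by simp [q9, q24]), run]
    refine ensures_pure ⟨by simp [q0], by simp [q5], by simp [ho.bound], ?_, by simp, ?_, ?_⟩
    · intro c hc
      simp [ho.storeOut c (by omega), hT.store, e2]
    · simp
      omega
    · simp
      omega
  | some β =>
    obtain ⟨h1, h2, h3⟩ := ho.some β rfl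
    obtain ⟨α, hα⟩ := Option.isSome_iff_exists.1 h1
    obtain ⟨a1, a2, a3, a4⟩ := hT.some _ α hα
    have hnpos := NeZero.pos n
    have hw : (m₂.setReg 24 0).work (β l') = m₂.work (β l') := by simp
    rw [hw] at h2
    intro m₄ hm₄
    have hC := ensures_copyPath G (a := t - dl) (l := l) (p := m₂.work (β l')) (M := M)
      (α := α) q5 q9 q18 q20 h2 (by omega) (by omega) (by omega)
      (by rw [ho.work]; simpa using a4) (by omega) hn hpo m₄ hm₄
    have htC := hC.time
    have hin : ∀ c, t - dl < c ∧ c < t + dr →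
        m₄.store c = glue (t - dl) l (t + dr) (α, β) c + 1 := by
      intro c hc
      by_cases hcl : c ≤ t - dl + l
      · rw [hC.storeIn c (by omega) hcl, glue, if_pos hcl]
      · rw [hC.storeOut c (by omega), glue, if_neg hcl]
        have := h3 (t + dr - c) (by omega) (by omega)
        rwa [show t + dr - (t + dr - c) = c by omega] at this
    have hout : ∀ c, ¬ (t - dl < c ∧ c < t + dr) → m₄.store c = σ c := by
      intro c hc
      rw [hC.storeOut c (by omega), ho.storeOut c (by omega), s2]
    refine ⟨?_, ?_, ?_, hout, ?_, by omega, hC.peak⟩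
    · rw [hC.reg 0 (by omega) (by omega) (by omega), q0]
    · rw [hC.reg 5 (by omega) (by omega) (by omega), q5]
    · intro c
      by_cases hc : t - dl < c ∧ c < t + dr
      · rw [hin c hc]
        exact (glue (t - dl) l (t + dr) (α, β) c).2
      · rw [hout c hc]
        exact hσ c
    · intro x hx c hc
      simp [hα] at hx
      rw [← hx]
      exact hin c hc

end

/-! ### Scanning for recorded times and setting up the parameters -/

/-- The first number below `k` at which `p` fails, or `k` if there is none. -/
def scanDist (p : ℕ → Prop) [DecidablePred p] : ℕ → ℕ
  | 0 => 0
  | k + 1 => if p (scanDist p k) then scanDist p k + 1 else scanDist p k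

section Scan

variable (p : ℕ → Prop) [DecidablePred p]

lemma scanDist_le (k : ℕ) : scanDist p k ≤ k := by
  induction k with
  | zero => rfl
  | succ k ih => rw [scanDist]; split_ifs <;> omega

lemma of_lt_scanDist {k i : ℕ} (hi : i < scanDist p k) : p i := by
  induction k with
  | zero => simp [scanDist] at hi
  | succ k ih =>
    rw [scanDist] at hi
    split_ifs at hi with h
    · rcases Nat.lt_succ_iff_lt_or_eq.1 hi with h' | rfl
      · exact ih h'
      · exact h
    · exact ih hi

lemma not_of_scanDist_lt {k : ℕ} (hk : scanDist p k < k) : ¬ p (scanDist p k) := by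
  induction k with
  | zero => omega
  | succ k ih =>
    rw [scanDist] at hk ⊢
    by_cases h : p (scanDist p k)
    · rw [if_pos h] at hk
      exact absurd h (ih (by omega))
    · rwa [if_neg h]

end Scan

/-- Test whether the time at distance `x` from the queried time is recorded. -/
def scanStep (o : ArithOp) (x : ℕ) : Cmd :=
  .seq (.arith o 12 0 x) (.seq (.readStore 12 12) (.ifLt 12 5 (.arith .add x x 5) (.const 12 0)))

/-- Compute the parameters and mark the start of the walk in the persistent memory. -/
def setup (cL cK : ℕ) : Cmd :=
  .seq (.const 5 1) (.seq (.arith .mul 6 1 2) (.seq (.arith .mul 6 6 3) (.seq (.arith .log 6 6 6)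
  (.seq (.arith .add 6 6 5) (.seq (.const 7 cL) (.seq (.arith .mul 7 7 6) (.seq (.arith .mul 7 7 4)
  (.seq (.arith .add 7 7 7) (.seq (.arith .log 8 1 1) (.seq (.const 10 2)
  (.seq (.arith .div 8 8 10) (.seq (.const 10 1) (.seq (.loop 8 (.arith .add 10 10 10))
  (.seq (.const 8 cK) (.seq (.arith .mul 8 8 6) (.seq (.arith .mul 8 8 10)
  (.seq (.const 9 0) (.writeStore 9 5))))))))))))))))))

/-- The program: it extends the record of the walk so that it contains the queried time. -/
def accessProgram (cL cK : ℕ) : Cmd :=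
  .seq (setup cL cK) (.seq (.loop 7 (scanStep .sub 11)) (.seq (.loop 7 (scanStep .add 13))
    (.seq extendRecord (.seq (.readStore 12 0) (.arith .sub 0 12 5)))))

namespace Params

variable (π : Params)

/-- The logarithm of the required accuracy. -/
def logAcc : ℕ := Nat.log 2 (π.n * π.B * π.invEps) + 1

/-- Recorded times at distance less than `window` are near. -/
def window (cL : ℕ) : ℕ := 2 * (cL * π.logAcc * π.invGap)

/-- An approximation of the square root of the number of vertices. -/
def root : ℕ := 2 ^ (Nat.log 2 π.n / 2)

/-- The number of walks from either end of a gap. -/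
def numWalks (cK : ℕ) : ℕ := cK * π.logAcc * π.root

end Params

section

variable {n : ℕ} [NeZero n] (G : SimpleGraph (Fin n)) [DecidableRel G.Adj]

/-- The state after `j` steps of a scan. -/
structure ScanInv (m₀ : Config) (x : ℕ) (p : ℕ → Prop) [DecidablePred p] (M j : ℕ)
    (m : Config) : Prop where
  reg : ∀ y, y ≠ 12 → y ≠ x → m.reg y = m₀.reg y
  regx : m.reg x = scanDist p j
  work : m.work = m₀.work
  store : m.store = m₀.store
  time : m.time ≤ m₀.time + 1 + 5 * j
  peak : m.peak ≤ M

/-- Loops cannot be left early; once a recorded time is found the counter stops, and the remaining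
passes test the same cell again. -/
lemma ensures_scan {o : ArithOp} {x L M : ℕ} {m₀ : Config} (hx : x ≠ 12) (hx0 : x ≠ 0)
    (hx5 : x ≠ 5) (h5 : m₀.reg 5 = 1) (h7 : m₀.reg 7 = L) (hrx : m₀.reg x = 0)
    (hn : n ≤ M) (hbound : ∀ c, m₀.store c ≤ n) (hoM : ∀ j ≤ L, o.eval (m₀.reg 0) j ≤ M)
    (hLM : L ≤ M) (hM0 : m₀.peak ≤ M) :
    Ensures (run G (.loop 7 (scanStep o x)) m₀)
      (ScanInv m₀ x (fun i => m₀.store (o.eval (m₀.reg 0) i) = 0) M L) := by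
  rw [run, h7]
  refine Ensures.iterate ⟨fun _ _ _ => rfl, by simpa [scanDist] using hrx, rfl, rfl, by simp,
    hM0⟩ ?_
  intro j hj m hm
  have e5 : m.reg 5 = 1 := by rw [hm.reg 5 (by omega) (by omega), h5]
  have e0 : m.reg 0 = m₀.reg 0 := hm.reg 0 (by omega) (by omega)
  have hle := scanDist_le (fun i => m₀.store (o.eval (m₀.reg 0) i) = 0) j
  have hmt := hm.time
  have hmp := hm.peak
  have ho := hoM (scanDist (fun i => m₀.store (o.eval (m₀.reg 0) i) = 0) j) (by omega)
  simp only [scanStep, run, PMF.pure_bind, ArithOp.eval_add]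
  set s := scanDist (fun i => m₀.store (o.eval (m₀.reg 0) i) = 0) j with hs
  have hb := hbound (o.eval (m₀.reg 0) s)
  have hregx : m.reg x = s := hm.regx
  clear_value s
  by_cases h : m₀.store (o.eval (m₀.reg 0) s) = 0
  · rw [if_pos (by simp [e5, e0, hregx, hm.store, h])]
    refine ensures_pure ⟨?_, ?_, by simp [hm.work], by simp [hm.store], by simp; omega, ?_⟩
    · intro y y1 y2
      simp [y1, y2, hm.reg y y1 y2]
    · rw [scanDist, ← hs, if_pos h]
      simp [hx, hregx, e5]
    · simp [hx, hregx, e5, e0, hm.store]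
      omega
  · rw [if_neg (by simp [e5, e0, hregx, hm.store, h])]
    refine ensures_pure ⟨?_, ?_, by simp [hm.work], by simp [hm.store], by simp; omega, ?_⟩
    · intro y y1 y2
      simp [y1, hm.reg y y1 y2]
    · rw [scanDist, ← hs, if_neg h]
      simp [hx, hregx]
    · simp [hregx, e0, hm.store]
      omega

lemma ensures_root {k M : ℕ} {m₀ : Config} (h8 : m₀.reg 8 = k) (h10 : m₀.reg 10 = 1)
    (hM : 2 ^ k ≤ M) (hM0 : m₀.peak ≤ M) :
    Ensures (run G (.loop 8 (.arith .add 10 10 10)) m₀) fun m =>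
      (∀ y, y ≠ 10 → m.reg y = m₀.reg y) ∧ m.reg 10 = 2 ^ k ∧ m.work = m₀.work ∧
        m.store = m₀.store ∧ m.time ≤ m₀.time + 1 + 2 * k ∧ m.peak ≤ M := by
  rw [run, h8]
  refine Ensures.iterate (R := fun j m => (∀ y, y ≠ 10 → m.reg y = m₀.reg y) ∧
    m.reg 10 = 2 ^ j ∧ m.work = m₀.work ∧ m.store = m₀.store ∧
    m.time ≤ m₀.time + 1 + 2 * j ∧ m.peak ≤ M) (by simp [h10, hM0]) ?_
  rintro j hj m ⟨h1, h2, h3, h4, h5, h6⟩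
  have : 2 ^ (j + 1) ≤ 2 ^ k := Nat.pow_le_pow_right (by omega) hj
  rw [pow_succ] at this
  refine ensures_pure ⟨?_, ?_, by simp [h3], by simp [h4], by simp; omega, ?_⟩
  · intro y hy
    simp [hy, h1 y hy]
  · simp [ArithOp.eval_add, h2, pow_succ]
    omega
  · simp [ArithOp.eval_add, h2]
    omega

lemma run_seq_const {x c : ℕ} {q : Cmd} {m : Config} :
    run G (.seq (.const x c) q) m = run G q (m.setReg x c) := by
  rw [run, run, PMF.pure_bind]

lemma run_seq_arith {o : ArithOp} {x y z v : ℕ} {q : Cmd} {m : Config}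
    (hv : o.eval (m.reg y) (m.reg z) = v) :
    run G (.seq (.arith o x y z) q) m = run G q (m.setReg x v) := by
  rw [run, run, PMF.pure_bind, hv]

set_option maxHeartbeats 1000000 in
lemma ensures_setup {π : Params} {t cL cK M : ℕ} {σ : Store}
    (hM : ∀ x ∈ [t, π.B, π.n * π.B, π.invEps, π.n * π.B * π.invEps, π.logAcc, π.invGap, cL,
      cL * π.logAcc, π.window cL, π.n, 2, π.root, cK, cK * π.logAcc, π.numWalks cK], x ≤ M) :
    Ensures (run G (setup cL cK) (startConfig π t σ)) fun m =>
      m.reg 0 = t ∧ m.reg 1 = π.n ∧ m.reg 5 = 1 ∧ m.reg 7 = π.window cL ∧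
      m.reg 8 = π.numWalks cK ∧ m.reg 9 = 0 ∧ m.reg 11 = 0 ∧ m.reg 13 = 0 ∧
      m.store = σ.update 0 1 ∧ (m.work = fun _ => 0) ∧
      m.time ≤ 20 + Nat.log 2 π.n ∧ m.peak ≤ M := by
  simp only [List.forall_mem_cons] at hM
  obtain ⟨h1, h2, h3, h4, h5, h6, h7, h8, h9, h10, h11, h12, h13, h14, h15, h16, -⟩ := hM
  have h10' : cL * π.logAcc * π.invGap ≤ π.window cL := by rw [Params.window]; omega
  have h6' : Nat.log 2 (π.n * π.B * π.invEps) ≤ π.logAcc := by rw [Params.logAcc]; omega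
  rw [Params.numWalks] at h16
  have hlog : Nat.log 2 π.n ≤ π.n := Nat.log_le_self _ _
  rw [setup, startConfig]
  rw [run_seq_const,
    run_seq_arith G (v := π.n * π.B) (by simp [ArithOp.eval_mul]),
    run_seq_arith G (v := π.n * π.B * π.invEps) (by simp [ArithOp.eval_mul]),
    run_seq_arith G (v := Nat.log 2 (π.n * π.B * π.invEps)) (by simp [ArithOp.eval_log]),
    run_seq_arith G (v := π.logAcc) (by simp [ArithOp.eval_add, Params.logAcc]),
    run_seq_const,
    run_seq_arith G (v := cL * π.logAcc) (by simp [ArithOp.eval_mul]),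
    run_seq_arith G (v := cL * π.logAcc * π.invGap) (by simp [ArithOp.eval_mul]),
    run_seq_arith G (v := π.window cL) (by simp [ArithOp.eval_add, Params.window, two_mul]),
    run_seq_arith G (v := Nat.log 2 π.n) (by simp [ArithOp.eval_log]),
    run_seq_const,
    run_seq_arith G (v := Nat.log 2 π.n / 2) (by simp [ArithOp.eval_div]),
    run_seq_const]
  generalize hm₁ : Config.setReg _ 10 1 = m₁
  have r0 : m₁.reg 0 = t := by simp [← hm₁]
  have r1 : m₁.reg 1 = π.n := by simp [← hm₁]
  have r5 : m₁.reg 5 = 1 := by simp [← hm₁]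
  have r6 : m₁.reg 6 = π.logAcc := by simp [← hm₁]
  have r7 : m₁.reg 7 = π.window cL := by simp [← hm₁]
  have r8 : m₁.reg 8 = Nat.log 2 π.n / 2 := by simp [← hm₁]
  have r10 : m₁.reg 10 = 1 := by simp [← hm₁]
  have r11 : m₁.reg 11 = 0 := by simp [← hm₁]
  have r13 : m₁.reg 13 = 0 := by simp [← hm₁]
  have e1 : m₁.work = fun _ => 0 := by simp [← hm₁]
  have e2 : m₁.store = σ := by simp [← hm₁]
  have e3 : m₁.time ≤ 13 := by simp [← hm₁]
  have e4 : m₁.peak ≤ M := by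
    simp only [← hm₁, Config.setReg_peak, max_le_iff]
    omega
  clear hm₁
  rw [run]
  refine (ensures_root G r8 r10 (M := M) h13 e4).bind ?_
  rintro m₂ ⟨a1, a2, a3, a4, a5, a6⟩
  simp only [run, PMF.pure_bind, ArithOp.eval_mul]
  have b6 : m₂.reg 6 = π.logAcc := by rw [a1 6 (by omega), r6]
  have hdiv : 2 * (Nat.log 2 π.n / 2) ≤ Nat.log 2 π.n := by omega
  refine ensures_pure ⟨?_, ?_, ?_, ?_, ?_, ?_, ?_, ?_, ?_, ?_, ?_, ?_⟩
  · simp [a1 0, r0]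
  · simp [a1 1, r1]
  · simp [a1 5, r5]
  · simp [a1 7, r7]
  · simp [b6, a2, Params.numWalks, Params.root]
  · simp
  · simp [a1 11, r11]
  · simp [a1 13, r13]
  · simp [a4, e2, a1 5, r5]
  · simp [a3, e1]
  · simp
    omega
  · simp [b6, a2, a6, h14]
    exact ⟨h15, h16⟩

end

/-! ### The simulation of a whole query -/

section

variable {n : ℕ} [NeZero n] (G : SimpleGraph (Fin n)) [DecidableRel G.Adj]

lemma sim_extendRecord {σ : ℕ → ℕ} {t L K dl dr Θ M : ℕ} {m₀ : Config}
    (h : Ready (n := n) σ t L K dl dr Θ M m₀) (hdlr : dl = 0 ↔ dr = 0) (hdlt : dl ≤ t)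
    (hdlL : dl ≤ L) (hdrL : dr ≤ L) (hσ : ∀ c, σ c ≤ n) (htM : t + 2 * L ≤ M)
    (hn : n + 1 ≤ M) (hKM : n + K * L ≤ M) :
    Sim (run G extendRecord m₀) (extensionLaw G σ t L K dl dr)
      (Extended n σ t (NewTime L t dl dr) (Θ + (K * (9 * L + 12) + 6 * L + 25)) M) := by
  have r0 := h.reg0
  have r5 := h.reg5
  have r7 := h.reg7
  have r9 := h.reg9
  have r11 := h.reg11
  have r13 := h.reg13
  have hst := h.store
  have hti := h.time
  have hpe := h.peak
  rw [extendRecord, extensionLaw, run, r11, r7]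
  split_ifs with h1 h2 h3 h4
  · -- both ends are near
    rw [run, if_pos (by simp [r13, r7, h2]), run, if_pos (by simp [r9, r11, h3])]
    have hR : Ready (n := n) σ t L K dl dr (Θ + 3) M m₀.tick.tick.tick :=
      ⟨r0, h.reg1, r5, r7, h.reg8, r9, r11, r13, hst, h.work, by simp; omega, hpe⟩
    refine Sim.map_right _ ((sim_bridge G hR h3 (by omega) hdlt h1 h2 hσ htM hn hKM).mono ?_)
    intro m o hm
    have hnew : NewTime L t dl dr = fun c => t - dl < c ∧ c < t + dr := by
      funext c
      simp [NewTime, h1, h2]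
    rw [hnew]
    exact ⟨hm.reg0, hm.reg5, hm.bound, hm.storeOut, hm.storeIn, hm.time.trans (by omega), hm.peak⟩
  · -- the queried time is recorded
    rw [run, if_pos (by simp [r13, r7, h2]), run, if_neg (by simp [r9, r11]; omega), run]
    refine Sim.pure ⟨by simp [r0], by simp [r5], by simp [hst, hσ], by simp [hst], ?_,
      by simp; omega, by simp; omega⟩
    intro x _ c hc
    simp only [NewTime, h1, h2, if_true] at hc
    omega
  · -- only the left end is near
    rw [run, if_neg (by simp [r13, r7]; omega), run, run, PMF.pure_bind]
    simp only [ArithOp.eval_sub]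
    refine Sim.map_right _ ((sim_walkStore G (o := .add) (x := 11) (k := dl) (M := M)
      (ad := fun j => t - dl + j) (by omega) (by simp [r11]) (by simp [r5]) (by simp [r0, r11])
      (by simp [hst]; rw [coe_vertexOf (hσ _)]) (fun j => by simp [ArithOp.eval_add, add_assoc])
      (fun i j h1 h2 => by omega) (fun j _ => by omega) hn
      (by simp [r0, r11]; omega)).mono ?_)
    intro m X hX
    have hm := hX.time
    simp only [Config.setReg_time, Config.tick_time] at hm
    have hin : ∀ c, NewTime L t dl dr c → m.store c = X (c - (t - dl)) + 1 := by
      intro c hc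
      simp only [NewTime, h1, h2, if_true, if_false] at hc
      have := hX.storeIn (c - (t - dl)) (by omega) (by omega)
      rwa [show t - dl + (c - (t - dl)) = c by omega] at this
    have hout : ∀ c, ¬ NewTime L t dl dr c → m.store c = σ c := by
      intro c hc
      simp only [NewTime, h1, h2, if_true, if_false] at hc
      rw [hX.storeOut c fun i i1 i2 => by omega]
      simp [hst]
    refine ⟨?_, ?_, ?_, hout, ?_, by omega, hX.peak⟩
    · simp [hX.reg 0, r0]
    · simp [hX.reg 5, r5]
    · intro c
      by_cases hc : NewTime L t dl dr c
      · rw [hin c hc]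
        exact (X _).2
      · rw [hout c hc]
        exact hσ c
    · intro x hx c hc
      rw [Option.some.injEq] at hx
      rw [hin c hc, ← hx]
  · -- only the right end is near
    rw [run, if_pos (by simp [r13, r7, h4]), run, run, PMF.pure_bind]
    simp only [ArithOp.eval_add]
    refine Sim.map_right _ ((sim_walkStore G (o := .sub) (x := 13) (k := dr) (M := M)
      (ad := fun j => t + dr - j) (by omega) (by simp [r13]) (by simp [r5]) (by simp [r0, r13])
      (by simp [hst]; rw [coe_vertexOf (hσ _)]) (fun j => by simp [ArithOp.eval_sub, Nat.sub_sub])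
      (fun i j h1 h2 => by omega) (fun j _ => by omega) hn
      (by simp [r0, r13]; omega)).mono ?_)
    intro m X hX
    have hm := hX.time
    simp only [Config.setReg_time, Config.tick_time] at hm
    have hin : ∀ c, NewTime L t dl dr c → m.store c = X (t + dr - c) + 1 := by
      intro c hc
      simp only [NewTime, h1, h4, if_true, if_false] at hc
      have := hX.storeIn (t + dr - c) (by omega) (by omega)
      rwa [show t + dr - (t + dr - c) = c by omega] at this
    have hout : ∀ c, ¬ NewTime L t dl dr c → m.store c = σ c := by
      intro c hc
      simp only [NewTime, h1, h4, if_true, if_false] at hc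
      rw [hX.storeOut c fun i i1 i2 => by omega]
      simp [hst]
    refine ⟨?_, ?_, ?_, hout, ?_, by omega, hX.peak⟩
    · simp [hX.reg 0, r0]
    · simp [hX.reg 5, r5]
    · intro c
      by_cases hc : NewTime L t dl dr c
      · rw [hin c hc]
        exact (X _).2
      · rw [hout c hc]
        exact hσ c
    · intro x hx c hc
      rw [Option.some.injEq] at hx
      rw [hin c hc, ← hx]
  · -- no recorded time is near
    rw [run, if_neg (by simp [r13, r7]; omega), run_seq_randVertex]
    refine Sim.of_bind_map fun v => ?_
    have hv := v.2
    rw [run_seq_arith G (v := v + 1) (by simp [ArithOp.eval_add, r5]), run]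
    have hnew : ∀ c, NewTime L t dl dr c ↔ c = t := by
      intro c
      simp only [NewTime, h1, h4, if_false]
      omega
    refine Sim.pure ⟨by simp [r0], by simp [r5], ?_, ?_, ?_, by simp; omega, by simp; omega⟩
    · intro c
      by_cases hc : c = t
      · simp [r0, hc]
      · simp [r0, hc, hst, hσ]
    · intro c hc
      rw [hnew] at hc
      simp [r0, hc, hst]
    · intro x hx c hc
      rw [Option.some.injEq] at hx
      rw [hnew] at hc
      simp [r0, hc, ← hx]

/-- The record after the start of the walk has been marked. -/
def marked (σ : Store) : Store := σ.update 0 1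

/-- The distance from `t` to the nearest recorded time to the left, or `L` if none is near. -/
def leftDist (σ : ℕ → ℕ) (t L : ℕ) : ℕ := scanDist (fun i => σ (t - i) = 0) L

/-- The distance from `t` to the nearest recorded time to the right, or `L` if none is near. -/
def rightDist (σ : ℕ → ℕ) (t L : ℕ) : ℕ := scanDist (fun i => σ (t + i) = 0) L

section Dist

variable {σ : ℕ → ℕ} {t L : ℕ}

lemma leftDist_le : leftDist σ t L ≤ L := scanDist_le _ _

lemma rightDist_le : rightDist σ t L ≤ L := scanDist_le _ _

/-- Truncated subtraction sends every distance beyond `t` to cell `0`, which is recorded, so the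
scan cannot pass the start of the walk. -/
lemma leftDist_le_time (h0 : σ 0 ≠ 0) : leftDist σ t L ≤ t := by
  by_contra! h
  have := of_lt_scanDist _ h
  simp at this
  exact h0 this

lemma eq_zero_of_between (h1 : t - leftDist σ t L < c) (h2 : c < t + rightDist σ t L) :
    σ c = 0 := by
  rcases le_total c t with h | h
  · have := of_lt_scanDist (fun i => σ (t - i) = 0) (k := L) (i := t - c)
      (by unfold leftDist at h1; omega)
    simpa [show t - (t - c) = c by omega] using this
  · have := of_lt_scanDist (fun i => σ (t + i) = 0) (k := L) (i := c - t)
      (by unfold rightDist at h2; omega)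
    simpa [show t + (c - t) = c by omega] using this

lemma ne_zero_of_leftDist_lt (h : leftDist σ t L < L) : σ (t - leftDist σ t L) ≠ 0 :=
  not_of_scanDist_lt _ h

lemma ne_zero_of_rightDist_lt (h : rightDist σ t L < L) : σ (t + rightDist σ t L) ≠ 0 :=
  not_of_scanDist_lt _ h

lemma leftDist_eq_zero_iff (hL : 0 < L) : leftDist σ t L = 0 ↔ σ t ≠ 0 := by
  constructor
  · intro h h0
    have := ne_zero_of_leftDist_lt (σ := σ) (t := t) (L := L) (by omega)
    rw [h] at this
    exact this h0
  · intro h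
    by_contra hne
    have := of_lt_scanDist (fun i => σ (t - i) = 0) (k := L) (i := 0)
      (Nat.pos_of_ne_zero hne)
    exact h this

lemma rightDist_eq_zero_iff (hL : 0 < L) : rightDist σ t L = 0 ↔ σ t ≠ 0 := by
  constructor
  · intro h h0
    have := ne_zero_of_rightDist_lt (σ := σ) (t := t) (L := L) (by omega)
    rw [h] at this
    exact this h0
  · intro h
    by_contra hne
    have := of_lt_scanDist (fun i => σ (t + i) = 0) (k := L) (i := 0)
      (Nat.pos_of_ne_zero hne)
    exact h this

end Dist

/-- The outcome of a query, if the positions `o` have been added to the record `σ`. -/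
structure Answered (n : ℕ) (σ : ℕ → ℕ) (t : ℕ) (new : ℕ → Prop) (Θ M : ℕ) (m : Config)
    (o : Option (ℕ → Fin n)) : Prop where
  reg0 : m.reg 0 = m.store t - 1
  bound : ∀ c, m.store c ≤ n
  storeOut : ∀ c, ¬ new c → m.store c = σ c
  storeIn : ∀ x, o = some x → ∀ c, new c → m.store c = x c + 1
  time : m.time ≤ Θ
  peak : m.peak ≤ M

lemma sim_accessProgram {π : Params} {t cL cK M : ℕ} {σ : Store} (hπ : π.n = n)
    (hσ : ∀ c, σ c ≤ n) (hL : 0 < π.window cL)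
    (hM : ∀ x ∈ [t, π.B, π.n * π.B, π.invEps, π.n * π.B * π.invEps, π.logAcc, π.invGap, cL,
      cL * π.logAcc, π.window cL, π.n, 2, π.root, cK, cK * π.logAcc, π.numWalks cK], x ≤ M)
    (htM : t + 2 * π.window cL ≤ M) (hn : n + 1 ≤ M)
    (hKM : n + π.numWalks cK * π.window cL ≤ M) :
    Sim (run G (accessProgram cL cK) (startConfig π t σ))
      (extensionLaw G (marked σ) t (π.window cL) (π.numWalks cK)
        (leftDist (marked σ) t (π.window cL)) (rightDist (marked σ) t (π.window cL)))
      (Answered n (marked σ) t (NewTime (π.window cL) t (leftDist (marked σ) t (π.window cL))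
        (rightDist (marked σ) t (π.window cL)))
        (π.numWalks cK * (9 * π.window cL + 12) + 16 * π.window cL + 50 + Nat.log 2 n) M) := by
  have hσ1 : ∀ c, marked σ c ≤ n := by
    intro c
    by_cases hc : c = 0
    · subst hc
      simpa [marked, Nat.one_le_iff_ne_zero] using NeZero.ne n
    · simpa [marked, Finsupp.update_apply, hc] using hσ c
  rw [accessProgram, run]
  refine Sim.of_ensures_bind (ensures_setup G hM) ?_
  rintro m₁ ⟨r0, r1, r5, r7, r8, r9, r11, r13, e1, e2, e3, e4⟩
  have hst : m₁.store = marked σ := e1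
  rw [hπ] at e3
  rw [run]
  refine Sim.of_ensures_bind (ensures_scan G (M := M) (by omega) (by omega) (by omega) r5 r7 r11
    (by omega) (by rw [hst]; exact hσ1) (fun j _ => by rw [r0, ArithOp.eval_sub]; omega)
    (by omega) e4) ?_
  intro m₂ h₂
  have h2t := h₂.time
  have r0' : m₂.reg 0 = t := by rw [h₂.reg 0 (by omega) (by omega), r0]
  rw [run]
  refine Sim.of_ensures_bind (ensures_scan G (M := M) (L := π.window cL) (by omega) (by omega)
    (by omega)
    (by rw [h₂.reg 5 (by omega) (by omega), r5]) (by rw [h₂.reg 7 (by omega) (by omega), r7])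
    (by rw [h₂.reg 13 (by omega) (by omega), r13])
    (by omega) (by rw [h₂.store, hst]; exact hσ1)
    (fun j _ => by rw [r0', ArithOp.eval_add]; omega)
    (by omega) h₂.peak) ?_
  intro m₃ h₃
  have h3t := h₃.time
  have hreg : ∀ y, y ≠ 12 → y ≠ 11 → y ≠ 13 → m₃.reg y = m₁.reg y := fun y y1 y2 y3 => by
    rw [h₃.reg y y1 y3, h₂.reg y y1 y2]
  have hR : Ready (n := n) (marked σ) t (π.window cL) (π.numWalks cK)
      (leftDist (marked σ) t (π.window cL)) (rightDist (marked σ) t (π.window cL))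
      (22 + Nat.log 2 n + 10 * π.window cL) M m₃ := by
    refine ⟨?_, ?_, ?_, ?_, ?_, ?_, ?_, ?_, ?_, ?_, by omega, h₃.peak⟩
    · rw [hreg 0 (by omega) (by omega) (by omega), r0]
    · rw [hreg 1 (by omega) (by omega) (by omega), r1, hπ]
    · rw [hreg 5 (by omega) (by omega) (by omega), r5]
    · rw [hreg 7 (by omega) (by omega) (by omega), r7]
    · rw [hreg 8 (by omega) (by omega) (by omega), r8]
    · rw [hreg 9 (by omega) (by omega) (by omega), r9]
    · rw [h₃.reg 11 (by omega) (by omega), h₂.regx]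
      simp only [hst, r0, ArithOp.eval_sub, leftDist]
    · rw [h₃.regx]
      simp only [h₂.store, hst, r0', ArithOp.eval_add, rightDist]
    · intro c
      rw [h₃.store, h₂.store, hst]
    · rw [h₃.work, h₂.work, e2]
  rw [run]
  refine (sim_extendRecord G hR ?_ (leftDist_le_time (by simp [marked])) leftDist_le rightDist_le
    hσ1 htM hn hKM).bind_ensures ?_
  · rw [leftDist_eq_zero_iff hL, rightDist_eq_zero_iff hL]
  intro m o hm
  have hmt := hm.time
  have hmb := hm.bound t
  have hmp := hm.peak
  simp only [run, PMF.pure_bind, ArithOp.eval_sub]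
  refine ensures_pure ⟨by simp [hm.reg0, hm.reg5], by simpa using hm.bound,
    by simpa using hm.storeOut, by simpa using hm.storeIn, by simp; omega, ?_⟩
  simp [hm.reg0, hm.reg5]
  omega

end

/-! ### The accuracy of a single query -/

lemma apply_le_map_apply {α β : Type*} (p : PMF α) (φ : α → β) (a : α) :
    p a ≤ p.map φ (φ a) := by
  classical
  rw [PMF.map_apply]
  calc p a = if φ a = φ a then p a else 0 := (if_pos rfl).symm
    _ ≤ _ := ENNReal.le_tsum (f := fun b => if φ a = φ b then p b else 0) a

/-- The parameters `K` and `s` suffice for an accuracy of `1 - c` per query: `δ` bounds the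
deviation from the uniform distribution, `e₁` the probability that a table with `s` entries is
missed, `e₂` the probability that a table has fewer than `s` entries. -/
structure Accuracy (n K s : ℕ) (δ e₁ e₂ c : ℝ) : Prop where
  zero_le_δ : 0 ≤ δ
  δ_lt_one : δ < 1
  zero_le_e₁ : 0 ≤ e₁
  e₁_le_one : e₁ ≤ 1
  zero_le_e₂ : 0 ≤ e₂
  e₂_le_one : e₂ ≤ 1
  zero_le_c : 0 ≤ c
  one_le_s : 1 ≤ s
  s_le_n : s ≤ n
  miss : (1 - (1 - δ) / n * s) ^ K ≤ e₁
  small : (n.choose s : ℝ) * (s : ℝ) ^ K ≤ e₂ * (n : ℝ) ^ K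
  total : c * (1 + δ) ^ 2 ≤ (1 - e₁) * (1 - e₂) * (1 - δ) ^ (K + 1)

namespace Accuracy

variable {n K s : ℕ} {δ e₁ e₂ c : ℝ} (H : Accuracy n K s δ e₁ e₂ c)
include H

lemma mul_sq_le : c * (1 + δ) ^ 2 ≤ 1 - δ := by
  have h1 := H.zero_le_δ
  have h2 := H.δ_lt_one
  have h3 := H.zero_le_e₁
  have h4 := H.e₁_le_one
  have h5 := H.zero_le_e₂
  have h6 := H.e₂_le_one
  refine H.total.trans ?_
  calc (1 - e₁) * (1 - e₂) * (1 - δ) ^ (K + 1) ≤ 1 * (1 - δ) := by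
        refine mul_le_mul (mul_le_one₀ (by linarith) (by linarith) (by linarith)) ?_
          (pow_nonneg (by linarith) _) zero_le_one
        rw [pow_succ]
        exact mul_le_of_le_one_left (by linarith) (pow_le_one₀ (by linarith) (by linarith))
    _ = 1 - δ := one_mul _

lemma mul_le : c * (1 + δ) ≤ 1 - δ := by
  refine le_trans ?_ H.mul_sq_le
  have h1 := H.zero_le_δ
  have h2 := H.zero_le_c
  rw [sq]
  nlinarith [mul_nonneg h2 h1, mul_nonneg h2 (mul_nonneg h1 h1)]

lemma c_le_one : c ≤ 1 := by
  have h1 := H.mul_le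
  have h2 := H.zero_le_δ
  have h3 := H.zero_le_c
  nlinarith

end Accuracy

/-- No gap between recorded times is shorter than `L`. -/
def GapFree (L : ℕ) (σ : ℕ → ℕ) : Prop :=
  ∀ i k j, i < k → k < j → j < i + L → σ i ≠ 0 → σ j ≠ 0 → σ k ≠ 0

section

variable {n : ℕ} [NeZero n] (G : SimpleGraph (Fin n)) [DecidableRel G.Adj] {d : ℕ}

omit [NeZero n] in
lemma pathWeight_congr {X Y : ℕ → Fin n} {i j k : ℕ} (h : ∀ a ≤ k, X (i + a) = Y (j + a)) :
    pathWeight G d X i k = pathWeight G d Y j k := by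
  refine Finset.prod_congr rfl fun a ha => ?_
  rw [Finset.mem_range] at ha
  rw [h a ha.le, add_assoc, add_assoc, h (a + 1) ha]

omit [NeZero n] in
-- Reversibility: the walk matrix is symmetric.
lemma pathWeight_reverse {X Y : ℕ → Fin n} {i k : ℕ} (h : ∀ a ≤ k, Y a = X (i + k - a)) :
    pathWeight G d Y 0 k = pathWeight G d X i k := by
  rw [pathWeight, pathWeight, ← Finset.prod_range_reflect]
  refine Finset.prod_congr rfl fun a ha => ?_
  rw [Finset.mem_range] at ha
  have := walkMatrix_pow_comm G (d := d) 1
  simp only [pow_one] at this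
  rw [zero_add, h _ (by omega), h _ (by omega), this]
  congr 2 <;> omega

omit [NeZero n] in
lemma pathWeight_add (X : ℕ → Fin n) (i k l : ℕ) :
    pathWeight G d X i (k + l) = pathWeight G d X i k * pathWeight G d X (i + k) l := by
  simp only [pathWeight, Finset.prod_range_add, add_assoc]

/-- The first `k + 1` positions of a path. -/
def truncate (X : ℕ → Fin n) (k j : ℕ) : Fin n := if j ≤ k then X j else 0

lemma truncate_of_le {X : ℕ → Fin n} {k j : ℕ} (h : j ≤ k) : truncate X k j = X j := if_pos h

variable (hd : 1 ≤ d) (hG : G.IsRegularOfDegree d)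
include hd hG

lemma walkFrom_truncate (X : ℕ → Fin n) (k : ℕ) :
    walkFrom G (X 0) k (truncate X k) = ENNReal.ofReal (pathWeight G d X 0 k) := by
  rw [walkFrom_apply G hd hG, if_pos]
  · congr 1
    refine pathWeight_congr G fun a ha => ?_
    rw [truncate_of_le (by omega)]
  · exact ⟨truncate_of_le (Nat.zero_le _), fun i hi => if_neg (by omega)⟩

/-- The collision bound with `lo` and `hi` equal to `(1 - δ) / n` and `(1 + δ) / n`: the factor `(1
- δ) ^ K` is `(lo n) ^ K`, and the denominator is `hi ^ 2 n`. The weights of the half paths multiply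
to the weight of the whole path, since the second half is traversed backwards. -/
lemma collisionLaw_walkFrom_lower {X : ℕ → Fin n} {a l l' h K s : ℕ} {δ e₁ e₂ c : ℝ}
    (hmix : Mixes G d δ h) (H : Accuracy n K s δ e₁ e₂ c) (hl : h ≤ l) (hl' : h ≤ l') :
    ENNReal.ofReal (pathWeight G d X a (l + l')
        * ((1 - e₁) * (1 - e₂) * (1 - δ) ^ K / ((1 + δ) ^ 2 / n)))
      ≤ collisionLaw (walkFrom G (X a) l) (fun X => X l) (walkFrom G (X (a + l + l')) l')
        (fun X => X l') K
        (some (truncate (fun j => X (a + j)) l, truncate (fun j => X (a + l + l' - j)) l')) := by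
  have h1 := H.zero_le_δ
  have h2 := H.δ_lt_one
  have h3 := H.e₁_le_one
  have h4 := H.e₂_le_one
  have h5 := H.zero_le_e₁
  have h6 := H.zero_le_e₂
  have hn : (0 : ℝ) < n := by exact_mod_cast NeZero.pos n
  have hsn : (s : ℝ) ≤ n := by exact_mod_cast H.s_le_n
  have hlos : (1 - δ) / n * s ≤ 1 := by
    rw [div_mul_eq_mul_div, div_le_one hn]
    nlinarith
  have hlo0 : 0 ≤ (1 - δ) / n := div_nonneg (by linarith) hn.le
  have key := collisionLaw_lower (ι := Fin n) (p := walkFrom G (X a) l) (e := fun X => X l)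
    (q := walkFrom G (X (a + l + l')) l') (e' := fun X => X l')
    (lo := ENNReal.ofReal ((1 - δ) / n)) (hi := ENNReal.ofReal ((1 + δ) / n))
    (s := s) (K := K) (e1 := ENNReal.ofReal e₁) (e2 := ENNReal.ofReal e₂)
    (b := truncate (fun j => X (a + j)) l) (c := truncate (fun j => X (a + l + l' - j)) l')
    (fun w => by
      rw [map_walkFrom_end G hd hG]
      exact ENNReal.ofReal_le_ofReal (hmix l hl _ _).1)
    (fun w => by
      rw [map_walkFrom_end G hd hG]
      exact ENNReal.ofReal_le_ofReal (hmix l hl _ _).2)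
    (fun w => by
      rw [map_walkFrom_end G hd hG]
      exact ENNReal.ofReal_le_ofReal (hmix l' hl' _ _).1)
    (fun w => by
      rw [map_walkFrom_end G hd hG]
      exact ENNReal.ofReal_le_ofReal (hmix l' hl' _ _).2)
    H.one_le_s (by simpa using H.s_le_n)
    (by
      rw [← ENNReal.ofReal_natCast s, ← ENNReal.ofReal_mul hlo0, ← ENNReal.ofReal_one,
        ← ENNReal.ofReal_sub _ (mul_nonneg hlo0 (Nat.cast_nonneg s)),
        ← ENNReal.ofReal_pow (by linarith)]
      exact ENNReal.ofReal_le_ofReal H.miss)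
    (by
      rw [Fintype.card_fin]
      have := ENNReal.ofReal_le_ofReal H.small
      rwa [ENNReal.ofReal_mul (Nat.cast_nonneg _), ENNReal.ofReal_mul h6,
        ENNReal.ofReal_pow (Nat.cast_nonneg _), ENNReal.ofReal_pow (Nat.cast_nonneg _),
        ENNReal.ofReal_natCast, ENNReal.ofReal_natCast, ENNReal.ofReal_natCast] at this)
    (by
      rw [truncate_of_le le_rfl, truncate_of_le le_rfl]
      congr 1
      omega)
  have w1 := walkFrom_truncate G hd hG (fun j => X (a + j)) l
  have w2 := walkFrom_truncate G hd hG (fun j => X (a + l + l' - j)) l'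
  simp only [add_zero, Nat.sub_zero] at w1 w2
  have p1 : pathWeight G d (fun j => X (a + j)) 0 l = pathWeight G d X a l :=
    pathWeight_congr G fun j _ => by simp
  have p2 : pathWeight G d (fun j => X (a + l + l' - j)) 0 l' = pathWeight G d X (a + l) l' :=
    pathWeight_reverse G fun j _ => rfl
  rw [w1, w2, p1, p2, Fintype.card_fin, ← ENNReal.ofReal_one, ← ENNReal.ofReal_sub _ h5,
    ← ENNReal.ofReal_sub _ h6, ← ENNReal.ofReal_natCast n, ← ENNReal.ofReal_mul hlo0,
    ← ENNReal.ofReal_pow (mul_nonneg hlo0 hn.le), ← ENNReal.ofReal_pow (by positivity),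
    ← ENNReal.ofReal_mul (pathWeight_nonneg G _ _ _ _),
    ← ENNReal.ofReal_mul (mul_nonneg (pathWeight_nonneg G _ _ _ _) (pathWeight_nonneg G _ _ _ _)),
    ← ENNReal.ofReal_mul (mul_nonneg (mul_nonneg (pathWeight_nonneg G _ _ _ _)
      (pathWeight_nonneg G _ _ _ _)) (by linarith)),
    ← ENNReal.ofReal_mul (mul_nonneg (mul_nonneg (mul_nonneg (pathWeight_nonneg G _ _ _ _)
      (pathWeight_nonneg G _ _ _ _)) (by linarith)) (by linarith)),
    ← ENNReal.ofReal_mul (by positivity), ← pathWeight_add, div_mul_cancel₀ _ hn.ne'] at key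
  have hpos : 0 < (1 + δ) ^ 2 / n := by positivity
  rw [show ((1 + δ) / n) ^ 2 * n = (1 + δ) ^ 2 / n by field_simp] at key
  rw [mul_div_assoc', ENNReal.ofReal_div_of_pos hpos]
  refine ENNReal.div_le_of_le_mul ?_
  rw [mul_comm (collisionLaw _ _ _ _ _ _)]
  refine le_trans (le_of_eq ?_) key
  congr 1
  ring

/-- The probability that a query extends the record by the positions of `X` is at least `c` times
the conditional probability that the random walk passes through these positions. -/
lemma extensionLaw_lower {σ τ : ℕ → ℕ} {X : ℕ → Fin n} {t h K s N : ℕ} {δ e₁ e₂ c : ℝ}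
    (hmix : Mixes G d δ h) (H : Accuracy n K s δ e₁ e₂ c) (hh : 1 ≤ h)
    (h0 : σ 0 ≠ 0) (hgap : GapFree (2 * h) σ) (hX : ∀ i, σ i ≠ 0 → σ i = X i + 1)
    (hτ : ∀ i, τ i = if NewTime (2 * h) t (leftDist σ t (2 * h)) (rightDist σ t (2 * h)) i
      then (X i : ℕ) + 1 else σ i)
    (hN : t + rightDist σ t (2 * h) ≤ N) (y : Fin n) :
    ∃ x : ℕ → Fin n,
      (∀ i, NewTime (2 * h) t (leftDist σ t (2 * h)) (rightDist σ t (2 * h)) i → x i = X i) ∧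
      ENNReal.ofReal (c * matchProb G d τ N 0 y)
        ≤ extensionLaw G σ t (2 * h) K (leftDist σ t (2 * h)) (rightDist σ t (2 * h)) (some x)
          * ENNReal.ofReal (matchProb G d σ N 0 y) := by
  have hdlt : leftDist σ t (2 * h) ≤ t := leftDist_le_time h0
  have hdlL : leftDist σ t (2 * h) ≤ 2 * h := leftDist_le
  have hdrL : rightDist σ t (2 * h) ≤ 2 * h := rightDist_le
  have hl0 := leftDist_eq_zero_iff (σ := σ) (t := t) (L := 2 * h) (by omega)
  have hr0 := rightDist_eq_zero_iff (σ := σ) (t := t) (L := 2 * h) (by omega)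
  have hfree := fun i => eq_zero_of_between (σ := σ) (t := t) (L := 2 * h) (c := i)
  have hleft := ne_zero_of_leftDist_lt (σ := σ) (t := t) (L := 2 * h)
  have hright := ne_zero_of_rightDist_lt (σ := σ) (t := t) (L := 2 * h)
  generalize leftDist σ t (2 * h) = dl at *
  generalize rightDist σ t (2 * h) = dr at *
  have hc0 := H.zero_le_c
  have hδ := H.zero_le_δ
  have hvert : ∀ i, σ i ≠ 0 → vertexOf n (σ i) = X i := fun i hi => by
    refine Fin.ext ?_
    have := hX i hi
    have := (X i).2
    rw [coe_vertexOf (by omega)]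
    omega
  by_cases ht : σ t = 0
  swap
  · -- the queried time is recorded
    have hdl : dl = 0 := hl0.2 ht
    have hdr : dr = 0 := hr0.2 ht
    subst hdl hdr
    have hnew : ∀ i, ¬ NewTime (2 * h) t 0 0 i := by
      intro i
      simp only [NewTime, show 0 < 2 * h by omega, if_true]
      omega
    refine ⟨fun _ => 0, fun i hi => absurd hi (hnew i), ?_⟩
    have : τ = σ := funext fun i => by rw [hτ, if_neg (hnew i)]
    rw [this, extensionLaw, if_pos (by omega), if_pos (by omega), if_neg (by omega),
      PMF.pure_apply, if_pos rfl, one_mul]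
    exact ENNReal.ofReal_le_ofReal (mul_le_of_le_one_left (matchProb_nonneg G d _ _ _ _)
      H.c_le_one)
  have hdl : 1 ≤ dl := Nat.pos_of_ne_zero fun h => (hl0.1 h) ht
  have hdr : 1 ≤ dr := Nat.pos_of_ne_zero fun h => (hr0.1 h) ht
  have E : Extends σ τ t dl dr := by
    refine ⟨hdl, hdlt, hdr, fun j h1 h2 => hfree j h1 h2, fun j hj => ?_, fun j hj => ?_⟩
    · rw [hτ, if_neg]
      rintro ⟨h1, -⟩
      split_ifs at h1 <;> omega
    · rw [hτ, if_neg]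
      rintro ⟨-, h1⟩
      split_ifs at h1 <;> omega
  obtain ⟨k, rfl⟩ : ∃ k, N = (t - dl) + (dl + dr + k) := ⟨N - (t + dr), by omega⟩
  -- Before the window `σ` and `τ` agree, so the comparison can be made at time `t - dl`; `P` is a
  -- lower bound for the probability of the extension.
  suffices hs : ∃ (x : ℕ → Fin n) (P : ℝ), (∀ i, NewTime (2 * h) t dl dr i → x i = X i) ∧
      0 ≤ P ∧ ENNReal.ofReal P ≤ extensionLaw G σ t (2 * h) K dl dr (some x) ∧
      ∀ y, c * matchProb G d τ (dl + dr + k) (t - dl) y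
        ≤ P * matchProb G d σ (dl + dr + k) (t - dl) y by
    obtain ⟨x, P, h1, hP0, h2, h3⟩ := hs
    refine ⟨x, h1, ?_⟩
    refine le_trans ?_ (mul_le_mul_left h2 _)
    rw [← ENNReal.ofReal_mul hP0]
    refine ENNReal.ofReal_le_ofReal ?_
    exact matchProb_mono_prefix (fun j _ hj => E.left j (by omega))
      (by rw [zero_add]; exact h3) y
  by_cases h1 : dl < 2 * h
  · have hul := hvert _ (hleft h1)
    by_cases h2 : dr < 2 * h
    · -- both ends are near
      have hul' := hvert _ (hright h2)
      -- The absence of short gaps enters here: both half walks have length at least `h`.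
      have hm : 2 * h ≤ dl + dr := by
        by_contra! hlt
        exact hgap (t - dl) t (t + dr) (by omega) (by omega) (by omega) (hleft h1) (hright h2) ht
      set l := (dl + dr) / 2 with hl
      set l' := dl + dr - l with hl'
      have hll : l + l' = dl + dr := by omega
      have hb : t - dl + l + l' = t + dr := by omega
      have hcoll := collisionLaw_walkFrom_lower G hd hG (X := X) (a := t - dl) (l := l) (l' := l')
        hmix H (by omega) (by omega)
      have hn : (0 : ℝ) < n := by exact_mod_cast NeZero.pos n
      have e1 := H.e₁_le_one
      have e2 := H.e₂_le_one
      have e3 := H.δ_lt_one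
      have hfac : 0 ≤ (1 - e₁) * (1 - e₂) * (1 - δ) ^ K / ((1 + δ) ^ 2 / n) :=
        div_nonneg (mul_nonneg (mul_nonneg (by linarith) (by linarith))
          (pow_nonneg (by linarith) _)) (by positivity)
      rw [hll, hb] at hcoll
      refine ⟨glue (t - dl) l (t + dr) (truncate (fun j => X (t - dl + j)) l,
        truncate (fun j => X (t + dr - j)) l'), _, ?_, mul_nonneg (pathWeight_nonneg G _ _ _ _)
        hfac, hcoll.trans ?_, ?_⟩
      · intro i hi
        simp only [NewTime, h1, h2, if_true] at hi
        rw [glue]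
        split_ifs with hil
        · dsimp only
          rw [truncate_of_le (by omega)]
          congr 1
          omega
        · dsimp only
          rw [truncate_of_le (by omega)]
          congr 1
          omega
      · rw [extensionLaw, if_pos h1, if_pos h2, if_pos (by omega), hul, hul']
        exact apply_le_map_apply _ (Option.map (glue (t - dl) l (t + dr))) _
      · intro y
        refine E.matchProb_le_bridge (X := X) ?_ ?_ y
        · intro j j1 j2
          by_cases hj : t - dl < j ∧ j < t + dr
          · rw [hτ, if_pos]
            simpa only [NewTime, h1, h2, if_true] using hj
          · rcases (show j = t - dl ∨ j = t + dr by omega) with rfl | rfl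
            · rw [E.left _ le_rfl, hX _ (hleft h1)]
            · rw [E.right _ le_rfl, hX _ (hright h2)]
        · have hw := (hmix (dl + dr) (by omega) (X (t - dl)) (X (t + dr))).1
          have htot := H.total
          rw [mul_comm c, mul_assoc]
          refine mul_le_mul_of_nonneg_left ?_ (pathWeight_nonneg G _ _ _ _)
          refine le_trans ?_ (mul_le_mul_of_nonneg_left hw hfac)
          rw [div_mul_div_comm, div_mul_cancel₀ _ hn.ne', le_div_iff₀ (by positivity)]
          rw [pow_succ (1 - δ) K] at htot
          linarith
    · -- only the left end is near
      refine ⟨fun i => truncate (fun j => X (t - dl + j)) dl (i - (t - dl)), _, ?_,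
        pathWeight_nonneg G d X (t - dl) dl, ?_, ?_⟩
      · intro i hi
        simp only [NewTime, h1, h2, if_true, if_false] at hi
        dsimp only
        rw [truncate_of_le (by omega)]
        congr 1
        omega
      · have w := walkFrom_truncate G hd hG (fun j => X (t - dl + j)) dl
        rw [add_zero] at w
        rw [extensionLaw, if_pos h1, if_neg h2, hul, ← pathWeight_congr G
          (X := fun j => X (t - dl + j)) (i := 0) (fun j _ => by simp), ← w]
        exact apply_le_map_apply _ (fun X : ℕ → Fin n => some fun c => X (c - (t - dl))) _
      · refine fun y => E.matchProb_le_left hmix (by omega) ?_ ?_ hc0 H.mul_le y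
        · intro j j1 j2
          by_cases hj : j = t - dl
          · rw [hj, E.left _ le_rfl, hX _ (hleft h1)]
          · rw [hτ, if_pos]
            simp only [NewTime, h1, h2, if_true, if_false]
            omega
        · intro j j1 j2
          rw [hτ, if_neg, hfree j (by omega) j2]
          simp only [NewTime, h1, h2, if_true, if_false]
          omega
  · by_cases h2 : dr < 2 * h
    · -- only the right end is near
      have hul' := hvert _ (hright h2)
      refine ⟨fun i => truncate (fun j => X (t + dr - j)) dr (t + dr - i), _, ?_,
        pathWeight_nonneg G d X t dr, ?_, ?_⟩
      · intro i hi
        simp only [NewTime, h1, h2, if_true, if_false] at hi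
        dsimp only
        rw [truncate_of_le (by omega)]
        congr 1
        omega
      · have w := walkFrom_truncate G hd hG (fun j => X (t + dr - j)) dr
        rw [Nat.sub_zero] at w
        rw [extensionLaw, if_neg h1, if_pos h2, hul', ← pathWeight_reverse G
          (Y := fun j => X (t + dr - j)) (fun j _ => rfl), ← w]
        exact apply_le_map_apply _ (fun X : ℕ → Fin n => some fun c => X (t + dr - c)) _
      · refine fun y => E.matchProb_le_right hmix (by omega) ?_ ?_ hc0 H.mul_le y
        · intro j j1 j2
          by_cases hj : j = t + dr
          · rw [hj, E.right _ le_rfl, hX _ (hright h2)]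
          · rw [hτ, if_pos]
            simp only [NewTime, h1, h2, if_true, if_false]
            omega
        · intro j j1 j2
          rw [hτ, if_neg, hfree j j1 (by omega)]
          simp only [NewTime, h1, h2, if_true, if_false]
          omega
    · -- no recorded time is near
      have hnew : ∀ i, NewTime (2 * h) t dl dr i ↔ i = t := by
        intro i
        simp only [NewTime, h1, h2, if_false]
        omega
      refine ⟨fun _ => X t, 1 / n, ?_, by positivity, ?_, ?_⟩
      · intro i hi
        rw [(hnew i).1 hi]
      · rw [extensionLaw, if_neg h1, if_neg h2]
        refine le_trans (le_of_eq ?_)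
          (apply_le_map_apply _ (fun v : Fin n => some fun _ : ℕ => v) (X t))
        rw [PMF.uniformOfFintype_apply, Fintype.card_fin, one_div,
          ENNReal.ofReal_inv_of_pos (by exact_mod_cast NeZero.pos n), ENNReal.ofReal_natCast]
      · refine fun y => E.matchProb_le_none (X := X) hmix (by omega) (by omega) ?_ ?_
          (by linarith) hc0 H.mul_sq_le y
        · rw [hτ, if_pos ((hnew t).2 rfl)]
        · intro j j1 j2 j3
          rw [hτ, if_neg (fun h => j3 ((hnew j).1 h)), hfree j j1 j2]

end

/-! ### From pointwise domination to the `ℓ₁` distance -/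

section Distance

variable {α β : Type*}

/-- The difference `p - q` is that of the nonnegative functions `p - a q` and `(1 - a) q`, each of
total mass `1 - a`. -/
lemma l1Dist_le_of_mul_le {p q : PMF α} {a : ℝ} (h0 : 0 ≤ a) (h1 : a ≤ 1)
    (h : ∀ x, ENNReal.ofReal a * q x ≤ p x) : l1Dist p q ≤ ENNReal.ofReal (2 * (1 - a)) := by
  have hq : ∑' x, ENNReal.ofReal a * q x = ENNReal.ofReal a := by
    rw [ENNReal.tsum_mul_left, PMF.tsum_coe, mul_one]
  calc l1Dist p q ≤ ∑' x, ((p x - ENNReal.ofReal a * q x) + ENNReal.ofReal (1 - a) * q x) := by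
        refine ENNReal.tsum_le_tsum fun x => ?_
        have hp := PMF.apply_ne_top p x
        have hqx := PMF.apply_ne_top q x
        have hx := ENNReal.toReal_mono hp (h x)
        rw [ENNReal.toReal_mul, ENNReal.toReal_ofReal h0] at hx
        have hQ : 0 ≤ (q x).toReal := ENNReal.toReal_nonneg
        have e1 : p x - ENNReal.ofReal a * q x
            = ENNReal.ofReal ((p x).toReal - a * (q x).toReal) := by
          rw [ENNReal.ofReal_sub _ (mul_nonneg h0 hQ), ENNReal.ofReal_mul h0,
            ENNReal.ofReal_toReal hp, ENNReal.ofReal_toReal hqx]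
        have e2 : ENNReal.ofReal (1 - a) * q x = ENNReal.ofReal ((1 - a) * (q x).toReal) := by
          rw [ENNReal.ofReal_mul (by linarith), ENNReal.ofReal_toReal hqx]
        rw [e1, e2, ← ENNReal.ofReal_add (by linarith) (mul_nonneg (by linarith) hQ)]
        refine ENNReal.ofReal_le_ofReal ?_
        rw [abs_le]
        constructor <;> nlinarith
    _ = ENNReal.ofReal (2 * (1 - a)) := by
        have hsub : ∑' x, (p x - ENNReal.ofReal a * q x) = 1 - ENNReal.ofReal a := by
          refine ENNReal.eq_sub_of_add_eq ENNReal.ofReal_ne_top ?_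
          nth_rewrite 2 [← hq]
          rw [← ENNReal.tsum_add, ← PMF.tsum_coe p]
          exact tsum_congr fun x => tsub_add_cancel_of_le (h x)
        rw [ENNReal.tsum_add, hsub, ENNReal.tsum_mul_left, PMF.tsum_coe, mul_one, ← ENNReal.ofReal_one,
          ← ENNReal.ofReal_sub _ h0, ← ENNReal.ofReal_add (by linarith) (by linarith)]
        congr 1
        ring

lemma mul_map_le_map {p q : PMF α} {a : ℝ≥0∞} (φ : α → β) (h : ∀ x, a * q x ≤ p x) (y : β) :
    a * q.map φ y ≤ p.map φ y := by
  classical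
  rw [PMF.map_apply, PMF.map_apply, ← ENNReal.tsum_mul_left]
  refine ENNReal.tsum_le_tsum fun x => ?_
  split_ifs
  · exact h x
  · simp

lemma mul_le_bind_apply (p : PMF α) (k : α → PMF β) (a : α) (b : β) :
    p a * k a b ≤ p.bind k b := by
  rw [PMF.bind_apply]
  exact ENNReal.le_tsum (f := fun a => p a * k a b) a

end Distance

/-! ### The ideal change of state and its invariants -/

section Fill

variable {n : ℕ}

/-- The times at which the query for time `t` adds positions to the record `σ`. -/
def IsNew (L : ℕ) (σ : ℕ → ℕ) (t c : ℕ) : Prop :=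
  NewTime L t (leftDist σ t L) (rightDist σ t L) c

instance (L : ℕ) (σ : ℕ → ℕ) (t c : ℕ) : Decidable (IsNew L σ t c) :=
  inferInstanceAs (Decidable (NewTime _ _ _ _ _))

lemma IsNew.lt {L : ℕ} {σ : ℕ → ℕ} {t c : ℕ} (h : IsNew L σ t c) : c < t + L + 1 := by
  have := h.2
  have := rightDist_le (σ := σ) (t := t) (L := L)
  split_ifs at * <;> omega

lemma IsNew.le {L : ℕ} {σ : ℕ → ℕ} {t c : ℕ} (h : IsNew L σ t c) : t ≤ c + L := by
  have := h.1
  have := leftDist_le (σ := σ) (t := t) (L := L)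
  split_ifs at * <;> omega

/-- The state after the query for time `t` if it adds the positions of `X` to the record. -/
def fill (L : ℕ) (X : ℕ → Fin n) (σ : Store) (t : ℕ) : Store :=
  Finsupp.onFinset ((marked σ).support ∪ Finset.range (t + L + 1))
    (fun c => if IsNew L (marked σ) t c then X c + 1 else marked σ c) (by
      intro c hc
      rw [Finset.mem_union, Finset.mem_range, Finsupp.mem_support_iff]
      split_ifs at hc with h
      · exact Or.inr h.lt
      · exact Or.inl hc)

lemma fill_apply (L : ℕ) (X : ℕ → Fin n) (σ : Store) (t c : ℕ) :
    fill L X σ t c = if IsNew L (marked σ) t c then (X c : ℕ) + 1 else marked σ c := rfl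

/-- The record `σ` consists of positions of the walk `X` up to time `N`, and it has no small
gaps. -/
structure Records [NeZero n] (L N : ℕ) (X : ℕ → Fin n) (σ : ℕ → ℕ) : Prop where
  start : σ 0 = 1
  agree : ∀ i, σ i ≠ 0 → σ i = X i + 1
  le : ∀ i, σ i ≠ 0 → i ≤ N
  gap : GapFree L σ

variable [NeZero n]

lemma marked_zero (σ : Store) : marked σ 0 = 1 := by simp [marked]

lemma marked_apply_of_ne {σ : Store} {c : ℕ} (hc : c ≠ 0) : marked σ c = σ c := by
  simp [marked, hc]

lemma records_initial (L N : ℕ) {X : ℕ → Fin n} (hX : X 0 = 0) :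
    Records L N X (marked 0) := by
  have h : ∀ i, marked 0 i ≠ 0 → i = 0 := by
    intro i hi
    by_contra hne
    rw [marked_apply_of_ne hne] at hi
    simp at hi
  refine ⟨marked_zero 0, fun i hi => ?_, fun i hi => ?_, fun i k j h1 h2 _ _ hj => ?_⟩
  · rw [h i hi, marked_zero, hX]
    simp
  · rw [h i hi]
    omega
  · exact absurd (h j hj) (by omega)

/-- On a side with a near recorded time everything up to that time is filled. On the other side the
new end `t` has no recorded time within `L`, so the gap that begins there is long enough. -/
lemma GapFree.extend {L t : ℕ} {σ τ : ℕ → ℕ} (hL : 0 < L) (h0 : σ 0 ≠ 0) (hσ : GapFree L σ)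
    (hτ : ∀ c, τ c ≠ 0 ↔ IsNew L σ t c ∨ σ c ≠ 0) : GapFree L τ := by
  have hdlt : leftDist σ t L ≤ t := leftDist_le_time h0
  have hdlL : leftDist σ t L ≤ L := leftDist_le
  have hdrL : rightDist σ t L ≤ L := rightDist_le
  have hl0 := leftDist_eq_zero_iff (σ := σ) (t := t) hL
  have hr0 := rightDist_eq_zero_iff (σ := σ) (t := t) hL
  have hfree := fun i => eq_zero_of_between (σ := σ) (t := t) (L := L) (c := i)
  have hleft := ne_zero_of_leftDist_lt (σ := σ) (t := t) (L := L)
  have hright := ne_zero_of_rightDist_lt (σ := σ) (t := t) (L := L)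
  intro i k j hik hkj hji hi hj
  rw [hτ] at hi hj ⊢
  by_contra! hk
  obtain ⟨hk1, hk2⟩ := hk
  unfold IsNew NewTime at *
  generalize leftDist σ t L = dl at *
  generalize rightDist σ t L = dr at *
  have hσi := hfree i
  have hσj := hfree j
  -- The old condition is instantiated for the pairs of ends that can occur, `(i, j)`, `(i, t - dl)`
  -- and `(t + dr, j)`; what remains is linear arithmetic.
  have g : ¬ (σ i ≠ 0 ∧ σ j ≠ 0) := fun hh => hσ i k j hik hkj hji hh.1 hh.2 hk2
  have gl : ¬ (k < t - dl ∧ t - dl < i + L ∧ σ i ≠ 0 ∧ σ (t - dl) ≠ 0) := fun hh =>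
    hσ i k _ hik hh.1 hh.2.1 hh.2.2.1 hh.2.2.2 hk2
  have gr : ¬ (t + dr < k ∧ j < t + dr + L ∧ σ (t + dr) ≠ 0 ∧ σ j ≠ 0) := fun hh =>
    hσ _ k j hh.1 hkj hh.2.1 hh.2.2.1 hh.2.2.2 hk2
  have hkl : k ≠ t - dl ∨ L ≤ dl := by
    by_contra! hh
    exact hleft hh.2 (hh.1 ▸ hk2)
  have hkr : k ≠ t + dr ∨ L ≤ dr := by
    by_contra! hh
    exact hright hh.2 (hh.1 ▸ hk2)
  clear hτ hσ hfree
  by_cases c1 : dl < L <;> by_cases c2 : dr < L <;>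
    simp only [c1, c2, if_true, if_false, true_implies] at hi hj hk1 hleft hright <;> omega

/-- The first part says that marking the start again changes nothing, so the state after a query is
itself the record with which the next query works. -/
lemma Records.fill {L N t : ℕ} {X : ℕ → Fin n} {σ : Store} (hL : 0 < L) (hX : X 0 = 0)
    (h : Records L N X (marked σ)) (ht : t ≤ N) :
    marked (fill L X σ t) = WalkAccess.fill L X σ t ∧
      Records L N X (WalkAccess.fill L X σ t) := by
  have hs : WalkAccess.fill L X σ t 0 = 1 := by
    rw [fill_apply, hX, marked_zero]
    simp
  refine ⟨?_, hs, fun i hi => ?_, fun i hi => ?_, ?_⟩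
  · ext c
    by_cases hc : c = 0
    · rw [hc, hs, marked_zero]
    · rw [marked_apply_of_ne hc]
  · rw [fill_apply] at hi ⊢
    split_ifs at hi ⊢
    · rfl
    · exact h.agree i hi
  · rw [fill_apply] at hi
    split_ifs at hi with hn
    · have := hn.2
      have hr := ne_zero_of_rightDist_lt (σ := marked σ) (t := t) (L := L)
      split_ifs at this with hlt
      · have := h.le _ (hr hlt)
        omega
      · omega
    · exact h.le i hi
  · refine h.gap.extend (t := t) hL (by rw [h.start]; omega) fun c => ?_
    rw [fill_apply]
    split_ifs with hn
    · simp [hn]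
    · simp [hn]

end Fill

/-! ### The ideal history as a function of the walk -/

section Ideal

variable {n : ℕ} [NeZero n]

/-- The history in which all answers and all recorded positions are those of `X`. -/
def idealHistory (L : ℕ) (f : List Round → ℕ) (X : ℕ → Fin n) : ℕ → List Round
  | 0 => []
  | r + 1 => ⟨f (idealHistory L f X r), X (f (idealHistory L f X r)),
      fill L X (currentState (idealHistory L f X r)) (f (idealHistory L f X r))⟩
        :: idealHistory L f X r

omit [NeZero n] in
lemma idealInteraction_fill (L : ℕ) (f : List Round → ℕ) (X : ℕ → Fin n) (r : ℕ) :
    idealInteraction (fun X σ t => PMF.pure (fill L X σ t)) f X r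
      = PMF.pure (idealHistory L f X r) := by
  induction r with
  | zero => rfl
  | succ r ih => rw [idealInteraction, ih, PMF.pure_bind, PMF.pure_map, idealHistory]

omit [NeZero n] in
lemma visible_idealHistory (L : ℕ) (g : List (ℕ × ℕ) → ℕ) (X : ℕ → Fin n) (r : ℕ) :
    visible (idealHistory L (fun h => g (visible h)) X r) = readOff g X r := by
  induction r with
  | zero => rfl
  | succ r ih =>
    rw [idealHistory, readOff, visible, List.map_cons, ← visible, ih]

lemma records_idealHistory {L N : ℕ} {f : List Round → ℕ} {X : ℕ → Fin n} (hL : 0 < L)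
    (hX : X 0 = 0) (hf : ∀ h, f h ≤ N) (r : ℕ) :
    Records L N X (marked (currentState (idealHistory L f X r))) := by
  induction r with
  | zero => exact records_initial L N hX
  | succ r ih =>
    rw [idealHistory, currentState]
    obtain ⟨h1, h2⟩ := ih.fill hL hX (hf (idealHistory L f X r))
    rwa [h1]

lemma Records.state_le {L N : ℕ} {X : ℕ → Fin n} {σ : Store} (h : Records L N X (marked σ))
    (h0 : σ 0 ≤ n) (c : ℕ) : σ c ≤ n := by
  by_cases hc : c = 0
  · rwa [hc]
  · by_contra! hlt
    have := h.agree c (by rw [marked_apply_of_ne hc]; omega)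
    rw [marked_apply_of_ne hc] at this
    have := (X c).2
    omega

lemma currentState_idealHistory_le {L N : ℕ} {f : List Round → ℕ} {X : ℕ → Fin n} (hL : 0 < L)
    (hX : X 0 = 0) (hf : ∀ h, f h ≤ N) (r : ℕ) (c : ℕ) :
    currentState (idealHistory L f X r) c ≤ n := by
  refine (records_idealHistory hL hX hf r).state_le ?_ c
  cases r with
  | zero => simp [idealHistory, currentState]
  | succ r =>
    rw [idealHistory, currentState, fill_apply, hX, marked_zero]
    simpa [Nat.one_le_iff_ne_zero] using NeZero.ne n

end Ideal

/-! ### Comparison of the real and the ideal interaction -/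

section Comparison

variable {n : ℕ} [NeZero n] (G : SimpleGraph (Fin n)) [DecidableRel G.Adj]

/-- A bound on all words that occur in a query for time `t`. -/
def Params.peakBound (π : Params) (cL cK t : ℕ) : ℕ :=
  t + 2 * π.window cL + (π.n + 1) + (π.n + π.numWalks cK * π.window cL) +
    [t, π.B, π.n * π.B, π.invEps, π.n * π.B * π.invEps, π.logAcc, π.invGap, cL,
      cL * π.logAcc, π.window cL, π.n, 2, π.root, cK, cK * π.logAcc, π.numWalks cK].sum

lemma sim_query {π : Params} {cL cK : ℕ} {h : List Round} (t : ℕ) (hπ : π.n = n)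
    (hσ : ∀ c, currentState h c ≤ n) (hL : 0 < π.window cL) :
    Sim (query G (accessProgram cL cK) π h t)
      (extensionLaw G (marked (currentState h)) t (π.window cL) (π.numWalks cK)
        (leftDist (marked (currentState h)) t (π.window cL))
        (rightDist (marked (currentState h)) t (π.window cL)))
      (Answered n (marked (currentState h)) t (IsNew (π.window cL) (marked (currentState h)) t)
        (π.numWalks cK * (9 * π.window cL + 12) + 16 * π.window cL + 50 + Nat.log 2 n)
        (π.peakBound cL cK t)) := by
  refine sim_accessProgram G hπ hσ hL (fun x hx => ?_) ?_ ?_ ?_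
  · exact (List.single_le_sum (fun _ _ => Nat.zero_le _) x hx).trans (Nat.le_add_left _ _)
  · rw [Params.peakBound]; omega
  · rw [Params.peakBound]; omega
  · rw [Params.peakBound]; omega

variable {G} {d : ℕ}

lemma matchProb_le_one (hd : 1 ≤ d) (hG : G.IsRegularOfDegree d) (σ : ℕ → ℕ) (k : ℕ)
    (u : Fin n) : ENNReal.ofReal (matchProb G d σ k 0 u) ≤ 1 := by
  classical
  rw [← expect_walkFrom_match G hd hG, ← expect_const (walkFrom G u k) 1]
  exact expect_mono fun X => by split_ifs <;> simp

lemma mem_support_walkDist {k : ℕ} {X : ℕ → Fin n} (hX : X ∈ (walkDist G k).support) :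
    X 0 = 0 := by
  induction k generalizing X with
  | zero =>
    rw [walkDist, PMF.support_pure, Set.mem_singleton_iff] at hX
    rw [hX]
  | succ k ih =>
    rw [walkDist, PMF.mem_support_bind_iff] at hX
    obtain ⟨Y, hY, hX⟩ := hX
    rw [PMF.mem_support_map_iff] at hX
    obtain ⟨v, -, rfl⟩ := hX
    simpa using ih hY

/-- A trajectory that produces this history must agree with the final record. No time after `len` is
recorded, so the horizon may exceed the length of the walk. -/
lemma ideal_apply_le (hd : 1 ≤ d) (hG : G.IsRegularOfDegree d) {L len N : ℕ}
    {f : List Round → ℕ} (hL : 0 < L) (hf : ∀ h, f h ≤ len) (hN : len ≤ N) {X : ℕ → Fin n}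
    (hX : X 0 = 0) (r : ℕ) :
    (walkDist G len).map (fun X => idealHistory L f X r) (idealHistory L f X r)
      ≤ ENNReal.ofReal
        (matchProb G d (marked (currentState (idealHistory L f X r))) N 0 0) := by
  classical
  have hrec := records_idealHistory hL hX hf r
  obtain ⟨k, rfl⟩ := Nat.exists_eq_add_of_le hN
  rw [matchProb_extend G hd hG fun j hj => by
    by_contra hne
    have := hrec.le j hne
    omega]
  rw [← expect_walkFrom_match G hd hG, ← walkDist_eq_walkFrom, ← expect_eq_apply, expect_map]
  refine expect_mono_support fun Y hY => ?_
  have hY0 := mem_support_walkDist hY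
  split_ifs with h1 h2
  · exact le_rfl
  · refine absurd (fun i _ => ?_) h2
    have := records_idealHistory hL hY0 hf r
    rw [h1] at this
    by_cases hi : marked (currentState (idealHistory L f X r)) i = 0
    · exact allows_of_zero hi
    · exact allows_of_eq (this.agree i hi)
  · simp
  · exact le_rfl

/-- Each query costs a factor `c` and multiplies the bound by the ratio of the matching
probabilities of the new and the old record, so the product telescopes. The horizon `len + 2 * h`
leaves room for the window to the right of any query. -/
lemma le_interaction_apply (hd : 1 ≤ d) (hG : G.IsRegularOfDegree d) {π : Params}
    {cL cK h s len : ℕ} {δ e₁ e₂ c : ℝ} (hπ : π.n = n) (hw : π.window cL = 2 * h) (hh : 1 ≤ h)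
    (hmix : Mixes G d δ h) (H : Accuracy n (π.numWalks cK) s δ e₁ e₂ c)
    {f : List Round → ℕ} (hf : ∀ h, f h ≤ len) {X : ℕ → Fin n} (hX : X 0 = 0) (r : ℕ) :
    ENNReal.ofReal (c ^ r * matchProb G d
        (marked (currentState (idealHistory (2 * h) f X r))) (len + 2 * h) 0 0)
      ≤ interaction G (accessProgram cL cK) π f r (idealHistory (2 * h) f X r) := by
  induction r with
  | zero =>
    rw [pow_zero, one_mul]
    simpa [interaction, idealHistory] using matchProb_le_one hd hG _ _ _
  | succ r ih =>
    have hL : 0 < 2 * h := by omega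
    have hrec := records_idealHistory hL hX hf r
    have hst := currentState_idealHistory_le hL hX hf r
    have hsim := sim_query G (cL := cL) (cK := cK) (f (idealHistory (2 * h) f X r)) hπ hst
      (by omega)
    rw [hw] at hsim
    have hft := hf (idealHistory (2 * h) f X r)
    rw [interaction]
    simp only [idealHistory]
    generalize idealHistory (2 * h) f X r = g at *
    obtain ⟨hm1, hm2⟩ := hrec.fill hL hX hft
    rw [currentState, hm1]
    obtain ⟨x, hx1, hx2⟩ := extensionLaw_lower G hd hG (τ := fill (2 * h) X (currentState g) (f g))
      hmix H hh (by rw [hrec.start]; omega) hrec.gap hrec.agree (fun i => fill_apply _ _ _ _ _)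
      (N := len + 2 * h) (by
        have := rightDist_le (σ := marked (currentState g)) (t := f g) (L := 2 * h)
        omega) 0
    refine le_trans ?_ (mul_le_bind_apply _ _ g _)
    have hq := hsim.apply_le_map (b := some x)
      (φ := fun m : Config => (⟨f g, m.reg 0, m.store⟩ :: g : List Round))
      (c := ⟨f g, X (f g), fill (2 * h) X (currentState g) (f g)⟩ :: g) ?_
    · rw [pow_succ, mul_assoc, ENNReal.ofReal_mul (pow_nonneg H.zero_le_c _)]
      rw [ENNReal.ofReal_mul (pow_nonneg H.zero_le_c _)] at ih
      refine (mul_le_mul_right hx2 _).trans ?_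
      rw [mul_left_comm, mul_comm]
      exact mul_le_mul' ih hq
    -- The sampled positions determine the new state and the answer, so every configuration coupled
    -- with `some x` yields the desired history.
    · intro m hm
      have hstore : m.store = fill (2 * h) X (currentState g) (f g) := by
        ext i
        rw [fill_apply]
        split_ifs with hi
        · rw [hm.storeIn x rfl i hi, hx1 i hi]
        · exact hm.storeOut i hi
      have hans : m.reg 0 = X (f g) := by
        rw [hm.reg0, hstore, hm2.agree, Nat.add_sub_cancel]
        rw [fill_apply]
        -- The queried time is recorded afterwards: it is one of the new times unless it was
        -- recorded before.
        split_ifs with hi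
        · omega
        · rw [ne_eq, ← ne_eq, ← leftDist_eq_zero_iff hL]
          by_contra hne
          have hne' : rightDist (marked (currentState g)) (f g) (2 * h) ≠ 0 := by
            rw [ne_eq, rightDist_eq_zero_iff hL, ← leftDist_eq_zero_iff hL]
            exact hne
          have := leftDist_le_time (σ := marked (currentState g)) (t := f g) (L := 2 * h)
            (by rw [hrec.start]; omega)
          refine hi ⟨?_, ?_⟩ <;> split_ifs <;> omega
      rw [hstore, hans]

lemma mul_ideal_le_interaction (hd : 1 ≤ d) (hG : G.IsRegularOfDegree d) {π : Params}
    {cL cK h s len : ℕ} {δ e₁ e₂ c : ℝ} (hπ : π.n = n) (hw : π.window cL = 2 * h) (hh : 1 ≤ h)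
    (hmix : Mixes G d δ h) (H : Accuracy n (π.numWalks cK) s δ e₁ e₂ c)
    {f : List Round → ℕ} (hf : ∀ h, f h ≤ len) (r : ℕ) (g : List Round) :
    ENNReal.ofReal (c ^ r) * (walkDist G len).map (fun X => idealHistory (2 * h) f X r) g
      ≤ interaction G (accessProgram cL cK) π f r g := by
  by_cases hg : g ∈ ((walkDist G len).map fun X => idealHistory (2 * h) f X r).support
  · rw [PMF.mem_support_map_iff] at hg
    obtain ⟨X, hX, rfl⟩ := hg
    have hX0 := mem_support_walkDist hX
    refine le_trans ?_ (le_interaction_apply hd hG hπ hw hh hmix H hf hX0 r)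
    rw [ENNReal.ofReal_mul (pow_nonneg H.zero_le_c _)]
    exact mul_le_mul_right
      (ideal_apply_le hd hG (by omega) hf (Nat.le_add_right _ _) hX0 r) _
  · rw [PMF.mem_support_iff, not_not] at hg
    rw [hg, mul_zero]
    exact zero_le

/-- Bernoulli's inequality bounds the loss over `r` queries by `r (1 - c)`. -/
lemma two_mul_one_sub_pow_le {c ε : ℝ} {B r : ℕ} (h0 : 0 ≤ c) (h1 : c ≤ 1)
    (hε : 2 * (B * (1 - c)) ≤ ε) (hr : r ≤ B) : 2 * (1 - c ^ r) ≤ ε := by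
  have hb := one_add_mul_le_pow (a := c - 1) (by linarith) r
  rw [add_sub_cancel] at hb
  have hrB : (r : ℝ) ≤ B := by exact_mod_cast hr
  nlinarith

variable {π : Params} {cL cK h s B : ℕ} {δ e₁ e₂ c ε : ℝ}

lemma isRobust_of_accuracy (hd : 1 ≤ d) (hG : G.IsRegularOfDegree d) (hπ : π.n = n)
    (hw : π.window cL = 2 * h) (hh : 1 ≤ h) (hmix : Mixes G d δ h)
    (H : Accuracy n (π.numWalks cK) s δ e₁ e₂ c) (hε : 2 * (B * (1 - c)) ≤ ε) :
    IsRobust G (accessProgram cL cK) π B ε := by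
  refine ⟨fun X σ t => PMF.pure (fill (2 * h) X σ t), fun len f hf r hr => ?_⟩
  simp only [idealInteraction_fill]
  refine (l1Dist_le_of_mul_le (pow_nonneg H.zero_le_c r) (pow_le_one₀ H.zero_le_c H.c_le_one)
    (mul_ideal_le_interaction hd hG hπ hw hh hmix H hf r)).trans ?_
  exact ENNReal.ofReal_le_ofReal (two_mul_one_sub_pow_le H.zero_le_c H.c_le_one hε hr)

lemma isLocalAccess_of_accuracy (hd : 1 ≤ d) (hG : G.IsRegularOfDegree d) (hπ : π.n = n)
    (hw : π.window cL = 2 * h) (hh : 1 ≤ h) (hmix : Mixes G d δ h)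
    (H : Accuracy n (π.numWalks cK) s δ e₁ e₂ c) (hε : 2 * (B * (1 - c)) ≤ ε) :
    IsLocalAccess G (accessProgram cL cK) π B ε := by
  intro len g hg r hr
  have key := mul_map_le_map visible
    (mul_ideal_le_interaction hd hG hπ hw hh hmix H (f := fun h => g (visible h)) (len := len)
      (fun h => hg _) r)
  rw [PMF.map_comp] at key
  simp only [Function.comp_def, visible_idealHistory] at key
  refine (l1Dist_le_of_mul_le (pow_nonneg H.zero_le_c r) (pow_le_one₀ H.zero_le_c H.c_le_one)
    key).trans ?_
  exact ENNReal.ofReal_le_ofReal (two_mul_one_sub_pow_le H.zero_le_c H.c_le_one hε hr)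

end Comparison

/-! ### The choice of the parameters -/

lemma exp_neg_natCast_le (m : ℕ) : Real.exp (-m) ≤ (1 / 2) ^ m := by
  have h : Real.exp (-1) ≤ 1 / 2 := by
    rw [Real.exp_neg, one_div]
    exact inv_anti₀ (by norm_num) (by linarith [Real.add_one_le_exp (1 : ℝ)])
  calc Real.exp (-m) = Real.exp (-1) ^ m := by
        rw [← Real.exp_nat_mul]
        congr 1
        ring
    _ ≤ _ := pow_le_pow_left₀ (Real.exp_pos _).le h m

lemma one_sub_pow_le_half_pow {x : ℝ} {k m : ℕ} (hx : x ≤ 1) (h : m ≤ k * x) :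
    (1 - x) ^ k ≤ (1 / 2) ^ m := by
  calc (1 - x) ^ k ≤ Real.exp (-x) ^ k :=
        pow_le_pow_left₀ (by linarith) (Real.one_sub_le_exp_neg x) k
    _ = Real.exp (-(k * x)) := by
        rw [← Real.exp_nat_mul]
        congr 1
        ring
    _ ≤ Real.exp (-m) := Real.exp_le_exp.2 (by linarith)
    _ ≤ _ := exp_neg_natCast_le m

/-- `s` is of order `√n` and `2 ^ ρ ≥ Λ`. With `K = 32 ρ s`, missing a table of `s` entries and
having fewer than `s` entries each have probability at most `1 / (6 Λ)`, and `δ` is so small that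
even `K` factors `1 - δ` cost no more than this. -/
lemma accuracy_of_bounds {n ρ s Λ : ℕ} {δ : ℝ} (hn : 2 ≤ n) (hnΛ : n ≤ Λ) (h3 : 3 ≤ Λ)
    (hΛ : Λ ≤ 2 ^ ρ) (hρΛ : ρ ≤ Λ) (hs : s * s ≤ n) (hs' : n ≤ 4 * (s * s)) (hδ0 : 0 ≤ δ)
    (hδ : δ ≤ n * (1 / 2) ^ (10 * ρ)) :
    Accuracy n (32 * ρ * s) s δ (1 / (6 * Λ)) (1 / (6 * Λ)) (1 - 1 / (2 * Λ)) := by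
  have hs1 : 1 ≤ s := by
    rcases Nat.eq_zero_or_pos s with h | h
    · subst h; omega
    · exact h
  have hsn : s ≤ n := le_trans (Nat.le_mul_self s) hs
  have hnR : (2 : ℝ) ≤ n := by exact_mod_cast hn
  have h3R : (3 : ℝ) ≤ Λ := by exact_mod_cast h3
  have hnΛR : (n : ℝ) ≤ Λ := by exact_mod_cast hnΛ
  have hsR : (s : ℝ) ≤ n := by exact_mod_cast hsn
  have hs1R : (1 : ℝ) ≤ s := by exact_mod_cast hs1
  have hρR : (ρ : ℝ) ≤ Λ := by exact_mod_cast hρΛ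
  have hss : (s : ℝ) * s ≤ n := by exact_mod_cast hs
  have hss' : (n : ℝ) ≤ 4 * (s * s) := by exact_mod_cast hs'
  have hΛR : (Λ : ℝ) ≤ 2 ^ ρ := by exact_mod_cast hΛ
  -- All errors are measured in powers of `x = 2 ^ (-ρ) ≤ 1 / Λ`; in particular `δ ≤ n x ^ 10 ≤ x ^
  -- 9`.
  obtain ⟨x, hx⟩ : ∃ x : ℝ, x = (1 / 2) ^ ρ := ⟨_, rfl⟩
  have hx0 : 0 < x := by rw [hx]; positivity
  have hxΛ : Λ * x ≤ 1 := by
    rw [hx, one_div, inv_pow, ← div_eq_mul_inv, div_le_one (by positivity)]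
    exact hΛR
  have hx3 : x ≤ 1 / 3 := by nlinarith
  have hδx : δ ≤ x ^ 9 := by
    refine hδ.trans ?_
    rw [mul_comm 10, pow_mul, ← hx]
    calc n * x ^ 10 = n * x * x ^ 9 := by ring
      _ ≤ 1 * x ^ 9 := by
        refine mul_le_mul_of_nonneg_right ?_ (by positivity)
        exact (mul_le_mul_of_nonneg_right hnΛR hx0.le).trans hxΛ
      _ = x ^ 9 := one_mul _
  have hδ1 : δ ≤ 1 / 3 := hδx.trans ((pow_le_of_le_one hx0.le (by linarith) (by omega)).trans hx3)
  have hpow4 : x ^ 4 ≤ 1 / (6 * Λ) := by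
    rw [le_div_iff₀ (by positivity)]
    have : x ^ 3 ≤ (1 / 3) ^ 3 := pow_le_pow_left₀ hx0.le hx3 3
    nlinarith [pow_pos hx0 3]
  have he1 : 1 / (6 * (Λ : ℝ)) ≤ 1 := by
    rw [div_le_one (by positivity)]
    linarith
  have he0 : 0 ≤ 1 / (6 * (Λ : ℝ)) := by positivity
  have hc : 1 / (2 * (Λ : ℝ)) ≤ 1 := by
    rw [div_le_one (by positivity)]
    linarith
  refine ⟨hδ0, by linarith, he0, he1, he0, he1, by linarith, hs1, hsn, ?_, ?_, ?_⟩
  · have hn0 : (0 : ℝ) < n := by linarith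
    -- The expected number of hits is `32 ρ (1 - δ) s ^ 2 / n`; it is at least `4 ρ` since `s ^ 2 ≥
    -- n / 4` and `1 - δ ≥ 1 / 2`.
    refine le_trans (one_sub_pow_le_half_pow (m := ρ * 4) ?_ ?_) ?_
    · rw [div_mul_eq_mul_div, div_le_one hn0]
      nlinarith
    · rw [div_mul_eq_mul_div, mul_div_assoc', le_div_iff₀ hn0]
      push_cast
      have : (ρ : ℝ) * n ≤ ρ * (4 * (s * s)) := mul_le_mul_of_nonneg_left hss' (Nat.cast_nonneg _)
      have h2 : (ρ : ℝ) * (s * s) * (1 / 2) ≤ ρ * (s * s) * (1 - δ) :=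
        mul_le_mul_of_nonneg_left (by linarith) (by positivity)
      linarith
    · rw [pow_mul, ← hx]
      exact hpow4
  -- As `s ≤ √n`, the power `s ^ K` is at most `n ^ (K / 2)`. The other half of `n ^ K` outweighs
  -- both the binomial coefficient and the factor `6 Λ`.
  · have h1 : (n.choose s : ℝ) ≤ n ^ s := by exact_mod_cast Nat.choose_le_pow n s
    have h2 : (s : ℝ) ^ (32 * ρ * s) ≤ n ^ (16 * ρ * s) := by
      rw [show 32 * ρ * s = 2 * (16 * ρ * s) by ring, pow_mul, sq]
      exact pow_le_pow_left₀ (by positivity) hss _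
    have hρ1 : 1 ≤ ρ := by
      rcases Nat.eq_zero_or_pos ρ with h | h
      · subst h; simp at hΛ; omega
      · exact h
    have hexp : s + ρ * 4 ≤ 16 * ρ * s := by nlinarith
    obtain ⟨k, hk⟩ := Nat.exists_eq_add_of_le hexp
    have h3 : (1 : ℝ) ≤ 1 / (6 * Λ) * n ^ (ρ * 4) := by
      refine le_trans ?_ (mul_le_mul_of_nonneg_right hpow4 (by positivity))
      rw [hx, ← pow_mul, ← mul_pow]
      exact one_le_pow₀ (by linarith)
    have h4 : (1 : ℝ) ≤ n ^ k := one_le_pow₀ (by linarith)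
    have h5 : (n : ℝ) ^ s ≤ 1 / (6 * Λ) * n ^ (16 * ρ * s) := by
      rw [hk, pow_add, pow_add]
      calc (n : ℝ) ^ s = n ^ s * (1 * 1) := by ring
        _ ≤ n ^ s * (1 / (6 * Λ) * n ^ (ρ * 4) * n ^ k) :=
          mul_le_mul_of_nonneg_left (mul_le_mul h3 h4 zero_le_one (by positivity))
            (by positivity)
        _ = _ := by ring
    calc (n.choose s : ℝ) * s ^ (32 * ρ * s) ≤ n ^ s * n ^ (16 * ρ * s) :=
          mul_le_mul h1 h2 (by positivity) (by positivity)
      _ ≤ 1 / (6 * Λ) * n ^ (16 * ρ * s) * n ^ (16 * ρ * s) :=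
          mul_le_mul_of_nonneg_right h5 (by positivity)
      _ = _ := by
        rw [mul_assoc, ← pow_add]
        congr 2
        ring
  · have hb := one_add_mul_le_pow (a := -δ) (by linarith) (32 * ρ * s + 1)
    -- The extra `3` pays for `(1 + δ) ^ 2 ≤ 1 + 3 δ`.
    have hK : ((32 * ρ * s + 1 : ℕ) : ℝ) + 3 ≤ 36 * (Λ * Λ) := by
      push_cast
      have : (ρ : ℝ) * s ≤ Λ * Λ :=
        mul_le_mul hρR (hsR.trans hnΛR) (by positivity) (by positivity)
      nlinarith
    have hKδ : (((32 * ρ * s + 1 : ℕ) : ℝ) + 3) * δ ≤ 1 / (6 * Λ) := by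
      refine (mul_le_mul hK hδx hδ0 (by positivity)).trans ?_
      rw [le_div_iff₀ (by positivity)]
      have hy : (Λ * x) ^ 3 ≤ 1 := pow_le_one₀ (by positivity) hxΛ
      have hz : x ^ 6 ≤ (1 / 3) ^ 6 := pow_le_pow_left₀ hx0.le hx3 6
      calc 36 * (Λ * Λ) * x ^ 9 * (6 * Λ) = 216 * ((Λ * x) ^ 3 * x ^ 6) := by ring
        _ ≤ 216 * (1 * (1 / 3) ^ 6) :=
          mul_le_mul_of_nonneg_left (mul_le_mul hy hz (by positivity) zero_le_one) (by norm_num)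
        _ ≤ 1 := by norm_num
    generalize hm : 32 * ρ * s + 1 = m at *
    have hmδ : 0 ≤ (m : ℝ) * δ := by positivity
    -- Of the allowed loss `3 e`, the two failure probabilities use `2 e` and the powers of `1 ± δ`
    -- use the third `e`.
    obtain ⟨e, he⟩ : ∃ e : ℝ, e = 1 / (6 * Λ) := ⟨_, rfl⟩
    have h3e : 1 / (2 * (Λ : ℝ)) = 3 * e := by
      rw [he]
      field_simp
      norm_num
    rw [h3e] at hc ⊢
    rw [← he] at hKδ he0 ⊢
    have hl : (1 - e) * (1 - e) * (1 - m * δ) ≤ (1 - e) * (1 - e) * (1 - δ) ^ m := by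
      refine mul_le_mul_of_nonneg_left ?_ (mul_self_nonneg _)
      rw [sub_eq_add_neg 1 δ]
      linarith
    refine le_trans ?_ hl
    rw [add_mul] at hKδ
    have hδ2 : δ * δ ≤ δ * 1 := mul_le_mul_of_nonneg_left (by linarith) hδ0
    have h1 : (1 - 3 * e) * (1 + δ) ^ 2 ≤ (1 - 3 * e) * (1 + 3 * δ) :=
      mul_le_mul_of_nonneg_left (by linarith) (by linarith)
    have h2 : (1 - 2 * e) * (1 - m * δ) ≤ (1 - e) * (1 - e) * (1 - m * δ) :=
      mul_le_mul_of_nonneg_right (by linarith [mul_self_nonneg e]) (by linarith)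
    have h3 : 0 ≤ e * δ := mul_nonneg he0 hδ0
    have h4 : 0 ≤ e * (m * δ) := mul_nonneg he0 hmδ
    linarith

lemma two_pow_logAcc_bounds (π : Params) (h : 1 ≤ π.n * π.B * π.invEps) :
    π.n * π.B * π.invEps ≤ 2 ^ π.logAcc ∧ π.logAcc ≤ π.n * π.B * π.invEps := by
  rw [Params.logAcc]
  refine ⟨(Nat.lt_pow_succ_log_self (by norm_num) _).le, ?_⟩
  exact Nat.log_lt_self 2 (by omega)

lemma root_bounds (π : Params) (h : 1 ≤ π.n) :
    π.root * π.root ≤ π.n ∧ π.n ≤ 4 * (π.root * π.root) := by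
  rw [Params.root, ← pow_add]
  constructor
  · refine le_trans (Nat.pow_le_pow_right (by norm_num) ?_) (Nat.pow_log_le_self 2 (by omega))
    omega
  · refine (Nat.lt_pow_succ_log_self (b := 2) (by norm_num) π.n).le.trans ?_
    rw [show (4 : ℕ) = 2 ^ 2 by norm_num, ← pow_add]
    exact Nat.pow_le_pow_right (by norm_num) (by omega)

section Parameters

variable {n B : ℕ} {ε lam : ℝ}

lemma one_le_invEps (hε : 0 < ε) : 1 ≤ (params n B ε lam).invEps :=
  Nat.one_le_iff_ne_zero.2 (Nat.ceil_pos.2 (by positivity)).ne'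

lemma one_le_invGap (h1 : lam < 1) : 1 ≤ (params n B ε lam).invGap :=
  Nat.one_le_iff_ne_zero.2 (Nat.ceil_pos.2 (by
    have : 0 < 1 - lam := by linarith
    positivity)).ne'

/-- `λ ^ k ≤ exp (-(1 - λ) k)`: the walk halves its deviation every `⌈1 / (1 - λ)⌉` steps. -/
lemma pow_invGap_le (h0 : 0 ≤ lam) (h1 : lam < 1) :
    lam ^ (params n B ε lam).invGap ≤ 1 / 2 := by
  have := one_sub_pow_le_half_pow (x := 1 - lam) (k := (params n B ε lam).invGap) (m := 1)
    (by linarith) (by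
      rw [Nat.cast_one, ← div_le_iff₀ (by linarith)]
      exact Nat.le_ceil _)
  simpa using this

lemma mixes_of_expansion [NeZero n] {G : SimpleGraph (Fin n)} [DecidableRel G.Adj] {d : ℕ}
    (hd : 1 ≤ d) (hG : G.IsRegularOfDegree d) (h0 : 0 ≤ lam) (h1 : lam < 1)
    (hlam : spectralExpansion G d ≤ lam) (h : ℕ) : Mixes G d (n * lam ^ h) h := by
  intro m hm u v
  have hn : (0 : ℝ) < n := by exact_mod_cast NeZero.pos n
  have := abs_le.1 (abs_walkMatrix_pow_sub_le G hd hG h0 hlam m u v)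
  have hp : lam ^ m ≤ lam ^ h := pow_le_pow_of_le_one h0 h1.le hm
  rw [sub_div, add_div, mul_div_assoc, mul_div_cancel₀ _ hn.ne']
  constructor <;> linarith

lemma isAccurate [NeZero n] {G : SimpleGraph (Fin n)} [DecidableRel G.Adj] {d : ℕ}
    (hd : 1 ≤ d) (hG : G.IsRegularOfDegree d) (h0 : 0 ≤ lam) (h1 : lam < 1)
    (hlam : spectralExpansion G d ≤ lam) (hε : 0 < ε) :
    IsLocalAccess G (accessProgram 10 32) (params n B ε lam) B ε ∧
      IsRobust G (accessProgram 10 32) (params n B ε lam) B ε := by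
  -- For `B = 0` the quantity `Λ` vanishes and the estimates break down, but only empty histories
  -- have to be compared.
  rcases Nat.eq_zero_or_pos B with rfl | hB
  · refine ⟨fun len g hg r hr => ?_, fun X σ t => PMF.pure σ, fun len f hf r hr => ?_⟩
    all_goals
      obtain rfl : r = 0 := by omega
      refine (l1Dist_le_of_mul_le zero_le_one le_rfl fun x => ?_).trans
        (ENNReal.ofReal_le_ofReal (by linarith))
    · rw [ENNReal.ofReal_one, one_mul, interaction, PMF.pure_map]
      exact (congrArg (fun p : PMF _ => p x) (PMF.map_const _ _)).le
    · rw [ENNReal.ofReal_one, one_mul, interaction]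
      exact (congrArg (fun p : PMF _ => p x) (PMF.bind_const _ _)).le
  obtain ⟨π, hπ⟩ : ∃ π, π = params n B ε lam := ⟨_, rfl⟩
  have hn3 := three_le_card G hd hG h1 hlam
  have hE : 1 ≤ π.invEps := hπ ▸ one_le_invEps hε
  have hg : 1 ≤ π.invGap := hπ ▸ one_le_invGap h1
  have hpn : π.n = n := by rw [hπ]; rfl
  have hpB : π.B = B := by rw [hπ]; rfl
  have hBE : 1 ≤ π.B * π.invEps := Nat.mul_pos (by omega) hE
  have hnΛ : n ≤ π.n * π.B * π.invEps := by
    rw [mul_assoc, hpn]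
    exact Nat.le_mul_of_pos_right _ hBE
  obtain ⟨b1, b2⟩ := two_pow_logAcc_bounds π (by omega)
  obtain ⟨c1, c2⟩ := root_bounds π (by omega)
  rw [hpn] at c1 c2
  have hmix := mixes_of_expansion hd hG h0 h1 hlam (10 * π.logAcc * π.invGap)
  have H := accuracy_of_bounds (δ := n * lam ^ (10 * π.logAcc * π.invGap)) (by omega) hnΛ
    (by omega) b1 b2 c1 c2 (by positivity) (by
      rw [mul_comm _ π.invGap, pow_mul]
      refine mul_le_mul_of_nonneg_left ?_ (Nat.cast_nonneg _)
      exact pow_le_pow_left₀ (by positivity) (hπ ▸ pow_invGap_le h0 h1) _)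
  have hh : 1 ≤ 10 * π.logAcc * π.invGap :=
    Nat.mul_pos (Nat.mul_pos (by norm_num) (Nat.succ_pos _)) hg
  -- With `c = 1 - 1 / (2 Λ)` the total error is `1 / (n ⌈1 / ε⌉)`.
  have hεB : 2 * (B * (1 - (1 - 1 / (2 * ((π.n * π.B * π.invEps : ℕ) : ℝ))))) ≤ ε := by
    have hEε : 1 / ε ≤ π.invEps := by
      rw [hπ]
      exact Nat.le_ceil _
    have hE0 : (0 : ℝ) < π.invEps := by exact_mod_cast hE
    have hB0 : (0 : ℝ) < B := by exact_mod_cast hB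
    have hn0 : (1 : ℝ) ≤ n := by exact_mod_cast (by omega : 1 ≤ n)
    rw [div_le_iff₀ hε] at hEε
    rw [hpn, hpB]
    push_cast
    rw [show 2 * ((B : ℝ) * (1 - (1 - 1 / (2 * (n * B * π.invEps))))) = 1 / (n * π.invEps) by
      field_simp
      ring, div_le_iff₀ (by positivity)]
    nlinarith [mul_pos hε hE0]
  rw [← hπ]
  exact ⟨isLocalAccess_of_accuracy hd hG hpn rfl hh hmix H hεB,
    isRobust_of_accuracy hd hG hpn rfl hh hmix H hεB⟩

end Parameters

/-! ### The growth of the persistent memory -/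

lemma storeBits_le_add {σ τ : Store} {S : Finset ℕ} {b : ℕ} (hS : ∀ c ∉ S, τ c = σ c)
    (hb : ∀ c ∈ S, τ c ≠ 0 → Nat.size c + Nat.size (τ c) ≤ b) :
    storeBits τ ≤ storeBits σ + S.card * b := by
  classical
  rw [storeBits, storeBits, Finsupp.sum, Finsupp.sum,
    ← Finset.sum_filter_add_sum_filter_not τ.support (· ∈ S), add_comm]
  refine add_le_add ?_ ?_
  · refine le_trans (Finset.sum_le_sum (g := fun c => Nat.size c + Nat.size (σ c))
      fun c hc => ?_) (Finset.sum_le_sum_of_subset fun c hc => ?_)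
    · rw [hS c (Finset.mem_filter.1 hc).2]
    · rw [Finset.mem_filter, Finsupp.mem_support_iff] at hc
      rw [Finsupp.mem_support_iff, ← hS c hc.2]
      exact hc.1
  · refine (Finset.sum_le_card_nsmul _ _ b fun c hc => ?_).trans ?_
    · rw [Finset.mem_filter, Finsupp.mem_support_iff] at hc
      exact hb c hc.2 hc.1
    · rw [smul_eq_mul]
      refine Nat.mul_le_mul_right _ (Finset.card_le_card fun c hc => ?_)
      exact (Finset.mem_filter.1 hc).2

section States

variable {n : ℕ} [NeZero n] (G : SimpleGraph (Fin n)) [DecidableRel G.Adj]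

/-- The words in the states are at most `n`, and they are stored at times that do not exceed all
queried times. -/
def ValidState (n N : ℕ) (σ : ℕ → ℕ) : Prop := ∀ c, σ c ≤ n ∧ (σ c ≠ 0 → c ≤ N)

omit [NeZero n] in
lemma Answered.validState {σ : Store} {t L Θ M N : ℕ} {m : Config} {o : Option (ℕ → Fin n)}
    (h : Answered n (marked σ) t (IsNew L (marked σ) t) Θ M m o) (hσ : ValidState n N σ) :
    ValidState n (max t N) m.store := by
  have hσ' : ∀ c, marked σ c ≠ 0 → c ≤ N := by
    intro c hc
    by_cases h0 : c = 0
    · omega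
    · rw [marked_apply_of_ne h0] at hc
      exact (hσ c).2 hc
  refine fun c => ⟨h.bound c, fun hc => ?_⟩
  by_cases hn : IsNew L (marked σ) t c
  · have := hn.2
    have hr := ne_zero_of_rightDist_lt (σ := marked σ) (t := t) (L := L)
    split_ifs at this with hlt
    · have := hσ' _ (hr hlt)
      omega
    · omega
  · rw [h.storeOut c hn] at hc
    have := hσ' c hc
    omega

/-- Resource bounds concern every run, including those with failed bridges, where the state need not
record a walk; this weaker invariant survives there. -/
lemma validState_of_interaction {π : Params} {cL cK : ℕ} (hπ : π.n = n)
    (hL : 0 < π.window cL) (f : List Round → ℕ) (r : ℕ) :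
    Ensures (interaction G (accessProgram cL cK) π f r) fun h =>
      ValidState n (maxTime h) (currentState h) := by
  induction r with
  | zero => exact ensures_pure (by simp [currentState, ValidState])
  | succ r ih =>
    refine ih.bind fun h hh => ?_
    intro h' hh'
    rw [PMF.mem_support_map_iff] at hh'
    obtain ⟨m, hm, rfl⟩ := hh'
    obtain ⟨o, ho⟩ := (sim_query G (f h) hπ (fun c => (hh c).1) hL).ensures m hm
    exact ho.validState hh

omit [NeZero n] in
-- Only cell `0` and the cells within `L` of `t` can change. Positions are added up to `t` or up to
-- an already recorded time, so no address exceeds the largest queried time.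
lemma Answered.storeBits_le {σ : Store} {t L Θ M N : ℕ} {m : Config} {o : Option (ℕ → Fin n)}
    (h : Answered n (marked σ) t (IsNew L (marked σ) t) Θ M m o) (hσ : ValidState n N σ) :
    storeBits m.store
      ≤ storeBits σ + (2 * L + 2) * (Nat.size (max t N) + Nat.size n) := by
  refine (storeBits_le_add (σ := σ) (S := insert 0 (Finset.Icc (t - L) (t + L)))
    (b := Nat.size (max t N) + Nat.size n) ?_ ?_).trans ?_
  · intro c hc
    rw [Finset.mem_insert, Finset.mem_Icc] at hc
    rw [h.storeOut c, marked_apply_of_ne (fun h0 => hc (Or.inl h0))]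
    intro hn
    have := hn.le
    have := hn.lt
    exact hc (Or.inr (by omega))
  · intro c _ hc
    obtain ⟨h1, h2⟩ := h.validState hσ c
    exact add_le_add (Nat.size_le_size (h2 hc)) (Nat.size_le_size h1)
  · refine Nat.add_le_add_left (Nat.mul_le_mul_right _ ?_) _
    refine (Finset.card_insert_le _ _).trans ?_
    rw [Nat.card_Icc]
    omega

end States

/-! ### Numerical bounds on time, space and word length -/

section Estimates

lemma size_le_log {x : ℕ} {y : ℝ} (h1 : 1 ≤ y) (h : (x : ℝ) ≤ y) :
    (Nat.size x : ℝ) ≤ 1 + 2 * Real.log y := by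
  have hy := Real.log_nonneg h1
  rcases Nat.eq_zero_or_pos (Nat.size x) with h0 | h0
  · rw [h0, Nat.cast_zero]
    linarith
  obtain ⟨k, hk⟩ := Nat.exists_eq_add_of_le' h0
  have h2 : 2 ^ k ≤ x := Nat.lt_size.1 (by omega)
  have h3 : (2 : ℝ) ^ k ≤ y := le_trans (by exact_mod_cast h2) h
  have h4 := Real.log_le_log (by positivity) h3
  rw [Real.log_pow] at h4
  have h5 := Real.log_two_gt_d9
  have h6 : (k : ℝ) * (1 / 2) ≤ k * Real.log 2 :=
    mul_le_mul_of_nonneg_left (by linarith) (Nat.cast_nonneg k)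
  rw [hk]
  push_cast
  linarith

lemma peak_arith {t n B nB E Λ ρ s g : ℕ} (hΛ1 : 1 ≤ Λ) (hg : 1 ≤ g) (hρ : ρ ≤ Λ) (hsΛ : s ≤ Λ)
    (hn : n ≤ Λ) (hB : B ≤ Λ) (hnB : nB ≤ Λ) (hE : E ≤ Λ) :
    t + 2 * (20 * (ρ * g)) + (n + 1) + (n + 640 * (ρ * s * (ρ * g))) +
      (t + (B + (nB + (E + (Λ + (ρ + (g + (10 + (10 * ρ + (20 * (ρ * g) + (n + (2 + (s + (32 +
        (32 * ρ + (32 * (ρ * s) + 0))))))))))))))))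
      ≤ 1024 * ((t + 1) * Λ ^ 3 * g) := by
  have e1 : ρ * g ≤ Λ * g := Nat.mul_le_mul_right _ hρ
  have e2 : ρ * s ≤ Λ * Λ := Nat.mul_le_mul hρ hsΛ
  have e3 : ρ * s * (ρ * g) ≤ Λ * Λ * (Λ * g) := Nat.mul_le_mul e2 e1
  have q1 : Λ * Λ * (Λ * g) ≤ (t + 1) * Λ ^ 3 * g := by
    rw [show (t + 1) * Λ ^ 3 * g = Λ * Λ * (Λ * g) * (t + 1) by ring]
    exact Nat.le_mul_of_pos_right _ (by omega)
  have q2 : Λ * Λ ≤ Λ * Λ * (Λ * g) := Nat.le_mul_of_pos_right _ (Nat.mul_pos hΛ1 hg)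
  have q3 : Λ * g ≤ Λ * Λ * (Λ * g) := Nat.le_mul_of_pos_left _ (Nat.mul_pos hΛ1 hΛ1)
  have q4 : Λ ≤ Λ * g := Nat.le_mul_of_pos_right _ hg
  have q5 : g ≤ Λ * g := Nat.le_mul_of_pos_left _ hΛ1
  have q6 : t + 1 ≤ (t + 1) * Λ ^ 3 * g := by
    rw [mul_assoc]
    exact Nat.le_mul_of_pos_right _ (Nat.mul_pos (Nat.pow_pos hΛ1) hg)
  generalize (t + 1) * Λ ^ 3 * g = Q at *
  generalize ρ * s * (ρ * g) = z1 at *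
  generalize Λ * Λ * (Λ * g) = z2 at *
  generalize ρ * g = z3 at *
  generalize ρ * s = z4 at *
  generalize Λ * g = z5 at *
  generalize Λ * Λ = z6 at *
  linarith

/-- A crude polynomial bound suffices, since only the length of the words counts. -/
lemma peakBound_le {π : Params} {t : ℕ} (hn : 1 ≤ π.n) (hB : 1 ≤ π.B) (hE : 1 ≤ π.invEps)
    (hg : 1 ≤ π.invGap) :
    π.peakBound 10 32 t
      ≤ 1024 * ((t + 1) * (π.n * π.B * π.invEps) ^ 3 * π.invGap) := by
  have hΛ1 : 1 ≤ π.n * π.B * π.invEps := Nat.mul_pos (Nat.mul_pos hn hB) hE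
  obtain ⟨-, hρ⟩ := two_pow_logAcc_bounds π hΛ1
  have hnB : π.n * π.B ≤ π.n * π.B * π.invEps := Nat.le_mul_of_pos_right _ hE
  have hEΛ : π.invEps ≤ π.n * π.B * π.invEps := Nat.le_mul_of_pos_left _ (Nat.mul_pos hn hB)
  have hn' : π.n ≤ π.n * π.B := Nat.le_mul_of_pos_right _ hB
  have hB' : π.B ≤ π.n * π.B := Nat.le_mul_of_pos_left _ hn
  have hs : π.root ≤ π.n := (Nat.le_mul_self _).trans (root_bounds π hn).1
  have hw : π.window 10 = 20 * (π.logAcc * π.invGap) := by rw [Params.window]; ring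
  have hk : π.numWalks 32 = 32 * (π.logAcc * π.root) := by rw [Params.numWalks]; ring
  have hwk : π.numWalks 32 * π.window 10
      = 640 * (π.logAcc * π.root * (π.logAcc * π.invGap)) := by
    rw [hw, hk]; ring
  rw [Params.peakBound, hwk]
  simp only [hw, hk, List.sum_cons, List.sum_nil]
  exact peak_arith hΛ1 hg hρ (hs.trans (hn'.trans hnB)) (hn'.trans hnB) (hB'.trans hnB) hnB hEΛ

lemma log_le_three_mul_root (π : Params) : Nat.log 2 π.n ≤ 3 * π.root := by
  have h : Nat.log 2 π.n / 2 < 2 ^ (Nat.log 2 π.n / 2) := Nat.lt_two_pow_self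
  rw [Params.root]
  omega

/-- The size of the parameters in terms of the quantities in the resource bounds. -/
structure ParamBounds (π : Params) (ℓ γ : ℝ) : Prop where
  ℓ_ge : 1 / 3 ≤ ℓ
  γ_ge : 1 ≤ γ
  n_ge : 3 ≤ π.n
  B_ge : 1 ≤ π.B
  invEps_ge : 1 ≤ π.invEps
  invGap_ge : 1 ≤ π.invGap
  invGap_le : (π.invGap : ℝ) ≤ 2 * γ
  log_le : Real.log (π.n * π.B * π.invEps) ≤ 2 + ℓ

lemma paramBounds {n B : ℕ} {ε lam : ℝ} (hn : 3 ≤ n) (hB : 1 ≤ B) (h0 : 0 ≤ lam)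
    (h1 : lam < 1) (hε : 0 < ε) (hε2 : ε < 2) :
    ParamBounds (params n B ε lam) (Real.log (n * B / ε)) (1 / (1 - lam)) := by
  have hnR : (3 : ℝ) ≤ n := by exact_mod_cast hn
  have hBR : (1 : ℝ) ≤ B := by exact_mod_cast hB
  have hnB : (3 : ℝ) ≤ n * B := by nlinarith
  have hγ : 1 ≤ 1 / (1 - lam) := by
    rw [le_div_iff₀ (by linarith)]
    linarith
  -- `n ≥ 3` and `ε < 2` keep `n B / ε` away from one, so that additive constants can be absorbed
  -- into its logarithm.
  have hx : 3 / 2 ≤ (n : ℝ) * B / ε := by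
    rw [le_div_iff₀ hε]
    linarith
  have hE : ((params n B ε lam).invEps : ℝ) ≤ 3 / ε := by
    have h2 := (Nat.ceil_lt_add_one (show 0 ≤ 1 / ε by positivity)).le
    refine h2.trans ?_
    rw [div_add_one hε.ne']
    exact div_le_div_of_nonneg_right (by linarith) hε.le
  refine ⟨?_, hγ, hn, hB, one_le_invEps hε, one_le_invGap h1, ?_, ?_⟩
  · refine le_trans ?_ (Real.one_sub_inv_le_log_of_pos (by linarith))
    have := inv_anti₀ (by norm_num) hx
    norm_num at this ⊢
    linarith
  · have h2 := (Nat.ceil_lt_add_one (show 0 ≤ 1 / (1 - lam) by linarith)).le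
    refine h2.trans (by linarith)
  · have hE1 : (1 : ℝ) ≤ (params n B ε lam).invEps := by exact_mod_cast one_le_invEps hε
    have h3 : Real.log 3 ≤ 2 := by
      have := Real.log_le_sub_one_of_pos (show (0 : ℝ) < 3 by norm_num)
      linarith
    have h4 : (n : ℝ) * B * (params n B ε lam).invEps ≤ 3 * (n * B / ε) := by
      refine (mul_le_mul_of_nonneg_left hE (by positivity)).trans (le_of_eq ?_)
      ring
    have h5 := Real.log_le_log (by positivity) h4
    rw [Real.log_mul (x := 3) (by norm_num) (by positivity)] at h5
    change Real.log ((n : ℝ) * B * (params n B ε lam).invEps) ≤ _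
    linarith

namespace ParamBounds

variable {π : Params} {ℓ γ τ : ℝ} (H : ParamBounds π ℓ γ)
include H

lemma one_le_prod : (1 : ℝ) ≤ π.n * π.B * π.invEps := by
  have := Nat.mul_pos (Nat.mul_pos (show 0 < π.n by have := H.n_ge; omega) H.B_ge) H.invEps_ge
  exact_mod_cast this

/-- The logarithm to base two is at most twice the natural one, which gives `5 + 2 ℓ`; and `5 ≤ 15
ℓ`. -/
lemma logAcc_le : (π.logAcc : ℝ) ≤ 17 * ℓ := by
  have h1 := H.one_le_prod
  have h2 : 2 ^ Nat.log 2 (π.n * π.B * π.invEps) ≤ π.n * π.B * π.invEps :=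
    Nat.pow_log_le_self 2 (by
      have : 1 ≤ π.n * π.B * π.invEps := by exact_mod_cast h1
      omega)
  have h3 : (2 : ℝ) ^ Nat.log 2 (π.n * π.B * π.invEps) ≤ π.n * π.B * π.invEps := by
    exact_mod_cast h2
  have h4 := (Real.log_le_log (by positivity) h3).trans H.log_le
  rw [Real.log_pow] at h4
  have h5 := Real.log_two_gt_d9
  have h6 : (Nat.log 2 (π.n * π.B * π.invEps) : ℝ) * (1 / 2)
      ≤ Nat.log 2 (π.n * π.B * π.invEps) * Real.log 2 :=
    mul_le_mul_of_nonneg_left (by linarith) (Nat.cast_nonneg _)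
  have h7 := H.ℓ_ge
  rw [Params.logAcc]
  push_cast
  linarith

lemma window_le : (π.window 10 : ℝ) ≤ 680 * (ℓ * γ) := by
  have h1 := H.logAcc_le
  have h2 := H.invGap_le
  have h3 := H.ℓ_ge
  have h4 : (π.logAcc : ℝ) * π.invGap ≤ 17 * ℓ * (2 * γ) :=
    mul_le_mul h1 h2 (Nat.cast_nonneg _) (by linarith)
  rw [Params.window]
  push_cast
  linarith

lemma numWalks_le : (π.numWalks 32 : ℝ) ≤ 544 * (ℓ * √π.n) := by
  have h1 := H.logAcc_le
  have h2 : (π.root : ℝ) ≤ √π.n := by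
    refine Real.le_sqrt_of_sq_le ?_
    rw [sq]
    exact_mod_cast (root_bounds π (by have := H.n_ge; omega)).1
  have h3 := H.ℓ_ge
  have h4 : (π.logAcc : ℝ) * π.root ≤ 17 * ℓ * √π.n :=
    mul_le_mul h1 h2 (Nat.cast_nonneg _) (by linarith)
  rw [Params.numWalks]
  push_cast
  linarith

lemma window_pos : 1 ≤ π.window 10 := by
  have := Nat.mul_pos (show 0 < π.logAcc from Nat.succ_pos _) H.invGap_ge
  rw [Params.window, mul_assoc]
  omega

/-- The number of steps is at most `90` times the product of the number of walks and the window, and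
`90 · 544 · 680 < 40000000`. -/
lemma time_le (hτ : 1 ≤ τ) :
    ((π.numWalks 32 * (9 * π.window 10 + 12) + 16 * π.window 10 + 50 + Nat.log 2 π.n : ℕ) : ℝ)
      ≤ 40000000 * (√π.n * τ * γ * ℓ ^ 2) := by
  have h1 := H.window_pos
  have hr : 1 ≤ π.root := Nat.pow_pos (by norm_num)
  have h2 : π.root ≤ π.numWalks 32 := by
    rw [Params.numWalks]
    exact Nat.le_mul_of_pos_left _ (by rw [Params.logAcc]; omega)
  have h3 := log_le_three_mul_root π
  have h4 : π.numWalks 32 * (9 * π.window 10 + 12) + 16 * π.window 10 + 50 + Nat.log 2 π.n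
      ≤ 90 * (π.numWalks 32 * π.window 10) := by
    have a1 : π.numWalks 32 ≤ π.numWalks 32 * π.window 10 := Nat.le_mul_of_pos_right _ h1
    have a2 : π.window 10 ≤ π.numWalks 32 * π.window 10 :=
      Nat.le_mul_of_pos_left _ (by omega)
    rw [mul_add, ← mul_assoc, mul_comm _ 9, mul_assoc]
    omega
  have h5 := mul_le_mul H.numWalks_le H.window_le (Nat.cast_nonneg _) (by
    have := H.ℓ_ge
    positivity)
  have h6 : (0 : ℝ) ≤ √π.n * γ * ℓ ^ 2 := by
    have := H.γ_ge
    positivity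
  have h7 : √π.n * γ * ℓ ^ 2 * 1 ≤ √π.n * γ * ℓ ^ 2 * τ := mul_le_mul_of_nonneg_left hτ h6
  have h8 : ((π.numWalks 32 * (9 * π.window 10 + 12) + 16 * π.window 10 + 50
      + Nat.log 2 π.n : ℕ) : ℝ) ≤ 90 * (π.numWalks 32 * π.window 10) := by exact_mod_cast h4
  nlinarith

lemma one_le_log {t : ℕ} : 1 ≤ Real.log (π.n * (t + 1)) := by
  have h : (3 : ℝ) ≤ π.n := by exact_mod_cast H.n_ge
  have ht : (0 : ℝ) ≤ t := Nat.cast_nonneg t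
  rw [Real.le_log_iff_exp_le (by positivity)]
  nlinarith [Real.exp_one_lt_three]

lemma space_le {N : ℕ} :
    (((2 * π.window 10 + 2) * (Nat.size N + Nat.size π.n) : ℕ) : ℝ)
      ≤ 40000000 * (Real.log (π.n * (N + 1)) * γ * ℓ) := by
  have hτ := H.one_le_log (t := N)
  have hn : (3 : ℝ) ≤ π.n := by exact_mod_cast H.n_ge
  have hN : (0 : ℝ) ≤ N := Nat.cast_nonneg N
  have h1 := size_le_log (x := N) (y := N + 1) (by linarith) (by linarith)
  have h2 := size_le_log (x := π.n) (y := π.n) (by linarith) le_rfl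
  have hlog : Real.log (π.n * (N + 1)) = Real.log π.n + Real.log (N + 1) :=
    Real.log_mul (by positivity) (by positivity)
  have h3 : ((Nat.size N + Nat.size π.n : ℕ) : ℝ) ≤ 4 * Real.log (π.n * (N + 1)) := by
    push_cast
    linarith
  have h4 : ((2 * π.window 10 + 2 : ℕ) : ℝ) ≤ 4 * (680 * (ℓ * γ)) := by
    have h5 : (1 : ℝ) ≤ π.window 10 := by exact_mod_cast H.window_pos
    have h6 := H.window_le
    push_cast
    linarith
  have hℓ := H.ℓ_ge
  have hγ := H.γ_ge
  have h5 : 0 ≤ Real.log (π.n * (N + 1)) * γ * ℓ := by positivity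
  rw [Nat.cast_mul]
  refine (mul_le_mul h4 h3 (Nat.cast_nonneg _) (by positivity)).trans ?_
  linarith

lemma word_le {t : ℕ} :
    (Nat.size (π.peakBound 10 32 t) : ℝ)
      ≤ 40000000 * (Real.log (π.n * (t + 1)) + ℓ + Real.log γ) := by
  have hτ := H.one_le_log (t := t)
  have hn : (3 : ℝ) ≤ π.n := by exact_mod_cast H.n_ge
  have ht : (0 : ℝ) ≤ t := Nat.cast_nonneg t
  have hg : (1 : ℝ) ≤ π.invGap := by exact_mod_cast H.invGap_ge
  have hΛ := H.one_le_prod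
  have h1 : ((π.peakBound 10 32 t : ℕ) : ℝ)
      ≤ 1024 * ((t + 1) * (π.n * π.B * π.invEps) ^ 3 * π.invGap) := by
    exact_mod_cast peakBound_le (by have := H.n_ge; omega) H.B_ge H.invEps_ge H.invGap_ge
  have hlogΛ := H.log_le
  generalize (π.n * π.B * π.invEps : ℝ) = Λ at *
  have h2 : (1 : ℝ) ≤ (t + 1) * Λ ^ 3 * π.invGap :=
    one_le_mul_of_one_le_of_one_le (one_le_mul_of_one_le_of_one_le (by linarith)
      (one_le_pow₀ hΛ)) hg
  have h3 := size_le_log (by linarith) h1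
  rw [Real.log_mul (by norm_num) (by positivity), Real.log_mul (by positivity) (by positivity),
    Real.log_mul (by positivity) (by positivity), Real.log_pow] at h3
  have h4 : Real.log 1024 ≤ 1023 := by
    have := Real.log_le_sub_one_of_pos (show (0 : ℝ) < 1024 by norm_num)
    linarith
  have h5 : Real.log π.invGap ≤ 1 + Real.log γ := by
    have hγ := H.γ_ge
    have h6 := Real.log_le_log (by positivity) H.invGap_le
    rw [Real.log_mul (by norm_num) (by positivity)] at h6
    have := Real.log_le_sub_one_of_pos (show (0 : ℝ) < 2 by norm_num)
    linarith
  have h6 : Real.log (t + 1) ≤ Real.log (π.n * (t + 1)) :=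
    Real.log_le_log (by positivity) (by nlinarith)
  have hℓ := H.ℓ_ge
  have hγ := Real.log_nonneg H.γ_ge
  push_cast at h3
  linarith

end ParamBounds

end Estimates

/-- The simulation provides the meters of every run. The working space is at most the time, as each
access to a cell costs a step and no cell is touched at the start. -/
lemma resources {n : ℕ} [NeZero n] (G : SimpleGraph (Fin n)) [DecidableRel G.Adj] {d : ℕ}
    (hd : 1 ≤ d) (hG : G.IsRegularOfDegree d) {lam ε : ℝ} {B : ℕ} (h0 : 0 ≤ lam) (h1 : lam < 1)
    (hlam : spectralExpansion G d ≤ lam) (hε : 0 < ε) (hε2 : ε < 2) (hB : 1 ≤ B)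
    {f : List Round → ℕ} {r : ℕ} {h : List Round}
    (hh : h ∈ (interaction G (accessProgram 10 32) (params n B ε lam) f r).support) {m : Config}
    (hm : m ∈ (query G (accessProgram 10 32) (params n B ε lam) h (f h)).support) :
    (m.time : ℝ) ≤ 40000000 * (√(n : ℝ) * Real.log (n * (f h + 1)) * (1 / (1 - lam))
        * Real.log (n * B / ε) ^ 2) ∧
    (m.touched.card : ℝ) ≤ 40000000 * (√(n : ℝ) * Real.log (n * (f h + 1)) * (1 / (1 - lam))
        * Real.log (n * B / ε) ^ 2) ∧
    (storeBits m.store : ℝ) ≤ storeBits (currentState h)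
      + 40000000 * (Real.log (n * (max (f h) (maxTime h) + 1)) * (1 / (1 - lam))
        * Real.log (n * B / ε)) ∧
    (Nat.size m.peak : ℝ) ≤ 40000000 * (Real.log (n * (f h + 1)) + Real.log (n * B / ε)
        + Real.log (1 / (1 - lam))) := by
  have hn3 := three_le_card G hd hG h1 hlam
  have H := paramBounds hn3 hB h0 h1 hε hε2
  have hpn : (params n B ε lam).n = n := rfl
  have ht := (ensures_touched G _ _) m hm
  have hst := validState_of_interaction G hpn H.window_pos f r h hh
  obtain ⟨o, ho⟩ := (sim_query G (f h) hpn (fun c => (hst c).1) H.window_pos).ensures m hm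
  have htime := ho.time
  have hspace := ho.storeBits_le hst
  have hpeak := Nat.size_le_size ho.peak
  generalize params n B ε lam = π at *
  subst hpn
  have t1 := H.time_le (H.one_le_log (t := f h))
  have t2 : (m.time : ℝ) ≤ _ := (Nat.cast_le.2 htime).trans t1
  refine ⟨t2, ?_, ?_, ?_⟩
  · refine le_trans (Nat.cast_le.2 ?_) t2
    simpa [startConfig] using ht
  · have := H.space_le (N := max (f h) (maxTime h))
    refine (Nat.cast_le.2 hspace).trans ?_
    rw [Nat.cast_add]
    linarith
  · exact (Nat.cast_le.2 hpeak).trans H.word_le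

end WalkAccess

end

open WalkAccess in
theorem theorem3p1 :
    ∃ (P : Cmd) (C : ℝ), 0 < C ∧
      ∀ (n d : ℕ) [NeZero n] (G : SimpleGraph (Fin n)) [DecidableRel G.Adj],
        1 ≤ d → G.IsRegularOfDegree d →
      ∀ (lam ε : ℝ) (B : ℕ), 0 ≤ lam → lam < 1 → spectralExpansion G d ≤ lam →
        0 < ε → ε < 2 →
      -- accuracy
      IsLocalAccess G P (params n B ε lam) B ε ∧
      IsRobust G P (params n B ε lam) B ε ∧
      -- resources of every query in every possible run
      ∀ (f : List Round → ℕ) (r : ℕ), r < B →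
      ∀ h ∈ (interaction G P (params n B ε lam) f r).support,
      ∀ m ∈ (query G P (params n B ε lam) h (f h)).support,
        -- time
        (m.time : ℝ) ≤ C * (√(n : ℝ) * Real.log (n * (f h + 1)) * (1 / (1 - lam))
            * Real.log (n * B / ε) ^ 2) ∧
        -- working space
        (m.touched.card : ℝ) ≤ C * (√(n : ℝ) * Real.log (n * (f h + 1)) * (1 / (1 - lam))
            * Real.log (n * B / ε) ^ 2) ∧
        -- additional space
        (storeBits m.store : ℝ) ≤ storeBits (currentState h)
          + C * (Real.log (n * (max (f h) (maxTime h) + 1)) * (1 / (1 - lam))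
            * Real.log (n * B / ε)) ∧
        -- word length
        (Nat.size m.peak : ℝ) ≤ C * (Real.log (n * (f h + 1)) + Real.log (n * B / ε)
            + Real.log (1 / (1 - lam))) := by
  refine ⟨accessProgram 10 32, 40000000, by norm_num, ?_⟩
  intro n d _ G _ hd hG lam ε B h0 h1 hlam hε hε2
  obtain ⟨ha, hr⟩ := isAccurate hd hG h0 h1 hlam hε
  exact ⟨ha, hr, fun f r hr h hh m hm => resources G hd hG h0 h1 hlam hε hε2 (by omega) hh hm⟩
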